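/- **Setting.** Let $n\ge 1$ and let $(M,\omega,X,L)$ be a Liouville quadruple: $(M,\omega)$ is a compact $2n$-dimensional symplectic manifold with boundary, $X$ is a vector field on $M$ with $L_X\omega=\omega$ that points strictly outwards on $\partial M$, and $L\subset M$ is a compact embedded Lagrangian submanifold, transverse to $\partial M$, with $\partial L=L\cap\partial M$ and $X_q\in T_qL$ for all $q\in L$. Put $\lambda=i_X\omega$. Let $\hat M=M\cup\partial M\times[1,\infty)$ be the completion, with $\hat X$ equal to $X$ on $M$ and to $\rho\,\partial_\rho$ on $\partial M\times[1,\infty)$, $\hat\lambda$ equal to $\lambda$ on $M$ and to $\rho\lambda$ on $\partial M\times[1,\infty)$, $\hat\omega=d\hat\lambda$, and $\hat L=L\cup\partial L\times[1,\infty)$. Points of the cylindrical part of $\hat M$ are written $(z,\rho)\in\partial M\times(0,\infty)$, by means of the map $\Phi:\partial M\times(0,\infty)\to\hat M$ with $\Phi(z,1)=z$ and $\partial_\rho\Phi=\rho^{-1}\hat X(\Phi)$. **Hamiltonians.** For a compact set $K\supset M$ in $\hat M$, let $\mathcal H_K$ be the set of $H\in C^\infty(\hat M)$ for which there are a smooth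 function $a_H:\partial M\to(0,\infty)$ and $b_H\in\mathbb R$ with $H(z,\rho)=a_H(z)\rho+b_H$ for all $(z,\rho)\in\hat M\setminus K$. Define $X_H$ by $dH=-i_{X_H}\hat\omega$, and let $\mathcal C(H)$ be the set of $x:[0,1]\to\hat M$ with $\dot x=X_H(x)$ and $x(0),x(1)\in\hat L$. Such an $x$ is nondegenerate if the differential at $x(0)$ of the time-one flow of $X_H$ maps $T_{x(0)}\hat L$ to a subspace that meets $T_{x(1)}\hat L$ only in $0$. A function $H\in\bigcup_K\mathcal H_K$ is admissible if all elements of $\mathcal C(H)$ are nondegenerate and $1$ is not the action $\int_0^l x^*\mu$ of a Reeb chord $x:[0,l]\to\partial M$, $l>0$, $x(0),x(l)\in\partial L$, of the contact form $\mu=a_H^{-1}\lambda$ on $\partial M$. A monotone homotopy between admissible $H$ and $H'$ is a smooth family $(H^s)_{s\in\mathbb R}$ with $H^s\in\mathcal H_K$ for all $s$ and one compact $K\supset M$, such that for some $s_0>0$: $H^s=H$ for $s\le-s_0$, $H^s=H'$ for $s\ge s_0$, and $\partial_sH^s>0$ on $\hat M$ and $\partial_sa_{H^s}>0$ on $\partial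 M$ for $s\in(-s_0,s_0)$. **Almost complex structures.** Let $\mathcal J$ be the set of smooth almost complex structures $J$ on $\hat M$ for which $(v,w)\mapsto\hat\omega(v,Jw)$ is a Riemannian metric. For a smooth function $a:\partial M\to(0,\infty)$ put $\Phi_a(z,\rho)=(z,a(z)^{-1}\rho)$ on $\partial M\times(0,\infty)$, $\lambda^a=a^{-1}\lambda$, $\xi^a=\ker\lambda^a\subset T\partial M$, and let $R^a$ be the Reeb vector field of $\lambda^a$. For a compact $K\supset M$, let $\mathcal J_{a,K}$ be the set of $J\in\mathcal J$ such that on $\Phi_a^{-1}(\hat M\setminus K)$ the structure $\Phi_a^*J$ preserves $\xi^a$ and acts on it as an almost complex structure $J^\infty$ of $\xi^a$ that does not depend on $\rho$, and $\Phi_a^*J(\partial_\rho)=\frac1{\rho c_J}R^a$ for some constant $c_J>0$. **Floer strips.** For a family $(H^s)$ of Hamiltonians, a smooth family $(J^s_t)_{s\in\mathbb R,t\in[0,1]}$ in $\mathcal J$ and chords $x_\pm$, a Floer strip from $x_-$ to $x_+$ is a smooth map $u:\mathbb R\times[0,1]\to\hat M$ with $\partial_su-J^s_t(\partial_tu-X_{H^s}(u))=0$,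 $u(\mathbb R\times\{0,1\})\subset\hat L$, and $u(s,\cdot)\to x_\pm$ uniformly on $[0,1]$ as $s\to\pm\infty$. **Theorem.** 1. Let $H$ be admissible and let $(J_t)_{t\in[0,1]}$ be a smooth family in $\mathcal J$ such that, for some compact $K\supset M$, $J_t\in\mathcal J_{a_H,K}$ for all $t$. Then there is a compact set $B\subset\hat M$ such that $u(\mathbb R\times[0,1])\subset B$ for all $x_-,x_+\in\mathcal C(H)$ and every Floer strip $u$ of $(H,J_t)$ from $x_-$ to $x_+$. 2. Let $H,H'$ be admissible, let $(H^s)_s$ be a monotone homotopy from $H$ to $H'$, and let $(J^s_t)_{s,t}$ be a smooth family in $\mathcal J$ such that, for some $s_0>0$, $J^s_t=J^{-s_0}_t$ for $s\le-s_0$ and $J^s_t=J^{s_0}_t$ for $s\ge s_0$. Suppose that there is a compact $K\supset M$ with $H^s\in\mathcal H_K$ and $J^s_t\in\mathcal J_{a_{H^s},K}$ for all $s,t$. Then there is a compact set $B\subset\hat M$ such that $u(\mathbb R\times[0,1])\subset B$ for all $x_-\in\mathcal C(H)$, $x_+\in\mathcal C(H')$ and every Floer strip $u$ of $(H^s,J^s_t)$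 from $x_-$ to $x_+$. -/

import Mathlib

open Set Filter Topology Manifold Bundle
open scoped ContDiff

noncomputable section

namespace Floer

section Forms

variable {E : Type*} [NormedAddCommGroup E] [NormedSpace ℝ E]
  {H : Type*} [TopologicalSpace H] (I : ModelWithCorners ℝ E H)
  {M : Type*} [TopologicalSpace M] [ChartedSpace H M]

/-- Fields of linear forms (`1`-forms) on a manifold, possibly with boundary. -/
abbrev OneForm : Type _ := ∀ p : M, TangentSpace I p →L[ℝ] ℝ

/-- Fields of bilinear forms on a manifold, possibly with boundary. -/
abbrev BilinForm : Type _ := ∀ p : M, TangentSpace I p →L[ℝ] TangentSpace I p →L[ℝ] ℝ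

variable {I}

/-- The `1`-form `α` is smooth. -/
def OneForm.Smooth [IsManifold I ∞ M] (α : OneForm I (M := M)) : Prop :=
  ContMDiff I (I.prod 𝓘(ℝ, E →L[ℝ] ℝ)) ∞
    (fun p : M => TotalSpace.mk' (E →L[ℝ] ℝ)
      (E := fun q : M => TangentSpace I q →L[ℝ] ℝ) p (α p))

/-- The field of bilinear forms `Ω` is smooth. -/
def BilinForm.Smooth [IsManifold I ∞ M] (Ω : BilinForm I (M := M)) : Prop :=
  ContMDiff I (I.prod 𝓘(ℝ, E →L[ℝ] E →L[ℝ] ℝ)) ∞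
    (fun p : M => TotalSpace.mk' (E →L[ℝ] E →L[ℝ] ℝ)
      (E := fun q : M => TangentSpace I q →L[ℝ] TangentSpace I q →L[ℝ] ℝ) p (Ω p))

/-- The derivative of the inverse of the chart at `p`, at the point `y` of the model space. -/
def chartInvDeriv (p : M) (y : E) :
    E →L[ℝ] TangentSpace I ((extChartAt I p).symm y) :=
  mfderivWithin 𝓘(ℝ, E) I (extChartAt I p).symm (range I) y

/-- The derivative at `p` of the chart at `p`. -/
def chartDeriv (p : M) : TangentSpace I p →L[ℝ] E :=
  mfderiv I 𝓘(ℝ, E) (extChartAt I p) p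

/-- A `1`-form expressed in the chart at `p`. -/
def OneForm.inChart (α : OneForm I (M := M)) (p : M) (y : E) : E →L[ℝ] ℝ :=
  (α ((extChartAt I p).symm y)).comp (chartInvDeriv p y)

/-- A field of bilinear forms expressed in the chart at `p`. -/
def BilinForm.inChart (Ω : BilinForm I (M := M)) (p : M) (y : E) : E →L[ℝ] E →L[ℝ] ℝ :=
  let A : E →L[ℝ] E := chartInvDeriv (I := I) p y
  let B : E →L[ℝ] E →L[ℝ] ℝ := Ω ((extChartAt I p).symm y)
  B.bilinearComp A A

/-- The exterior derivative of a `1`-form: in coordinates,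
`dα(v, w) = (∂_v α)(w) - (∂_w α)(v)`. -/
def OneForm.d (α : OneForm I (M := M)) (p : M) (v w : TangentSpace I p) : ℝ :=
  let D := fderivWithin ℝ (OneForm.inChart α p) (range I) (extChartAt I p p)
  let v' := chartDeriv p v
  let w' := chartDeriv p w
  D v' w' - D w' v'

/-- The exterior derivative of a `2`-form: in coordinates,
`dΩ(u, v, w) = (∂_u Ω)(v, w) - (∂_v Ω)(u, w) + (∂_w Ω)(u, v)`. -/
def BilinForm.d (Ω : BilinForm I (M := M)) (p : M) (u v w : TangentSpace I p) : ℝ :=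
  let D := fderivWithin ℝ (BilinForm.inChart Ω p) (range I) (extChartAt I p p)
  let u' := chartDeriv p u
  let v' := chartDeriv p v
  let w' := chartDeriv p w
  D u' v' w' - D v' u' w' + D w' u' v'

/-- The contraction `i_X Ω`. -/
def BilinForm.contract (X : ∀ p : M, TangentSpace I p) (Ω : BilinForm I (M := M)) :
    OneForm I (M := M) :=
  fun p => Ω p (X p)

/-- The Lie derivative of a `2`-form along a vector field, `L_X Ω = d(i_X Ω) + i_X dΩ`. -/
def BilinForm.lieDeriv (X : ∀ p : M, TangentSpace I p) (Ω : BilinForm I (M := M)) (p : M)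
    (v w : TangentSpace I p) : ℝ :=
  OneForm.d (BilinForm.contract X Ω) p v w + BilinForm.d Ω p (X p) v w

/-- Symplectic forms: smooth, alternating, nondegenerate, closed `2`-forms. -/
structure BilinForm.IsSymplectic [IsManifold I ∞ M] (Ω : BilinForm I (M := M)) : Prop where
  smooth : BilinForm.Smooth Ω
  alternating : ∀ p v, Ω p v v = 0
  nondegenerate : ∀ p v, (∀ w, Ω p v w = 0) → v = 0
  closed : ∀ p u v w, BilinForm.d Ω p u v w = 0

/-- `X` is a smooth vector field. -/
def SmoothVectorField [IsManifold I ∞ M] (X : ∀ p : M, TangentSpace I p) : Prop :=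
  ContMDiff I I.tangent ∞ (fun p : M => (⟨p, X p⟩ : TangentBundle I M))

/-- `R` is the Reeb vector at `z` of the contact form `μ`: `i_R dμ = 0` and `μ(R) = 1`. -/
def IsReebVector (μ : OneForm I (M := M)) (z : M) (R : TangentSpace I z) : Prop :=
  (∀ w, OneForm.d μ z R w = 0) ∧ μ z R = 1

end Forms

section

variable {E : Type*} [NormedAddCommGroup E] [NormedSpace ℝ E]
  {H : Type*} [TopologicalSpace H] (I : ModelWithCorners ℝ E H)
  {M : Type*} [TopologicalSpace M] [ChartedSpace H M]
  {E' : Type*} [NormedAddCommGroup E'] [NormedSpace ℝ E']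
  {H' : Type*} [TopologicalSpace H'] (I' : ModelWithCorners ℝ E' H')
  {M' : Type*} [TopologicalSpace M'] [ChartedSpace H' M']

/-- Injective immersions. When the source is compact and the target is Hausdorff, as everywhere
below, these are exactly the smooth embeddings. -/
structure IsSmoothInjImmersion (f : M → M') : Prop where
  contMDiff : ContMDiff I I' ∞ f
  injective : Function.Injective f
  immersion : ∀ p, Function.Injective (mfderiv I I' f p)

variable {I I'}

/-- The pullback `f^*α` of a `1`-form. -/
def OneForm.pullback (f : M → M') (α : OneForm I' (M := M')) : OneForm I (M := M) :=
  fun p => (α (f p)).comp (mfderiv I I' f p)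

/-- The velocity of a curve. -/
def velocity (I : ModelWithCorners ℝ E H) (γ : ℝ → M) (t : ℝ) : TangentSpace I (γ t) :=
  mfderiv 𝓘(ℝ, ℝ) I γ t (1 : ℝ)

/-- The velocity of a curve that is defined on the set `S` of times. -/
def velocityWithin (I : ModelWithCorners ℝ E H) (γ : ℝ → M) (S : Set ℝ) (t : ℝ) :
    TangentSpace I (γ t) :=
  mfderivWithin 𝓘(ℝ, ℝ) I γ S t (1 : ℝ)

/-- The vectors tangent at `p` to the (boundaryless) submanifold `S`: velocities of smooth curves
that lie in `S`. -/
def tangentVectors (I : ModelWithCorners ℝ E H) (S : Set M) (p : M) : Set (TangentSpace I p) :=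
  {v | ∃ γ : ℝ → M, ContMDiff 𝓘(ℝ, ℝ) I ∞ γ ∧ (∀ s, γ s ∈ S) ∧ γ 0 = p ∧
    HasMFDerivAt 𝓘(ℝ, ℝ) I γ 0 ((1 : ℝ →L[ℝ] ℝ).smulRight (v : E))}

open Classical in
/-- The flow of a vector field: `flow X t p` is the value at time `t` of the integral curve
of `X` that starts at `p` (and `p` if there is none that is defined for all times). -/
def flow (X : ∀ p : M, TangentSpace I p) (t : ℝ) (p : M) : M :=
  if h : ∃ γ : ℝ → M, IsMIntegralCurve γ X ∧ γ 0 = p then h.choose t else p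

end
section

variable (n : ℕ) [NeZero n]
  (M : Type*) [TopologicalSpace M] [ChartedSpace (EuclideanHalfSpace (2 * n)) M]
  [IsManifold (𝓡∂ (2 * n)) ∞ M]
  (N : Type*) [TopologicalSpace N] [ChartedSpace (EuclideanSpace ℝ (Fin (2 * n - 1))) N]
  [IsManifold (𝓡 (2 * n - 1)) ∞ N]
  (L : Type*) [TopologicalSpace L] [ChartedSpace (EuclideanHalfSpace n) L]
  [IsManifold (𝓡∂ n) ∞ L]

/-- A Liouville quadruple `(M, Ω, X, L)`: a symplectic form `Ω` and a Liouville vector field `X`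
on the `2n`-dimensional manifold with boundary `M` and a properly embedded Lagrangian submanifold
`L`. The manifold `M` is taken to be compact where this is used below; `N` is a copy of the
boundary of `M` as an abstract smooth manifold, and `L` is an abstract `n`-dimensional manifold
with boundary, embedded by `lag`. -/
structure LiouvilleQuadruple where
  /-- The symplectic form. -/
  Ω : BilinForm (𝓡∂ (2 * n)) (M := M)
  symplectic : BilinForm.IsSymplectic Ω
  /-- The Liouville vector field. -/
  X : ∀ p : M, TangentSpace (𝓡∂ (2 * n)) p
  smooth_X : SmoothVectorField X
  liouville : ∀ p v w, BilinForm.lieDeriv X Ω p v w = Ω p v w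
  /-- The identification of `N` with the boundary of `M`. -/
  bdry : N → M
  bdry_embedding : IsSmoothInjImmersion (𝓡 (2 * n - 1)) (𝓡∂ (2 * n)) bdry
  range_bdry : range bdry = (𝓡∂ (2 * n)).boundary M
  /-- `X` points strictly outwards: in a chart with values in the half space `{0 ≤ x₀}`, its
  zeroth component is negative. -/
  outward : ∀ z : N, (chartDeriv (bdry z) (X (bdry z)) : EuclideanSpace ℝ (Fin (2 * n))) 0 < 0
  /-- The embedding of `L`. -/
  lag : L → M
  lag_embedding : IsSmoothInjImmersion (𝓡∂ n) (𝓡∂ (2 * n)) lag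
  lagrangian : ∀ q v w,
    Ω (lag q) (mfderiv (𝓡∂ n) (𝓡∂ (2 * n)) lag q v) (mfderiv (𝓡∂ n) (𝓡∂ (2 * n)) lag q w) = 0
  tangent : ∀ q, X (lag q) ∈ range (mfderiv (𝓡∂ n) (𝓡∂ (2 * n)) lag q)
  boundary_lag : (𝓡∂ n).boundary L = lag ⁻¹' (𝓡∂ (2 * n)).boundary M
  /-- `L` is transverse to the boundary of `M`. -/
  transverse : ∀ q z, lag q = bdry z → ∀ v : EuclideanSpace ℝ (Fin (2 * n)),
    ∃ v₁ ∈ (range (mfderiv (𝓡∂ n) (𝓡∂ (2 * n)) lag q) : Set (EuclideanSpace ℝ (Fin (2 * n)))),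
    ∃ v₂ ∈ (range (mfderiv (𝓡 (2 * n - 1)) (𝓡∂ (2 * n)) bdry z) :
      Set (EuclideanSpace ℝ (Fin (2 * n)))),
    v = v₁ + v₂

end

section

variable {n : ℕ} [NeZero n]
  {M : Type*} [TopologicalSpace M] [ChartedSpace (EuclideanHalfSpace (2 * n)) M]
  [IsManifold (𝓡∂ (2 * n)) ∞ M]
  {N : Type*} [TopologicalSpace N] [ChartedSpace (EuclideanSpace ℝ (Fin (2 * n - 1))) N]
  [IsManifold (𝓡 (2 * n - 1)) ∞ N]
  {L : Type*} [TopologicalSpace L] [ChartedSpace (EuclideanHalfSpace n) L]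
  [IsManifold (𝓡∂ n) ∞ L]

namespace LiouvilleQuadruple

variable (Q : LiouvilleQuadruple n M N L)

/-- The `1`-form `λ = i_X Ω` on `M`. -/
def lam : OneForm (𝓡∂ (2 * n)) (M := M) := BilinForm.contract Q.X Q.Ω

/-- The contact form on the boundary: the restriction of `λ`. -/
def bdryLam : OneForm (𝓡 (2 * n - 1)) (M := N) := OneForm.pullback Q.bdry Q.lam

/-- The boundary of the Lagrangian, a Legendrian submanifold of the boundary of `M`. -/
def bdryLag : Set N := {z | Q.bdry z ∈ range Q.lag}

/-- The rescaled contact form `λ^a = a⁻¹ λ` on the boundary. -/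
def scaledLam (a : N → ℝ) : OneForm (𝓡 (2 * n - 1)) (M := N) := fun z => (a z)⁻¹ • Q.bdryLam z

/-- The action spectrum of the boundary of `L` for the contact form `μ`: the actions `∫ x^*μ` of
the Reeb chords `x : [0, l] → ∂M`, `l > 0`, with end points on `∂L`. -/
def actionSpectrum (μ : OneForm (𝓡 (2 * n - 1)) (M := N)) : Set ℝ :=
  {A | ∃ (l : ℝ) (x : ℝ → N), 0 < l ∧
    ContMDiffOn 𝓘(ℝ, ℝ) (𝓡 (2 * n - 1)) ∞ x (Icc 0 l) ∧
    x 0 ∈ Q.bdryLag ∧ x l ∈ Q.bdryLag ∧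
    (∀ t ∈ Icc 0 l, IsReebVector μ (x t) (velocityWithin (𝓡 (2 * n - 1)) x (Icc 0 l) t)) ∧
    A = ∫ t in (0 : ℝ)..l, μ (x t) (velocityWithin (𝓡 (2 * n - 1)) x (Icc 0 l) t)}

end LiouvilleQuadruple

/-- The manifold `W`, with the `1`-form `lam`, the vector field `X` and the two maps `incl` and
`cyl`, is the completion `M ∪ ∂M × [1, ∞)` of the Liouville quadruple `Q`.
The map `cyl` is the parametrization `∂M × (0, ∞) → W` of the cylindrical part; `∂M × [1, ∞)` is
glued to `M` along `∂M = ∂M × {1}`. -/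
structure Completion (Q : LiouvilleQuadruple n M N L)
    (W : Type*) [TopologicalSpace W] [ChartedSpace (EuclideanSpace ℝ (Fin (2 * n))) W]
    [IsManifold (𝓡 (2 * n)) ∞ W] where
  /-- The inclusion of `M`. -/
  incl : M → W
  incl_embedding : IsSmoothInjImmersion (𝓡∂ (2 * n)) (𝓡 (2 * n)) incl
  /-- The parametrization `(z, ρ) ↦ cyl z ρ` of the cylindrical part; only `ρ > 0` matters. -/
  cyl : N → ℝ → W
  cyl_smooth : ContMDiffOn ((𝓡 (2 * n - 1)).prod 𝓘(ℝ, ℝ)) (𝓡 (2 * n)) ∞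
    (fun p : N × ℝ => cyl p.1 p.2) (univ ×ˢ Ioi 0)
  cyl_one : ∀ z, cyl z 1 = incl (Q.bdry z)
  /-- As a set, `W` is the union of `M` and `∂M × (1, ∞)`. -/
  cover : ∀ w, w ∈ range incl ∨ ∃ z ρ, 1 < ρ ∧ cyl z ρ = w
  disjoint : ∀ z ρ, 1 < ρ → cyl z ρ ∉ range incl
  cyl_injective : ∀ z z' ρ ρ', 1 ≤ ρ → 1 ≤ ρ' → cyl z ρ = cyl z' ρ' → z = z' ∧ ρ = ρ'
  /-- The Liouville vector field on `W`. It extends `X`, and it is `ρ ∂_ρ` on the cylindrical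
  part. -/
  X : ∀ w : W, TangentSpace (𝓡 (2 * n)) w
  smooth_X : SmoothVectorField X
  X_incl : ∀ p, X (incl p) = mfderiv (𝓡∂ (2 * n)) (𝓡 (2 * n)) incl p (Q.X p)
  deriv_cyl : ∀ z ρ, 0 < ρ → velocity (𝓡 (2 * n)) (cyl z) ρ = ρ⁻¹ • X (cyl z ρ)
  /-- The Liouville form on `W`. It extends `λ`, and it is `ρ λ` on `∂M × [1, ∞)`. -/
  lam : OneForm (𝓡 (2 * n)) (M := W)
  smooth_lam : OneForm.Smooth lam
  lam_incl : OneForm.pullback incl lam = Q.lam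
  lam_cyl : ∀ z ρ, 1 ≤ ρ →
    (∀ v, lam (cyl z ρ) (mfderiv (𝓡 (2 * n - 1)) (𝓡 (2 * n)) (fun z' => cyl z' ρ) z v) =
      ρ * Q.bdryLam z v) ∧
    lam (cyl z ρ) (velocity (𝓡 (2 * n)) (cyl z) ρ) = 0

variable {Q : LiouvilleQuadruple n M N L}
  {W : Type*} [TopologicalSpace W] [ChartedSpace (EuclideanSpace ℝ (Fin (2 * n))) W]
  [IsManifold (𝓡 (2 * n)) ∞ W]

namespace Completion

variable (C : Completion Q W)

/-- The symplectic form on the completion, the exterior derivative of the Liouville form. -/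
def Ω (x : W) (v w : TangentSpace (𝓡 (2 * n)) x) : ℝ := OneForm.d C.lam x v w

/-- The completed Lagrangian `L ∪ ∂L × [1, ∞)`. -/
def Lhat : Set W :=
  C.incl '' range Q.lag ∪ {w | ∃ z ∈ Q.bdryLag, ∃ ρ, 1 ≤ ρ ∧ C.cyl z ρ = w}

open Classical in
/-- The Hamiltonian vector field `X_H`, defined by `dH = - i_{X_H} Ω`. -/
def hamVF (H : W → ℝ) (x : W) : TangentSpace (𝓡 (2 * n)) x :=
  if h : ∃ v, ∀ w, (mfderiv (𝓡 (2 * n)) 𝓘(ℝ, ℝ) H x w : ℝ) = - C.Ω x v w then h.choose else 0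

/-- The Hamiltonian chords of `H`: curves `x : [0, 1] → W` with end points on the completed
Lagrangian and `dx/dt = X_H(x)`. Only the values on `[0, 1]` matter. -/
structure IsChord (H : W → ℝ) (x : ℝ → W) : Prop where
  left : x 0 ∈ C.Lhat
  right : x 1 ∈ C.Lhat
  eqn : IsMIntegralCurveOn x (C.hamVF H) (Icc 0 1)

/-- The chord `x` is nondegenerate: the image of `T L` at `x 0` under the time-one map of the
linearized flow of `X_H` meets `T L` at `x 1` only in zero. -/
def IsNondegenerate (H : W → ℝ) (x : ℝ → W) : Prop :=
  ∀ v ∈ tangentVectors (𝓡 (2 * n)) C.Lhat (x 0),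
    mfderiv (𝓡 (2 * n)) (𝓡 (2 * n)) (flow (C.hamVF H) 1) (x 0) v ∈
      tangentVectors (𝓡 (2 * n)) C.Lhat (flow (C.hamVF H) 1 (x 0)) →
    mfderiv (𝓡 (2 * n)) (𝓡 (2 * n)) (flow (C.hamVF H) 1) (x 0) v = 0

/-- `K` is a compact set that contains `M`. -/
def IsCore (K : Set W) : Prop := IsCompact K ∧ range C.incl ⊆ K

/-- `H` is of contact type outside `K`, with `H(z, ρ) = a(z) ρ + b` there. -/
structure IsContactTypeHam (K : Set W) (a : N → ℝ) (b : ℝ) (H : W → ℝ) : Prop where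
  core : C.IsCore K
  smooth : ContMDiff (𝓡 (2 * n)) 𝓘(ℝ, ℝ) ∞ H
  slope_smooth : ContMDiff (𝓡 (2 * n - 1)) 𝓘(ℝ, ℝ) ∞ a
  slope_pos : ∀ z, 0 < a z
  eq : ∀ z ρ, 0 < ρ → C.cyl z ρ ∉ K → H (C.cyl z ρ) = a z * ρ + b

/-- Admissible Hamiltonians: functions of contact type outside some compact set, such that `1` is
not in the action spectrum for the contact form `a_H⁻¹ λ`, and all chords are nondegenerate.
The function determines its `slope` `a_H` (and, if `M` is nonempty, its constant `b_H`). -/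
structure AdmissibleHam where
  /-- The function. -/
  toFun : W → ℝ
  /-- The function `a_H`. -/
  slope : N → ℝ
  /-- The constant `b_H`. -/
  const : ℝ
  contactType : ∃ K, C.IsContactTypeHam K slope const toFun
  one_notMem : (1 : ℝ) ∉ Q.actionSpectrum (Q.scaledLam slope)
  nondegenerate : ∀ x, C.IsChord toFun x → C.IsNondegenerate toFun x

variable {C} in
/-- Monotone homotopies `(H^s)_s` from `H` to `H'`. -/
structure MonotoneHomotopy (H H' : C.AdmissibleHam) where
  /-- The functions `H^s`. -/
  toFun : ℝ → W → ℝ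
  smooth : ContMDiff (𝓘(ℝ, ℝ).prod (𝓡 (2 * n))) 𝓘(ℝ, ℝ) ∞ (fun p : ℝ × W => toFun p.1 p.2)
  /-- The functions `a_{H^s}`. -/
  slope : ℝ → N → ℝ
  /-- The constants `b_{H^s}`. -/
  const : ℝ → ℝ
  contactType : ∃ K, ∀ s, C.IsContactTypeHam K (slope s) (const s) (toFun s)
  monotone : ∃ s₀ > 0,
    (∀ s ≤ -s₀, toFun s = H.toFun) ∧ (∀ s ≥ s₀, toFun s = H'.toFun) ∧
    ∀ s ∈ Ioo (-s₀) s₀,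
      (∀ x, 0 < deriv (fun σ => toFun σ x) s) ∧ ∀ z, 0 < deriv (fun σ => slope σ z) s

/-- Almost complex structures on the completion that are compatible with the symplectic form:
`(v, w) ↦ Ω(v, J w)` is a Riemannian metric. -/
structure CompatibleACS where
  /-- The endomorphisms `J`. -/
  toFun : ∀ x : W, TangentSpace (𝓡 (2 * n)) x →L[ℝ] TangentSpace (𝓡 (2 * n)) x
  smooth : ContMDiff (𝓡 (2 * n))
    ((𝓡 (2 * n)).prod 𝓘(ℝ, EuclideanSpace ℝ (Fin (2 * n)) →L[ℝ] EuclideanSpace ℝ (Fin (2 * n)))) ∞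
    (fun x : W => TotalSpace.mk'
      (EuclideanSpace ℝ (Fin (2 * n)) →L[ℝ] EuclideanSpace ℝ (Fin (2 * n)))
      (E := fun y : W => TangentSpace (𝓡 (2 * n)) y →L[ℝ] TangentSpace (𝓡 (2 * n)) y) x (toFun x))
  square : ∀ x v, toFun x (toFun x v) = -v
  symm : ∀ x v w, C.Ω x v (toFun x w) = C.Ω x w (toFun x v)
  pos : ∀ x v, v ≠ 0 → 0 < C.Ω x v (toFun x v)

variable {C} in
/-- The family `(J^s_t)`, `s ∈ ℝ`, `t ∈ [0, 1]`, is smooth. The members with `t ∉ [0, 1]` do not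
matter, here and below. -/
def SmoothACSFamily (J : ℝ → ℝ → C.CompatibleACS) : Prop :=
  ContMDiffOn (𝓘(ℝ, ℝ).prod (𝓘(ℝ, ℝ).prod (𝓡 (2 * n))))
    ((𝓡 (2 * n)).prod 𝓘(ℝ, EuclideanSpace ℝ (Fin (2 * n)) →L[ℝ] EuclideanSpace ℝ (Fin (2 * n)))) ∞
    (fun p : ℝ × ℝ × W => TotalSpace.mk'
      (EuclideanSpace ℝ (Fin (2 * n)) →L[ℝ] EuclideanSpace ℝ (Fin (2 * n)))
      (E := fun y : W => TangentSpace (𝓡 (2 * n)) y →L[ℝ] TangentSpace (𝓡 (2 * n)) y)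
      p.2.2 ((J p.1 p.2.1).toFun p.2.2))
    (univ ×ˢ Icc 0 1 ×ˢ univ)

/-- The map `Φ_a : ∂M × (0, ∞) → W`, `(z, ρ) ↦ (z, a(z)⁻¹ ρ)`. -/
def scaledCyl (a : N → ℝ) (z : N) (ρ : ℝ) : W := C.cyl z ((a z)⁻¹ * ρ)

/-- The image under the derivative of `Φ_a` at `(z, ρ)` of the vector `(v, 0)`, where `v` is
tangent to `∂M`. -/
def pushHor (a : N → ℝ) (z : N) (ρ : ℝ) (v : TangentSpace (𝓡 (2 * n - 1)) z) :
    TangentSpace (𝓡 (2 * n)) (C.scaledCyl a z ρ) :=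
  mfderiv (𝓡 (2 * n - 1)) (𝓡 (2 * n)) (fun z' => C.scaledCyl a z' ρ) z v

/-- The image under the derivative of `Φ_a` at `(z, ρ)` of the vector `∂_ρ`. -/
def pushRho (a : N → ℝ) (z : N) (ρ : ℝ) : TangentSpace (𝓡 (2 * n)) (C.scaledCyl a z ρ) :=
  velocity (𝓡 (2 * n)) (C.scaledCyl a z) ρ

variable {C} in
/-- The almost complex structure `J` is of contact type outside `K` with respect to `a`:
at all points of `∂M × (0, ∞)` that `Φ_a` maps outside `K`, the pulled back structure `Φ_a^*J`
preserves the contact distribution `ξ^a = ker λ^a`, acts on it as an almost complex structure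
`Jinf` of `ξ^a` that does not depend on `ρ`, and maps `∂_ρ` to `(ρ c)⁻¹ R^a`, where `R^a` is the
Reeb vector field of `λ^a` and `c > 0` is a constant. -/
def CompatibleACS.IsContactType (J : C.CompatibleACS) (K : Set W) (a : N → ℝ) : Prop :=
  C.IsCore K ∧
  (∃ Jinf : ∀ z : N, TangentSpace (𝓡 (2 * n - 1)) z → TangentSpace (𝓡 (2 * n - 1)) z,
    (∀ z v, Q.scaledLam a z v = 0 →
      Q.scaledLam a z (Jinf z v) = 0 ∧ Jinf z (Jinf z v) = -v) ∧
    ∀ z ρ, 0 < ρ → C.scaledCyl a z ρ ∉ K → ∀ v, Q.scaledLam a z v = 0 →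
      J.toFun (C.scaledCyl a z ρ) (C.pushHor a z ρ v) = C.pushHor a z ρ (Jinf z v)) ∧
  ∃ c > 0, ∀ z ρ, 0 < ρ → C.scaledCyl a z ρ ∉ K → ∃ R, IsReebVector (Q.scaledLam a) z R ∧
    J.toFun (C.scaledCyl a z ρ) (C.pushRho a z ρ) = (ρ * c)⁻¹ • C.pushHor a z ρ R

/-- Solutions `u : ℝ × [0, 1] → W` of the Floer equation
`∂_s u - J^s_t (∂_t u - X_{H^s}(u)) = 0` with boundary on the completed Lagrangian and with
`u(s, ·) → x_±`, uniformly on `[0, 1]`, for `s → ±∞`. Uniform convergence is expressed as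
continuous convergence, which is the same because `[0, 1]` is compact and the limits are
continuous. Values outside `ℝ × [0, 1]` do not matter. -/
structure IsFloerStrip (H : ℝ → W → ℝ) (J : ℝ → ℝ → C.CompatibleACS) (xm xp : ℝ → W)
    (u : ℝ × ℝ → W) : Prop where
  smooth : ContMDiffOn 𝓘(ℝ, ℝ × ℝ) (𝓡 (2 * n)) ∞ u (univ ×ˢ Icc 0 1)
  floer : ∀ s, ∀ t ∈ Icc (0 : ℝ) 1,
    velocity (𝓡 (2 * n)) (fun σ => u (σ, t)) s -
      (J s t).toFun (u (s, t))
        (velocityWithin (𝓡 (2 * n)) (fun τ => u (s, τ)) (Icc 0 1) t - C.hamVF (H s) (u (s, t))) = 0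
  boundary : ∀ s, u (s, 0) ∈ C.Lhat ∧ u (s, 1) ∈ C.Lhat
  limit_neg : ∀ t ∈ Icc (0 : ℝ) 1, Tendsto u (atBot ×ˢ 𝓝[Icc 0 1] t) (𝓝 (xm t))
  limit_pos : ∀ t ∈ Icc (0 : ℝ) 1, Tendsto u (atTop ×ˢ 𝓝[Icc 0 1] t) (𝓝 (xp t))

end Completion

end

end Floer

end

/-!
The two parts of the theorem are instances of one estimate, `exists_isCompact_floerStrips`, for a
family of Hamiltonians `H^s` that is constant in `s` near the two ends and does not decrease
(`FloerFamily`).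

**Scalar equations at infinity.** Far out on the cylindrical end, where `H^s = a_s ρ + b_s`, put
`f = a_s ρ` along a strip `u`, `α = λ(∂_t u)`, `γ = λ(∂_s u)`, `b = ∂_s log a_s` and `m = 1 / c_J`. As
`J` has contact type, `J X = m X_H`, and the Floer equation becomes

  `∂_s f = b f + (f - α) / m`, `∂_t f = γ / m`, `∂_s α - ∂_t γ = (f - α) / m - |∂_s u|²`

(`Strip.stripData`). The Liouville form vanishes on the completed Lagrangian, hence `γ = 0` on the
boundary of the strip (`lamv_eq_zero_of_mem_Lhat`), which is a Neumann condition for `f`. The second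
derivative test at a maximum of `f e^φ`, with `φ = φ(s)` sufficiently convex, yields a maximum
principle on rectangles. It costs a factor where the family depends on `s`
(`StripData.exists_factor`) and no factor where it does not (`StripData.le_of_stationary`). The only
term that is not bounded is the derivative of `b` in the direction of `∂_s u`. It is absorbed by the
energy density, because `b` is a function on `∂M` and the metrics scale on the end
(`exists_sq_dW_comp_pr_le`).

**Energy.** It remains to bound `f` on some slices `{s} × [0, 1]` on both sides of the interval in
which the family moves. The action `A(s) = ∫ (H^s(u) - α) dt` satisfies `A' ≥ ∫ |∂_s u|² dt`, because
the family does not decrease. Near its ends the strip is close to chords, so it stays in a compact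
set and `|A| ≤ c (1 + (A')^{1/2})` there. A function with these two properties cannot exceed `2 c`
without blowing up in finite time (`le_of_riccati`), so `A` is bounded by a constant that does not
depend on the strip. Hence every interval of length one contains an `s` at which the slice has
bounded energy (`exists_energy_bound`). Convergence of the derivatives of `u` at the ends is not
needed.

**Slices.** Slices of bounded energy, at an `s` where `H^s` is admissible, are bounded
(`exists_slice_bound`). Such slices satisfy `∂_t u = X_H - J ∂_s u`, and the projection of the error
`J ∂_s u` to `∂M` tends to zero in `L²` far out on the end. Slices that escape to infinity would
therefore converge, after projection, to a Reeb chord of action `1` of the contact form `a⁻¹ λ`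
(`exists_level_of_slice`). The limit is taken pointwise along an ultrafilter, and is an integral
curve of the Reeb vector field when tested against smooth functions
(`exists_limit_weakIntegralCurve`), which is enough for it to be smooth. The same argument, with
energy zero, bounds the chords (`exists_chord_bound`).

If the boundary of `M` is empty, then the completion is the image of `M` and so is compact.
-/

noncomputable section

set_option linter.unusedSectionVars false

namespace Floer

/-! ### Pullbacks of 1-forms and exterior derivatives -/

section Evaluate
variable {E : Type*} [NormedAddCommGroup E] [NormedSpace ℝ E]
  {H : Type*} [TopologicalSpace H] {I : ModelWithCorners ℝ E H}
  {M : Type*} [TopologicalSpace M] [ChartedSpace H M] [IsManifold I ∞ M]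
  {EP : Type*} [NormedAddCommGroup EP] [NormedSpace ℝ EP]
  {HP : Type*} [TopologicalSpace HP] {IP : ModelWithCorners ℝ EP HP}
  {P : Type*} [TopologicalSpace P] [ChartedSpace HP P]

theorem OneForm.Smooth.contMDiffWithinAt_apply {α : OneForm I (M := M)} (hα : OneForm.Smooth α)
    {b : P → M} {v : ∀ p, TangentSpace I (b p)} {s : Set P} {p : P}
    (hv : ContMDiffWithinAt IP I.tangent ∞ (fun q => (⟨b q, v q⟩ : TangentBundle I M)) s p) :
    ContMDiffWithinAt IP 𝓘(ℝ, ℝ) ∞ (fun q => α (b q) (v q)) s p := by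
  have hb : ContMDiffWithinAt IP I ∞ b s p := by
    have := (contMDiffWithinAt_totalSpace).1 hv
    exact this.1
  have h1 : ContMDiffWithinAt IP (I.prod 𝓘(ℝ, E →L[ℝ] ℝ)) ∞
      (fun q : P => TotalSpace.mk' (E →L[ℝ] ℝ)
        (E := fun q : M => TangentSpace I q →L[ℝ] Bundle.Trivial M ℝ q) (b q) (α (b q))) s p :=
    ContMDiffAt.comp_contMDiffWithinAt (x := p) (hα (b p)) hb
  have h2 := ContMDiffWithinAt.clm_bundle_apply (E₁ := fun q : M => TangentSpace I q)
    (E₂ := Bundle.Trivial M ℝ) (F₁ := E) (F₂ := ℝ) h1 hv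
  rw [contMDiffWithinAt_totalSpace] at h2
  exact h2.2

theorem OneForm.Smooth.contMDiffOn_apply {α : OneForm I (M := M)} (hα : OneForm.Smooth α)
    {b : P → M} {v : ∀ p, TangentSpace I (b p)} {s : Set P}
    (hv : ContMDiffOn IP I.tangent ∞ (fun q => (⟨b q, v q⟩ : TangentBundle I M)) s) :
    ContMDiffOn IP 𝓘(ℝ, ℝ) ∞ (fun q => α (b q) (v q)) s :=
  fun p hp => hα.contMDiffWithinAt_apply (hv p hp)
end Evaluate

section Pullback

variable {E : Type*} [NormedAddCommGroup E] [NormedSpace ℝ E]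
  {W : Type*} [TopologicalSpace W] [ChartedSpace E W] [IsManifold 𝓘(ℝ, E) ∞ W]
  {F : Type*} [NormedAddCommGroup F] [NormedSpace ℝ F]

/-- The vector field `y ↦ du_y(v)` along `u`, for a constant vector `v`, is smooth. -/
theorem contMDiffOn_mfderivWithin_const
    {H : Type*} [TopologicalSpace H] {I : ModelWithCorners ℝ E H}
    {M : Type*} [TopologicalSpace M] [ChartedSpace H M] [IsManifold I ∞ M]
    {u : F → M} {S : Set F} (hu : ContMDiffOn 𝓘(ℝ, F) I ∞ u S)
    (hS : UniqueDiffOn ℝ S) (v : F) :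
    ContMDiffOn 𝓘(ℝ, F) I.tangent ∞
      (fun y => (⟨u y, mfderivWithin 𝓘(ℝ, F) I u S y v⟩ : TangentBundle I M)) S := by
  have h1 := hu.contMDiffOn_tangentMapWithin (m := ∞) (by simp) hS.uniqueMDiffOn
  have h2 : ContMDiff 𝓘(ℝ, F) 𝓘(ℝ, F).tangent ∞ (fun y : F => (⟨y, v⟩ : TangentBundle 𝓘(ℝ, F) F)) := by
    intro y
    exact (contMDiffAt_section y).2 (by simpa using contMDiffAt_const)
  exact h1.comp h2.contMDiffOn (fun y hy => hy)

/-- The pullback `u^*α` of a `1`-form under a map from a vector space, with derivatives within `S`. -/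
def pullbackWithin (α : OneForm 𝓘(ℝ, E) (M := W)) (u : F → W) (S : Set F) (y : F) : F →L[ℝ] ℝ :=
  (α (u y) : E →L[ℝ] ℝ).comp (mfderivWithin 𝓘(ℝ, F) 𝓘(ℝ, E) u S y : F →L[ℝ] E)

theorem contDiffOn_pullbackWithin [FiniteDimensional ℝ F] {α : OneForm 𝓘(ℝ, E) (M := W)} (hα : OneForm.Smooth α)
    {u : F → W} {S : Set F} (hu : ContMDiffOn 𝓘(ℝ, F) 𝓘(ℝ, E) ∞ u S) (hS : UniqueDiffOn ℝ S) :
    ContDiffOn ℝ ∞ (pullbackWithin α u S) S := by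
  rw [contDiffOn_clm_apply]
  intro v
  rw [← contMDiffOn_iff_contDiffOn]
  exact hα.contMDiffOn_apply (contMDiffOn_mfderivWithin_const hu hS v)

theorem fderivWithin_extChartAt_comp {p : W} {u : F → W} {S : Set F} {y : F}
    (hy : u y ∈ (chartAt E p).source)
    (hu : MDifferentiableWithinAt 𝓘(ℝ, F) 𝓘(ℝ, E) u S y) (hS : UniqueDiffWithinAt ℝ S y) (v : F) :
    fderivWithin ℝ (extChartAt 𝓘(ℝ, E) p ∘ u) S y v =
      mfderiv 𝓘(ℝ, E) 𝓘(ℝ, E) (extChartAt 𝓘(ℝ, E) p) (u y)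
        (mfderivWithin 𝓘(ℝ, F) 𝓘(ℝ, E) u S y v) := by
  have e2 : HasMFDerivAt 𝓘(ℝ, E) 𝓘(ℝ, E) (extChartAt 𝓘(ℝ, E) p) (u y) _ :=
    (mdifferentiableAt_extChartAt hy).hasMFDerivAt
  let A : E →L[ℝ] E := mfderiv 𝓘(ℝ, E) 𝓘(ℝ, E) (extChartAt 𝓘(ℝ, E) p) (u y)
  let B : F →L[ℝ] E := mfderivWithin 𝓘(ℝ, F) 𝓘(ℝ, E) u S y
  have e3 : HasFDerivWithinAt (extChartAt 𝓘(ℝ, E) p ∘ u) (A.comp B) S y :=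
    hasMFDerivWithinAt_iff_hasFDerivWithinAt.1
      (e2.comp_hasMFDerivWithinAt y hu.hasMFDerivWithinAt)
  have e4 : fderivWithin ℝ (extChartAt 𝓘(ℝ, E) p ∘ u) S y = A.comp B := e3.fderivWithin hS
  rw [e4]
  rfl

theorem pullbackWithin_eq_inChart_comp (α : OneForm 𝓘(ℝ, E) (M := W)) {p : W} {u : F → W} {S : Set F} {y : F}
    (hy : u y ∈ (chartAt E p).source)
    (hu : MDifferentiableWithinAt 𝓘(ℝ, F) 𝓘(ℝ, E) u S y) (hS : UniqueDiffWithinAt ℝ S y) :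
    pullbackWithin α u S y =
      (OneForm.inChart α p (extChartAt 𝓘(ℝ, E) p (u y))).comp
        (fderivWithin ℝ (extChartAt 𝓘(ℝ, E) p ∘ u) S y) := by
  have hy' : u y ∈ (extChartAt 𝓘(ℝ, E) p).source := by rwa [extChartAt_source]
  have e5 := mfderivWithin_extChartAt_symm_comp_mfderiv_extChartAt' (I := 𝓘(ℝ, E)) hy'
  refine ContinuousLinearMap.ext fun v => ?_
  have e6 := DFunLike.congr_fun e5 (mfderivWithin 𝓘(ℝ, F) 𝓘(ℝ, E) u S y v)
  have key : ∀ q : W, q = u y → (α q : E →L[ℝ] ℝ) = α (u y) := by rintro q rfl; rfl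
  have := key _ ((extChartAt 𝓘(ℝ, E) p).left_inv hy')
  change (α (u y) : E →L[ℝ] ℝ) _ = (α ((extChartAt 𝓘(ℝ, E) p).symm
    (extChartAt 𝓘(ℝ, E) p (u y))) : E →L[ℝ] ℝ) (mfderivWithin 𝓘(ℝ, E) 𝓘(ℝ, E)
      (extChartAt 𝓘(ℝ, E) p).symm (range 𝓘(ℝ, E)) (extChartAt 𝓘(ℝ, E) p (u y))
      (fderivWithin ℝ (extChartAt 𝓘(ℝ, E) p ∘ u) S y v))
  rw [this, fderivWithin_extChartAt_comp hy hu hS]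
  exact congrArg _ e6.symm

omit [IsManifold 𝓘(ℝ, E) ∞ W] in
theorem OneForm.inChart_eq_pullbackWithin (α : OneForm 𝓘(ℝ, E) (M := W)) {p : W} :
    OneForm.inChart α p = pullbackWithin α (extChartAt 𝓘(ℝ, E) p).symm (range 𝓘(ℝ, E)) := rfl

theorem OneForm.Smooth.contDiffOn_inChart [FiniteDimensional ℝ E] {α : OneForm 𝓘(ℝ, E) (M := W)} (hα : OneForm.Smooth α)
    (p : W) : ContDiffOn ℝ ∞ (OneForm.inChart α p) (extChartAt 𝓘(ℝ, E) p).target := by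
  have ho : IsOpen (extChartAt 𝓘(ℝ, E) p).target := isOpen_extChartAt_target p
  have := contDiffOn_pullbackWithin hα (contMDiffOn_extChartAt_symm (I := 𝓘(ℝ, E)) p) ho.uniqueDiffOn
  refine this.congr fun y hy => ?_
  rw [OneForm.inChart_eq_pullbackWithin]
  simp only [pullbackWithin]
  have h1 : mfderivWithin 𝓘(ℝ, E) 𝓘(ℝ, E) (extChartAt 𝓘(ℝ, E) p).symm (range 𝓘(ℝ, E)) y =
    mfderivWithin 𝓘(ℝ, E) 𝓘(ℝ, E) (extChartAt 𝓘(ℝ, E) p).symm (extChartAt 𝓘(ℝ, E) p).target y := by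
    simp only [modelWithCornersSelf_coe, range_id, mfderivWithin_univ]
    exact (mfderivWithin_of_isOpen ho hy).symm
  rw [h1]

/-- The exterior derivative is natural: `d(u^*α) = u^*(dα)`. The set `S` may have a boundary, as long as
the point is a limit of interior points, where the symmetry of second derivatives is available. -/
theorem fderivWithin_pullbackWithin_sub [FiniteDimensional ℝ E] [FiniteDimensional ℝ F]
    {α : OneForm 𝓘(ℝ, E) (M := W)} (hα : OneForm.Smooth α)
    {u : F → W} {S : Set F} (hu : ContMDiffOn 𝓘(ℝ, F) 𝓘(ℝ, E) ∞ u S) (hS : UniqueDiffOn ℝ S)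
    {x : F} (hx : x ∈ S) (hx' : x ∈ closure (interior S)) (v w : F) :
    fderivWithin ℝ (pullbackWithin α u S) S x v w - fderivWithin ℝ (pullbackWithin α u S) S x w v =
      OneForm.d α (u x) (mfderivWithin 𝓘(ℝ, F) 𝓘(ℝ, E) u S x v)
        (mfderivWithin 𝓘(ℝ, F) 𝓘(ℝ, E) u S x w) := by
  set p := u x with hp
  set φ := extChartAt 𝓘(ℝ, E) p
  set L := OneForm.inChart α p
  set ut : F → E := φ ∘ u with hut
  have hsrc : u ⁻¹' (chartAt E p).source ∈ 𝓝[S] x :=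
    (hu.continuousOn x hx).preimage_mem_nhdsWithin ((chartAt E p).open_source.mem_nhds (mem_chart_source E p))
  have hutd : ContDiffWithinAt ℝ ∞ ut S x := by
    rw [← contMDiffWithinAt_iff_contDiffWithinAt]
    exact (contMDiffAt_extChartAt (I := 𝓘(ℝ, E)) (x := p)).comp_contMDiffWithinAt x (hu x hx)
  have hev : ∀ᶠ y in 𝓝[S] x, pullbackWithin α u S y = (L (ut y)).comp (fderivWithin ℝ ut S y) := by
    filter_upwards [hsrc, self_mem_nhdsWithin] with y hy hyS
    exact pullbackWithin_eq_inChart_comp α hy ((hu y hyS).mdifferentiableWithinAt (by simp)) (hS y hyS)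
  have hLd : HasFDerivAt L (fderiv ℝ L (ut x)) (ut x) := by
    have := (hα.contDiffOn_inChart p).contDiffAt (x := ut x)
      ((isOpen_extChartAt_target (I := 𝓘(ℝ, E)) p).mem_nhds (mem_extChartAt_target (I := 𝓘(ℝ, E)) p))
    exact (this.differentiableAt (by simp)).hasFDerivAt
  have hut1 : HasFDerivWithinAt ut (fderivWithin ℝ ut S x) S x :=
    (hutd.differentiableWithinAt (by simp)).hasFDerivWithinAt
  have hut2 : HasFDerivWithinAt (fderivWithin ℝ ut S) (fderivWithin ℝ (fderivWithin ℝ ut S) S x) S x := by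
    have := hutd.fderivWithin_right (m := 1) hS (by norm_cast) hx
    exact (this.differentiableWithinAt (by simp)).hasFDerivWithinAt
  have hd := (hLd.comp_hasFDerivWithinAt x hut1).clm_comp hut2
  have hd' := (HasFDerivWithinAt.congr_of_eventuallyEq hd hev (hev.self_of_nhdsWithin hx)).fderivWithin (hS x hx)
  -- the second derivatives of `u` cancel by symmetry
  have hsymm := ContDiffWithinAt.isSymmSndFDerivWithinAt hutd
    (by rw [minSmoothness_of_isRCLikeNormedField]; norm_cast) hS hx' hx v w
  have hch : ∀ v, chartDeriv (I := 𝓘(ℝ, E)) (u x) (mfderivWithin 𝓘(ℝ, F) 𝓘(ℝ, E) u S x v) = fderivWithin ℝ ut S x v := by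
    intro v
    exact (fderivWithin_extChartAt_comp (mem_chart_source E p)
      ((hu x hx).mdifferentiableWithinAt (by simp)) (hS x hx) v).symm
  change _ = fderivWithin ℝ L (range 𝓘(ℝ, E)) (φ p)
      (chartDeriv (I := 𝓘(ℝ, E)) (u x) (mfderivWithin 𝓘(ℝ, F) 𝓘(ℝ, E) u S x v))
      (chartDeriv (I := 𝓘(ℝ, E)) (u x) (mfderivWithin 𝓘(ℝ, F) 𝓘(ℝ, E) u S x w)) -
    fderivWithin ℝ L (range 𝓘(ℝ, E)) (φ p)
      (chartDeriv (I := 𝓘(ℝ, E)) (u x) (mfderivWithin 𝓘(ℝ, F) 𝓘(ℝ, E) u S x w))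
      (chartDeriv (I := 𝓘(ℝ, E)) (u x) (mfderivWithin 𝓘(ℝ, F) 𝓘(ℝ, E) u S x v))
  erw [hch, hch]
  rw [hd', show range 𝓘(ℝ, E) = univ by simp, fderivWithin_univ]
  change L (ut x) (fderivWithin ℝ (fderivWithin ℝ ut S) S x v w) +
      fderiv ℝ L (ut x) (fderivWithin ℝ ut S x v) (fderivWithin ℝ ut S x w) -
    (L (ut x) (fderivWithin ℝ (fderivWithin ℝ ut S) S x w v) +
      fderiv ℝ L (ut x) (fderivWithin ℝ ut S x w) (fderivWithin ℝ ut S x v)) =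
      fderiv ℝ L (ut x) (fderivWithin ℝ ut S x v) (fderivWithin ℝ ut S x w) -
      fderiv ℝ L (ut x) (fderivWithin ℝ ut S x w) (fderivWithin ℝ ut S x v)
  rw [hsymm]
  ring
end Pullback

/-! ### Smooth maps between manifolds -/

/-- A smooth map into a boundaryless manifold is open at an interior point where its derivative is
surjective. -/
theorem map_nhds_eq_of_surjective {E : Type*} [NormedAddCommGroup E] [NormedSpace ℝ E]
    [FiniteDimensional ℝ E] {A : Type*} [TopologicalSpace A] {I : ModelWithCorners ℝ E A}
    {X : Type*} [TopologicalSpace X] [ChartedSpace A X]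
    {E' : Type*} [NormedAddCommGroup E'] [NormedSpace ℝ E'] [FiniteDimensional ℝ E']
    {Y : Type*} [TopologicalSpace Y] [ChartedSpace E' Y]
    {f : X → Y} {p : X} (hf : ContMDiffAt I 𝓘(ℝ, E') ∞ f p) (hp : I.IsInteriorPoint p)
    (hs : Function.Surjective (mfderiv I 𝓘(ℝ, E') f p)) : map f (𝓝 p) = 𝓝 (f p) := by
  set y := extChartAt I p p with hy
  have hr : range I ∈ 𝓝 y := mem_interior_iff_mem_nhds.1 hp
  set F := writtenInExtChartAt I 𝓘(ℝ, E') p f with hF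
  have h1 : ContDiffAt ℝ ∞ F y := (contMDiffAt_iff.1 hf).2.contDiffAt hr
  have h2 := (hf.mdifferentiableAt (by simp)).hasMFDerivAt
  have h3 : HasFDerivAt F (mfderiv I 𝓘(ℝ, E') f p : E →L[ℝ] E') y := h2.2.hasFDerivAt hr
  have h4 := (h1.hasStrictFDerivAt' h3 (by simp)).map_nhds_eq_of_surj
    (LinearMap.range_eq_top.2 hs)
  have hc : ContinuousAt (extChartAt I p).symm y := by
    rw [hy]; exact continuousAt_extChartAt_symm p
  have h5 : map (extChartAt I p).symm (𝓝 y) = 𝓝 p := by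
    rw [← map_extChartAt_symm_nhdsWithin_range (I := I) p, nhdsWithin_eq_nhds.2 hr]
  have h6 : F y = extChartAt 𝓘(ℝ, E') (f p) (f p) := by
    simp only [hF, hy, writtenInExtChartAt, Function.comp_apply, extChartAt_to_inv]
  have h7 : map (extChartAt 𝓘(ℝ, E') (f p)).symm (𝓝 (F y)) = 𝓝 (f p) := by
    rw [h6]
    have := map_extChartAt_symm_nhdsWithin_range (I := 𝓘(ℝ, E')) (f p)
    rwa [ModelWithCorners.range_eq_univ, nhdsWithin_univ] at this
  have hfc : ContinuousAt (f ∘ (extChartAt I p).symm) y :=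
    ContinuousAt.comp_of_eq hf.continuousAt hc (extChartAt_to_inv p)
  have h8 : (extChartAt 𝓘(ℝ, E') (f p)).symm ∘ F =ᶠ[𝓝 y] f ∘ (extChartAt I p).symm := by
    have : ∀ᶠ q in 𝓝 y, (f ∘ (extChartAt I p).symm) q ∈ (extChartAt 𝓘(ℝ, E') (f p)).source := by
      apply hfc.eventually_mem
      rw [Function.comp_apply, hy, extChartAt_to_inv]
      exact extChartAt_source_mem_nhds _
    filter_upwards [this] with q hq
    exact (extChartAt 𝓘(ℝ, E') (f p)).left_inv hq
  rw [← h7, ← h4, map_map, map_congr h8, ← map_map, h5]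

/-- A curve that returns infinitely often to the image of an injective immersion of a compact manifold,
as its parameter tends to `s₀`, has its velocity at `s₀` in the image of the derivative. -/
theorem mem_range_mfderiv_of_frequently {E A X E' A' Y : Type*}
    [NormedAddCommGroup E] [NormedSpace ℝ E]
    [FiniteDimensional ℝ E] [TopologicalSpace A] {I : ModelWithCorners ℝ E A}
    [TopologicalSpace X] [ChartedSpace A X]
    [NormedAddCommGroup E'] [NormedSpace ℝ E'] [FiniteDimensional ℝ E']
    [TopologicalSpace A'] {I' : ModelWithCorners ℝ E' A'}
    [TopologicalSpace Y] [ChartedSpace A' Y] [CompactSpace X] [T2Space Y]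
    {f : X → Y} (hf : IsSmoothInjImmersion I I' f) {w : ℝ → Y} {s₀ : ℝ} {v : E'}
    (hw : HasMFDerivAt 𝓘(ℝ, ℝ) I' w s₀ ((1 : ℝ →L[ℝ] ℝ).smulRight v))
    (hfr : ∃ᶠ s in 𝓝[≠] s₀, w s ∈ range f) :
    ∃ q, f q = w s₀ ∧ ∃ ξ : E, (mfderiv I I' f q : E →L[ℝ] E') ξ = v := by
  classical
  have hemb : IsClosedEmbedding f := hf.contMDiff.continuous.isClosedEmbedding hf.injective
  have hwc : ContinuousAt w s₀ := hw.continuousAt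
  obtain ⟨q₀, hq₀⟩ : w s₀ ∈ range f :=
    hemb.isClosed_range.mem_of_frequently_of_tendsto hfr (hwc.tendsto.mono_left inf_le_left)
  refine ⟨q₀, hq₀, ?_⟩
  -- the times near `s₀` at which the curve is in the image, and its lift at these times
  let l : Filter ℝ := 𝓝[≠] s₀ ⊓ 𝓟 {s | w s ∈ range f}
  have hl : l.NeBot := frequently_iff_neBot.1 hfr
  let q : ℝ → X := fun s => if h : w s ∈ range f then h.choose else q₀
  have hq : ∀ s, w s ∈ range f → f (q s) = w s := by
    intro s h
    simp only [q, dif_pos h]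
    exact h.choose_spec
  have hlf : ∀ᶠ s in l, f (q s) = w s := by
    filter_upwards [mem_inf_of_right (mem_principal_self _)] with s hs using hq s hs
  have hl0 : l ≤ 𝓝 s₀ := inf_le_left.trans inf_le_left
  have hlne : ∀ᶠ s in l, s ≠ s₀ := inf_le_left (a := 𝓝[≠] s₀) self_mem_nhdsWithin
  have hqt : Tendsto q l (𝓝 q₀) := by
    rw [hemb.isInducing.tendsto_nhds_iff, hq₀]
    exact (hwc.tendsto.mono_left hl0).congr' (hlf.mono fun s hs => hs.symm)
  set φ := extChartAt I q₀ with hφ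
  set ψ := extChartAt I' (w s₀) with hψ
  let D : E →L[ℝ] E' := mfderiv I I' f q₀
  have hFD : HasFDerivWithinAt (writtenInExtChartAt I I' q₀ f) D (range I) (φ q₀) :=
    ((hf.contMDiff q₀).mdifferentiableAt (by simp)).hasMFDerivAt.2
  have hwD : HasDerivAt (ψ ∘ w) v s₀ := by
    have h1 : HasFDerivWithinAt (ψ ∘ w) ((1 : ℝ →L[ℝ] ℝ).smulRight v) (range 𝓘(ℝ, ℝ)) s₀ := hw.2
    rw [modelWithCornersSelf_coe, range_id, hasFDerivWithinAt_univ] at h1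
    simpa using h1.hasDerivAt
  have hat : Tendsto (fun s => φ (q s)) l (𝓝[range I] (φ q₀)) := by
    refine tendsto_nhdsWithin_iff.2 ⟨(continuousAt_extChartAt q₀).tendsto.comp hqt, ?_⟩
    exact Eventually.of_forall fun s => mem_range_self _
  have hF : ∀ᶠ s in l, writtenInExtChartAt I I' q₀ f (φ (q s)) = ψ (w s) := by
    filter_upwards [hlf, hqt (extChartAt_source_mem_nhds (I := I) q₀)] with s h1 h2
    simp only [writtenInExtChartAt, Function.comp_apply, hψ, ← hq₀]
    rw [(extChartAt I q₀).left_inv h2, h1]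
  have hF0 : writtenInExtChartAt I I' q₀ f (φ q₀) = ψ (w s₀) := by
    simp only [writtenInExtChartAt, Function.comp_apply, hψ, ← hq₀, hφ, extChartAt_to_inv]
  obtain ⟨c, hc⟩ := (LinearMap.injective_iff_antilipschitz (D : E →ₗ[ℝ] E')).1 (hf.immersion q₀)
  have hlittle := hFD.isLittleO.comp_tendsto hat
  have hbig := (hFD.isTheta_sub (hc.2.isUniformInducing D.uniformContinuous).isInducing).isBigO_symm.comp_tendsto hat
  have hwO : (fun s => ψ (w s) - ψ (w s₀)) =O[l] (fun s => s - s₀) :=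
    (hwD.isBigO_sub).mono hl0
  -- the derivative of the immersion is bounded below, so that the lift is Lipschitz at `s₀`
  have e1 : (fun s => φ (q s) - φ q₀) =O[l] (fun s => s - s₀) := by
    refine (hbig.congr' EventuallyEq.rfl ?_).trans hwO
    filter_upwards [hF] with s hs
    simp only [Function.comp_apply, hs, hF0]
  have e2 : (fun s => ψ (w s) - ψ (w s₀) - D (φ (q s) - φ q₀)) =o[l] (fun s => s - s₀) := by
    refine (hlittle.congr' ?_ EventuallyEq.rfl).trans_isBigO e1
    filter_upwards [hF] with s hs
    simp only [Function.comp_apply, hs, hF0]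
  have e3 := ((hasDerivAt_iff_isLittleO.1 hwD).mono hl0).sub e2
  have e4 : Tendsto (fun s => D ((s - s₀)⁻¹ • (φ (q s) - φ q₀))) l (𝓝 v) := by
    have e5 : (fun s => D (φ (q s) - φ q₀) - (s - s₀) • v) =o[l] (fun s => s - s₀) := by
      refine e3.congr_left fun s => ?_
      simp only [Function.comp_apply]; abel
    have e6 := (Asymptotics.isLittleO_iff_tendsto' ?_).1 e5.norm_left
    · rw [tendsto_iff_norm_sub_tendsto_zero]
      have e7 := e6.norm
      rw [norm_zero] at e7
      refine e7.congr' ?_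
      filter_upwards [hlne] with s hs
      have hs' : s - s₀ ≠ 0 := sub_ne_zero.2 hs
      rw [map_smul, norm_div, norm_norm, div_eq_inv_mul, ← norm_inv, ← norm_smul, smul_sub,
        smul_smul, inv_mul_cancel₀ hs', one_smul]
    · filter_upwards [hlne] with s hs h
      exact absurd (sub_eq_zero.1 h) hs
  -- `v` is a limit of elements of the range of the derivative, which is closed
  have hcl : IsClosed (range D) := by
    have := (LinearMap.range (D : E →ₗ[ℝ] E')).closed_of_finiteDimensional
    rwa [LinearMap.coe_range] at this
  exact hcl.mem_of_tendsto e4 (Eventually.of_forall fun s => mem_range_self _)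

/-! ### Functions on a product with the line -/

section
variable {E : Type*} [NormedAddCommGroup E] [NormedSpace ℝ E]
  {A : Type*} [TopologicalSpace A] {I : ModelWithCorners ℝ E A}
  {X : Type*} [TopologicalSpace X] [ChartedSpace A X] [IsManifold I ∞ X]

/-- The derivative of a function on `X`, as a linear form on the model space. -/
def dM (I : ModelWithCorners ℝ E A) (G : X → ℝ) (x : X) : E →L[ℝ] ℝ := mfderiv I 𝓘(ℝ, ℝ) G x

/-- The derivative of a function on `ℝ × X`, as a linear form on `ℝ × E`. -/
def dProd (I : ModelWithCorners ℝ E A) (Γ : ℝ × X → ℝ) (s : ℝ) (x : X) : ℝ × E →L[ℝ] ℝ :=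
  mfderiv (𝓘(ℝ, ℝ).prod I) 𝓘(ℝ, ℝ) Γ (s, x)

theorem contMDiffOn_dProd {Γ : ℝ × X → ℝ} {O : Set X} (hO : IsOpen O)
    (hΓ : ContMDiffOn (𝓘(ℝ, ℝ).prod I) 𝓘(ℝ, ℝ) ∞ Γ (univ ×ˢ O)) (τ : ℝ) :
    ContMDiffOn (𝓘(ℝ, ℝ).prod I.tangent) 𝓘(ℝ, ℝ) ∞
      (fun p : ℝ × TangentBundle I X => dProd I Γ p.1 p.2.proj (τ, p.2.2))
      (univ ×ˢ {ξ | ξ.proj ∈ O}) := by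
  have hS : IsOpen ((univ : Set ℝ) ×ˢ O) := isOpen_univ.prod hO
  have h1 := hΓ.contMDiffOn_tangentMapWithin (m := ∞) (by simp) hS.uniqueMDiffOn
  have h2 : ContMDiff (𝓘(ℝ, ℝ).prod I.tangent) (𝓘(ℝ, ℝ).prod I).tangent ∞
      (fun p : ℝ × TangentBundle I X => (⟨(p.1, p.2.proj), (τ, p.2.2)⟩ :
        TangentBundle (𝓘(ℝ, ℝ).prod I) (ℝ × X))) := by
    have h3 : ContMDiff (𝓘(ℝ, ℝ).prod I.tangent) (𝓘(ℝ, ℝ).tangent.prod I.tangent) ∞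
        (fun p : ℝ × TangentBundle I X => ((⟨p.1, τ⟩ : TangentBundle 𝓘(ℝ, ℝ) ℝ), p.2)) := by
      refine ContMDiff.prodMk ?_ contMDiff_snd
      have h5 : ContMDiff 𝓘(ℝ, ℝ) 𝓘(ℝ, ℝ).tangent ∞
          (fun σ : ℝ => (⟨σ, τ⟩ : TangentBundle 𝓘(ℝ, ℝ) ℝ)) := by
        intro σ
        exact contMDiffAt_vectorSpace_iff_contDiffAt.2 contDiffAt_const
      exact h5.comp contMDiff_fst
    exact (contMDiff_equivTangentBundleProd_symm (I := 𝓘(ℝ, ℝ)) (M := ℝ) (I' := I) (M' := X)).comp h3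
  have h4 := (contMDiff_snd_tangentBundle_modelSpace ℝ 𝓘(ℝ, ℝ) (n := ∞)).comp_contMDiffOn
    (h1.comp h2.contMDiffOn (s := univ ×ˢ {ξ : TangentBundle I X | ξ.proj ∈ O}) (fun p hp => hp))
  refine h4.congr fun p hp => ?_
  have : mfderivWithin (𝓘(ℝ, ℝ).prod I) 𝓘(ℝ, ℝ) Γ (univ ×ˢ O) (p.1, p.2.proj) =
    mfderiv (𝓘(ℝ, ℝ).prod I) 𝓘(ℝ, ℝ) Γ (p.1, p.2.proj) := mfderivWithin_of_isOpen hS hp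
  simp only [Function.comp, tangentMapWithin, dProd]
  rw [this]
  rfl

variable {Γ : ℝ × X → ℝ} {s : ℝ} {x : X}

theorem hasDerivAt_of_dProd (h : MDifferentiableAt (𝓘(ℝ, ℝ).prod I) 𝓘(ℝ, ℝ) Γ (s, x)) :
    HasDerivAt (fun σ => Γ (σ, x)) (dProd I Γ s x ((1 : ℝ), 0)) s := by
  have h1 : HasMFDerivAt 𝓘(ℝ, ℝ) (𝓘(ℝ, ℝ).prod I) (fun σ : ℝ => (σ, x)) s
      ((ContinuousLinearMap.id ℝ ℝ).prod (0 : ℝ →L[ℝ] E)) :=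
    (hasMFDerivAt_id s).prodMk (hasMFDerivAt_const x s)
  have h2 := HasMFDerivAt.comp (f := fun σ : ℝ => (σ, x)) s h.hasMFDerivAt h1
  have h3 : HasFDerivAt (fun σ => Γ (σ, x))
      ((dProd I Γ s x).comp ((ContinuousLinearMap.id ℝ ℝ).prod (0 : ℝ →L[ℝ] E))) s :=
    hasMFDerivAt_iff_hasFDerivAt.1 h2
  exact h3.hasDerivAt

theorem mfderiv_slice_eq (h : MDifferentiableAt (𝓘(ℝ, ℝ).prod I) 𝓘(ℝ, ℝ) Γ (s, x)) (v : E) :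
    dM I (fun x => Γ (s, x)) x v = dProd I Γ s x (0, v) := by
  have h1 : HasMFDerivAt I (𝓘(ℝ, ℝ).prod I) (fun x : X => (s, x)) x
      ((0 : E →L[ℝ] ℝ).prod (ContinuousLinearMap.id ℝ E)) :=
    (hasMFDerivAt_const s x).prodMk (hasMFDerivAt_id x)
  have h2 := HasMFDerivAt.comp (f := fun x : X => (s, x)) x h.hasMFDerivAt h1
  have h3 := h2.mfderiv
  exact congrArg (fun D : E →L[ℝ] ℝ => D v) h3

theorem hasDerivWithinAt_comp_prod (h : MDifferentiableAt (𝓘(ℝ, ℝ).prod I) 𝓘(ℝ, ℝ) Γ (s, x))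
    {w : ℝ → X} {v : E} {S : Set ℝ} (hx : w s = x)
    (hw : HasMFDerivWithinAt 𝓘(ℝ, ℝ) I w S s ((1 : ℝ →L[ℝ] ℝ).smulRight v)) :
    HasDerivWithinAt (fun σ => Γ (σ, w σ)) (dProd I Γ s x (1, v)) S s := by
  subst hx
  have h1 : HasMFDerivWithinAt 𝓘(ℝ, ℝ) (𝓘(ℝ, ℝ).prod I) (fun σ : ℝ => (σ, w σ)) S s
      ((ContinuousLinearMap.id ℝ ℝ).prod ((1 : ℝ →L[ℝ] ℝ).smulRight v)) :=
    (hasMFDerivAt_id s).hasMFDerivWithinAt.prodMk hw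
  have h2 := HasMFDerivAt.comp_hasMFDerivWithinAt (f := fun σ : ℝ => (σ, w σ)) s h.hasMFDerivAt h1
  have h3 : HasFDerivWithinAt (fun σ => Γ (σ, w σ)) ((dProd I Γ s (w s)).comp
      ((ContinuousLinearMap.id ℝ ℝ).prod ((1 : ℝ →L[ℝ] ℝ).smulRight v))) S s :=
    hasMFDerivWithinAt_iff_hasFDerivWithinAt.1 h2
  refine h3.hasDerivWithinAt.congr_deriv ?_
  change dProd I Γ s (w s) ((1 : ℝ), (1 : ℝ) • v) = _
  rw [one_smul]

theorem dProd_one (h : MDifferentiableAt (𝓘(ℝ, ℝ).prod I) 𝓘(ℝ, ℝ) Γ (s, x)) (v : E) :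
    dProd I Γ s x (1, v) = deriv (fun σ => Γ (σ, x)) s +
      dM I (fun x => Γ (s, x)) x v := by
  refine Eq.trans ?_ (congrArg (fun r : ℝ => deriv (fun σ => Γ (σ, x)) s + r)
    (mfderiv_slice_eq h v)).symm
  rw [(hasDerivAt_of_dProd h).deriv]
  rw [← map_add]
  simp

theorem contMDiffOn_deriv_slice {O : Set X} (hO : IsOpen O)
    (hΓ : ContMDiffOn (𝓘(ℝ, ℝ).prod I) 𝓘(ℝ, ℝ) ∞ Γ (univ ×ˢ O)) :
    ContMDiffOn (𝓘(ℝ, ℝ).prod I) 𝓘(ℝ, ℝ) ∞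
      (fun p : ℝ × X => deriv (fun σ => Γ (σ, p.2)) p.1) (univ ×ˢ O) := by
  have h1 : ContMDiff (𝓘(ℝ, ℝ).prod I) (𝓘(ℝ, ℝ).prod I.tangent) ∞
      (fun p : ℝ × X => (p.1, (⟨p.2, 0⟩ : TangentBundle I X))) :=
    contMDiff_fst.prodMk ((Bundle.contMDiff_zeroSection ℝ (TangentSpace I : X → Type _)).comp
      contMDiff_snd)
  refine ((contMDiffOn_dProd hO hΓ 1).comp h1.contMDiffOn (fun p hp => hp)).congr fun p hp => ?_
  exact (hasDerivAt_of_dProd (((hΓ.contMDiffAt ((isOpen_univ.prod hO).mem_nhds hp)).mdifferentiableAt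
    (by simp)))).deriv

theorem contMDiffOn_dM_slice {O : Set X} (hO : IsOpen O)
    (hΓ : ContMDiffOn (𝓘(ℝ, ℝ).prod I) 𝓘(ℝ, ℝ) ∞ Γ (univ ×ˢ O)) :
    ContMDiffOn (𝓘(ℝ, ℝ).prod I.tangent) 𝓘(ℝ, ℝ) ∞
      (fun p : ℝ × TangentBundle I X => dM I (fun x => Γ (p.1, x)) p.2.proj p.2.2)
      (univ ×ˢ {ξ | ξ.proj ∈ O}) :=
  (contMDiffOn_dProd hO hΓ 0).congr fun p hp =>
    mfderiv_slice_eq (((hΓ.contMDiffAt ((isOpen_univ.prod hO).mem_nhds hp)).mdifferentiableAt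
      (by simp))) _

end

theorem hasDerivWithinAt_dM_comp {E : Type*} [NormedAddCommGroup E] [NormedSpace ℝ E]
    {A : Type*} [TopologicalSpace A] {I : ModelWithCorners ℝ E A}
    {X : Type*} [TopologicalSpace X] [ChartedSpace A X] {G : X → ℝ} {y : ℝ → X} {t : ℝ} {S : Set ℝ}
    (hG : MDifferentiableAt I 𝓘(ℝ, ℝ) G (y t)) {v : E}
    (hy : HasMFDerivWithinAt 𝓘(ℝ, ℝ) I y S t ((1 : ℝ →L[ℝ] ℝ).smulRight v)) :
    HasDerivWithinAt (fun τ => G (y τ)) (dM I G (y t) v) S t := by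
  have h2 := HasMFDerivAt.comp_hasMFDerivWithinAt (f := y) t hG.hasMFDerivAt hy
  have h3 : HasFDerivWithinAt (fun τ => G (y τ)) ((dM I G (y t)).comp
      ((1 : ℝ →L[ℝ] ℝ).smulRight v)) S t := hasMFDerivWithinAt_iff_hasFDerivWithinAt.1 h2
  refine h3.hasDerivWithinAt.congr_deriv ?_
  change dM I G (y t) ((1 : ℝ) • v) = _
  rw [one_smul]

/-! ### Calculus in one variable -/

/-- The second derivative test at a maximum on a closed interval, possibly at an end point, for a
function whose first derivative vanishes there. -/
theorem second_deriv_nonpos_of_isMaxOn {h h' : ℝ → ℝ} {a b t₀ h'' : ℝ} (hab : a < b)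
    (ht₀ : t₀ ∈ Icc a b)
    (hh : ∀ᶠ t in 𝓝[Icc a b] t₀, HasDerivWithinAt h (h' t) (Icc a b) t)
    (hh' : HasDerivWithinAt h' h'' (Icc a b) t₀) (h0 : h' t₀ = 0)
    (hmax : ∀ t ∈ Icc a b, h t ≤ h t₀) : h'' ≤ 0 := by
  by_contra! hpos
  have h1 := hasDerivWithinAt_iff_tendsto_slope.1 hh'
  have h2 : ∀ᶠ t in 𝓝[Icc a b \ {t₀}] t₀, 0 < slope h' t₀ t := h1.eventually_const_lt hpos
  have h3 : ∀ᶠ t in 𝓝[Icc a b] t₀, t ≠ t₀ → 0 < slope h' t₀ t := by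
    rw [sdiff_eq, inter_comm, nhdsWithin_inter', eventually_inf_principal] at h2
    rw [← nhdsWithin_inter_of_mem' (s := Icc a b) (t := univ) (by simp)]
    simp only [eventually_nhdsWithin_iff] at h2 ⊢
    filter_upwards [h2] with t ht hta hne
    exact ht hne hta.1
  have h4 := hh.and h3
  rw [Metric.nhdsWithin_basis_ball.eventually_iff] at h4
  obtain ⟨δ, hδ, h4⟩ := h4
  have h5 : ∀ t, |t - t₀| < δ → t ∈ Icc a b → HasDerivWithinAt h (h' t) (Icc a b) t ∧
      (t ≠ t₀ → 0 < slope h' t₀ t) := fun t ht hta => h4 ⟨by simpa [Real.dist_eq] using ht, hta⟩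
  rcases lt_or_ge t₀ b with hb | hb
  · -- to the right of `t₀` the function would increase
    set t₁ := min b (t₀ + δ / 2) with ht₁
    have e1 : t₀ < t₁ := lt_min hb (by linarith)
    have e2 : t₁ ≤ b := min_le_left _ _
    have e3 : t₁ ≤ t₀ + δ / 2 := min_le_right _ _
    have e4 : ∀ t ∈ Icc t₀ t₁, HasDerivWithinAt h (h' t) (Icc a b) t ∧ (t ≠ t₀ → 0 < slope h' t₀ t) :=
      fun t ht => h5 t (by rw [abs_of_nonneg (by linarith [ht.1])]; linarith [ht.2])
        ⟨ht₀.1.trans ht.1, ht.2.trans e2⟩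
    have e5 : StrictMonoOn h (Icc t₀ t₁) := by
      refine strictMonoOn_of_deriv_pos (convex_Icc _ _) (fun t ht =>
        ((e4 t ht).1.continuousWithinAt.mono (Icc_subset_Icc ht₀.1 e2))) fun t ht => ?_
      rw [interior_Icc] at ht
      rw [((e4 t (Ioo_subset_Icc_self ht)).1.hasDerivAt
        (Icc_mem_nhds (ht₀.1.trans_lt ht.1) (ht.2.trans_le e2))).deriv]
      have := (e4 t (Ioo_subset_Icc_self ht)).2 ht.1.ne'
      rw [slope_def_field, h0, sub_zero] at this
      have h6 : 0 < t - t₀ := sub_pos.2 ht.1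
      exact (div_pos_iff_of_pos_right h6).1 this
    have e6 := e5 (left_mem_Icc.2 e1.le) (right_mem_Icc.2 e1.le) e1
    exact absurd (hmax t₁ ⟨ht₀.1.trans e1.le, e2⟩) (not_le.2 e6)
  · have hb' : t₀ = b := le_antisymm ht₀.2 hb
    have ha : a < t₀ := by rw [hb']; exact hab
    -- `t₀` is the right end point; to its left the function would decrease
    set t₁ := max a (t₀ - δ / 2) with ht₁
    have e1 : t₁ < t₀ := max_lt ha (by linarith)
    have e2 : a ≤ t₁ := le_max_left _ _
    have e3 : t₀ - δ / 2 ≤ t₁ := le_max_right _ _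
    have e4 : ∀ t ∈ Icc t₁ t₀, HasDerivWithinAt h (h' t) (Icc a b) t ∧ (t ≠ t₀ → 0 < slope h' t₀ t) :=
      fun t ht => h5 t (by rw [abs_of_nonpos (by linarith [ht.2])]; linarith [ht.1])
        ⟨e2.trans ht.1, ht.2.trans ht₀.2⟩
    have e5 : StrictAntiOn h (Icc t₁ t₀) := by
      refine strictAntiOn_of_deriv_neg (convex_Icc _ _) (fun t ht =>
        ((e4 t ht).1.continuousWithinAt.mono (Icc_subset_Icc e2 ht₀.2))) fun t ht => ?_
      rw [interior_Icc] at ht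
      rw [((e4 t (Ioo_subset_Icc_self ht)).1.hasDerivAt
        (Icc_mem_nhds (e2.trans_lt ht.1) (ht.2.trans_le ht₀.2))).deriv]
      have := (e4 t (Ioo_subset_Icc_self ht)).2 ht.2.ne
      rw [slope_def_field, h0, sub_zero] at this
      have h6 : t - t₀ < 0 := sub_neg.2 ht.2
      by_contra! hn
      exact absurd (div_nonpos_of_nonneg_of_nonpos hn h6.le) (not_le.2 this)
    have e6 := e5 (left_mem_Icc.2 e1.le) (right_mem_Icc.2 e1.le) e1
    exact absurd (hmax t₁ ⟨e2, e1.le.trans ht₀.2⟩) (not_le.2 e6)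

/-- A monotone quantity whose square is controlled by its derivative is bounded, because it would
blow up in finite time otherwise. -/
theorem le_of_riccati {A A' : ℝ → ℝ} {c S : ℝ} (hc : 0 < c) (hA : ∀ s, HasDerivAt A (A' s) s)
    (hA' : ∀ s, 0 ≤ A' s) (h : ∀ s ≥ S, ∀ x > 0, A s ≤ c * (1 + x + A' s / x)) (s : ℝ) :
    A s ≤ 2 * c := by
  by_contra! hs
  have hmono : Monotone A := monotone_of_deriv_nonneg (fun s => (hA s).differentiableAt)
    fun s => by rw [(hA s).deriv]; exact hA' s
  set T := max s S
  have hpos : ∀ σ ≥ T, 2 * c < A σ := fun σ hσ => hs.trans_le (hmono ((le_max_left _ _).trans hσ))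
  -- the choice `x = A / (4 c)` turns the estimate into `A' ≥ const · A²`
  have hbig : ∀ σ ≥ T, A σ ^ 2 / (16 * c ^ 2) ≤ A' σ := by
    intro σ hσ
    have h1 := hpos σ hσ
    have h2 : 0 < A σ := by linarith
    have h3 := h σ ((le_max_right _ _).trans hσ) (A σ / (4 * c)) (by positivity)
    have h4 : c * (1 + A σ / (4 * c) + A' σ / (A σ / (4 * c))) =
      c + A σ / 4 + 4 * c ^ 2 * A' σ / A σ := by field_simp
    rw [h4] at h3
    have h5 : A σ / 4 ≤ 4 * c ^ 2 * A' σ / A σ := by linarith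
    rw [le_div_iff₀ h2] at h5
    rw [div_le_iff₀ (by positivity)]
    nlinarith
  -- the reciprocal decreases at a definite rate
  set k := 1 / (16 * c ^ 2) with hk
  have hkpos : 0 < k := by positivity
  have hanti : AntitoneOn (fun σ => (A σ)⁻¹ + k * σ) (Ici T) := by
    have hd : ∀ σ ∈ Ici T, HasDerivAt (fun σ => (A σ)⁻¹ + k * σ) (-A' σ / A σ ^ 2 + k) σ := by
      intro σ hσ
      have h2 : A σ ≠ 0 := by have := hpos σ hσ; exact (by linarith : 0 < A σ).ne'
      exact ((hA σ).inv h2).add (((hasDerivAt_id σ).const_mul k).congr_deriv (mul_one k))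
    refine antitoneOn_of_deriv_nonpos (convex_Ici T)
      (fun σ hσ => (hd σ hσ).continuousAt.continuousWithinAt)
      (fun σ hσ => (hd σ (interior_subset hσ)).differentiableAt.differentiableWithinAt) fun σ hσ => ?_
    rw [(hd σ (interior_subset hσ)).deriv]
    have h2 : 0 < A σ := by have := hpos σ (interior_subset hσ); linarith
    have h3 := hbig σ (interior_subset hσ)
    have h4 : k ≤ A' σ / A σ ^ 2 := by
      rw [le_div_iff₀ (by positivity), hk]
      calc 1 / (16 * c ^ 2) * A σ ^ 2 = A σ ^ 2 / (16 * c ^ 2) := by ring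
        _ ≤ _ := h3
    rw [neg_div]; linarith
  have hT : 0 < A T := by have := hpos T le_rfl; linarith
  have h9 : 0 < (A T)⁻¹ / k := by positivity
  have h6 := hanti (mem_Ici.2 (le_refl T)) (show T + (A T)⁻¹ / k ∈ Ici T from by
    rw [mem_Ici]; linarith) (by linarith)
  simp only at h6
  have h7 : 0 < (A (T + (A T)⁻¹ / k))⁻¹ := by
    have := hpos (T + (A T)⁻¹ / k) (by linarith)
    exact inv_pos.2 (by linarith)
  have h8 : k * ((A T)⁻¹ / k) = (A T)⁻¹ := by field_simp
  rw [mul_add, h8] at h6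
  linarith

/-- A Gronwall estimate for a function whose derivative is only controlled where it is large. -/
theorem le_of_deriv_le_of_large {g g' e : ℝ → ℝ} {R k E₀ : ℝ} (hR : 0 ≤ R) (hk : 0 ≤ k)
    (he : ContinuousOn e (Icc 0 1)) (he0 : ∀ t ∈ Icc (0 : ℝ) 1, 0 ≤ e t)
    (hE : ∫ t in (0 : ℝ)..1, e t ≤ E₀)
    (hg : ∀ t ∈ Icc (0 : ℝ) 1, HasDerivWithinAt g (g' t) (Icc 0 1) t)
    (hg' : ∀ t ∈ Icc (0 : ℝ) 1, R < g t → |g' t| ≤ k * g t + e t)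
    {t₀ : ℝ} (ht₀ : t₀ ∈ Icc (0 : ℝ) 1) (h0 : g t₀ ≤ R) :
    ∀ t ∈ Icc (0 : ℝ) 1, g t ≤ (R + 2 + E₀) * Real.exp (k + 1) := by
  -- the estimate to the right of a point
  have right : ∀ {g g' e : ℝ → ℝ}, ContinuousOn e (Icc 0 1) → (∀ t ∈ Icc (0 : ℝ) 1, 0 ≤ e t) →
      (∫ t in (0 : ℝ)..1, e t ≤ E₀) →
      (∀ t ∈ Icc (0 : ℝ) 1, HasDerivWithinAt g (g' t) (Icc 0 1) t) →
      (∀ t ∈ Icc (0 : ℝ) 1, R < g t → |g' t| ≤ k * g t + e t) →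
      ∀ {t₀ : ℝ}, t₀ ∈ Icc (0 : ℝ) 1 → g t₀ ≤ R →
      ∀ t ∈ Icc t₀ 1, g t ≤ (R + 2 + E₀) * Real.exp (k + 1) := by
    clear h0 hg' hg ht₀ hE he0 he
    intro g g' e he he0 hE hg hg' t₀ ht₀ h0 t ht
    set ec : ℝ → ℝ := IccExtend zero_le_one ((Icc (0 : ℝ) 1).domRestrict e) with hec
    have hecc : Continuous ec := (continuousOn_iff_continuous_domRestrict.1 he).Icc_extend'
    have hece : ∀ t ∈ Icc (0 : ℝ) 1, ec t = e t := fun t ht => by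
      rw [hec, IccExtend_of_mem _ _ ht]; rfl
    have hec0 : ∀ t, 0 ≤ ec t := fun t => he0 _ (Subtype.prop _)
    let I : ℝ → ℝ := fun t => ∫ τ in t₀..t, ec τ
    let B : ℝ → ℝ := fun t => (R + 1 + (I t + (t - t₀))) * Real.exp (k * (t - t₀))
    let B' : ℝ → ℝ := fun t => (ec t + 1) * Real.exp (k * (t - t₀)) +
      (R + 1 + (I t + (t - t₀))) * (Real.exp (k * (t - t₀)) * k)
    have hB : ∀ t, HasDerivAt B (B' t) t := by
      intro t
      have h1 : HasDerivAt I (ec t) t := intervalIntegral.integral_hasDerivAt_right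
        (hecc.intervalIntegrable _ _) (hecc.stronglyMeasurableAtFilter _ _) hecc.continuousAt
      have h2 : HasDerivAt (fun t => k * (t - t₀)) k t :=
        (((hasDerivAt_id t).sub_const t₀).const_mul k).congr_deriv (mul_one k)
      exact ((h1.add ((hasDerivAt_id t).sub_const t₀)).const_add (R + 1)).mul h2.exp
    have hInn : ∀ t ∈ Icc t₀ 1, 0 ≤ I t := fun t ht =>
      intervalIntegral.integral_nonneg ht.1 fun τ _ => hec0 τ
    have hle := image_le_of_deriv_right_lt_deriv_boundary (f := g) (f' := g') (a := t₀) (b := 1)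
      (B := B) (B' := B')
      (fun τ hτ => (hg τ ⟨ht₀.1.trans hτ.1, hτ.2⟩).continuousWithinAt.mono (Icc_subset_Icc_left ht₀.1))
      (fun τ hτ => ((hg τ ⟨ht₀.1.trans hτ.1, hτ.2.le⟩).mono_of_mem_nhdsWithin
        (mem_of_superset (Icc_mem_nhdsGE hτ.2) (Icc_subset_Icc_left (ht₀.1.trans hτ.1)))))
      (by simp only [B, I]; simp; linarith) hB ?_
    · refine (hle ht).trans ?_
      have h1 : I t ≤ E₀ := by
        refine le_trans ?_ hE
        have h2 : ∫ τ in (0 : ℝ)..1, e τ = ∫ τ in (0 : ℝ)..1, ec τ :=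
          intervalIntegral.integral_congr fun τ hτ => by
            rw [uIcc_of_le zero_le_one] at hτ; exact (hece τ hτ).symm
        rw [h2]
        exact intervalIntegral.integral_mono_interval ht₀.1 ht.1 ht.2
          (Eventually.of_forall hec0) (hecc.intervalIntegrable _ _)
      have h3 : k * (t - t₀) ≤ k + 1 := by nlinarith [ht.2, ht₀.1, ht.1]
      have h4 : R + 1 + (I t + (t - t₀)) ≤ R + 2 + E₀ := by linarith [ht.2, ht₀.1]
      have h5 : 0 ≤ R + 1 + (I t + (t - t₀)) := by linarith [hInn t ht, ht.1]
      exact mul_le_mul h4 (Real.exp_le_exp.2 h3) (Real.exp_pos _).le (h5.trans h4)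
    · intro τ hτ hgB
      have hτ1 : τ ∈ Icc (0 : ℝ) 1 := ⟨ht₀.1.trans hτ.1, hτ.2.le⟩
      have h1 : 1 ≤ Real.exp (k * (τ - t₀)) :=
        Real.one_le_exp (mul_nonneg hk (sub_nonneg.2 hτ.1))
      have h2 : R + 1 ≤ R + 1 + (I τ + (τ - t₀)) := by
        linarith [hInn τ ⟨hτ.1, hτ.2.le⟩, hτ.1]
      have h3 : R < B τ := by
        have : R + 1 ≤ B τ := by
          calc R + 1 = (R + 1) * 1 := by ring
            _ ≤ _ := mul_le_mul h2 h1 zero_le_one (by linarith)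
        linarith
      have h4 := (le_abs_self _).trans (hg' τ hτ1 (by rw [hgB]; exact h3))
      rw [hgB, ← hece τ hτ1] at h4
      refine h4.trans_lt ?_
      have h5 : ec τ < (ec τ + 1) * Real.exp (k * (τ - t₀)) := by nlinarith [hec0 τ]
      simp only [B, B']
      nlinarith
  intro t ht
  rcases le_total t₀ t with h | h
  · exact right he he0 hE hg hg' ht₀ h0 t ⟨h, ht.2⟩
  · -- the estimate to the left follows by reflection
    have hrefl : ∀ τ : ℝ, τ ∈ Icc (0 : ℝ) 1 → 1 - τ ∈ Icc (0 : ℝ) 1 := fun τ hτ =>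
      ⟨by linarith [hτ.2], by linarith [hτ.1]⟩
    have hmaps : MapsTo (fun τ : ℝ => 1 - τ) (Icc 0 1) (Icc 0 1) := fun τ hτ => hrefl τ hτ
    have := right (g := fun τ => g (1 - τ)) (g' := fun τ => - g' (1 - τ)) (e := fun τ => e (1 - τ))
      (he.comp (by fun_prop) hmaps) (fun τ hτ => he0 _ (hrefl τ hτ))
      (by rw [intervalIntegral.integral_comp_sub_left (fun τ => e τ)]; simpa using hE)
      (fun τ hτ => by
        have h1 := (hg (1 - τ) (hrefl τ hτ)).scomp τ
          (((hasDerivAt_id τ).const_sub 1).hasDerivWithinAt (s := Icc 0 1)) hmaps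
        exact h1.congr_deriv (by simp))
      (fun τ hτ hR => by rw [abs_neg]; exact hg' _ (hrefl τ hτ) hR) (hrefl t₀ ht₀)
      (by simpa using h0) (1 - t) ⟨by linarith, by linarith [ht.1]⟩
    simpa using this

/-! ### Parameters in integrals and limits -/

/-- Differentiation under the integral sign. -/
theorem hasDerivAt_integral_of_continuousOn {h h' : ℝ → ℝ → ℝ}
    (hc : ∀ s, ContinuousOn (h s) (Icc 0 1))
    (hd : ∀ s, ∀ t ∈ Icc (0 : ℝ) 1, HasDerivAt (fun σ => h σ t) (h' s t) s)
    (hc' : ContinuousOn (fun p : ℝ × ℝ => h' p.1 p.2) (univ ×ˢ Icc 0 1)) (s : ℝ) :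
    HasDerivAt (fun σ => ∫ t in (0 : ℝ)..1, h σ t) (∫ t in (0 : ℝ)..1, h' s t) s := by
  have hcomp : IsCompact (Icc (s - 1) (s + 1) ×ˢ Icc (0 : ℝ) 1) := isCompact_Icc.prod isCompact_Icc
  obtain ⟨B, hB⟩ := hcomp.exists_bound_of_continuousOn
    (hc'.mono (prod_mono (subset_univ _) subset_rfl))
  have hsl : ContinuousOn (h' s) (Icc 0 1) := hc'.comp (f := fun t : ℝ => (s, t))
    (by fun_prop) fun t ht => ⟨mem_univ _, ht⟩
  have hI : ∀ {g : ℝ → ℝ}, ContinuousOn g (Icc 0 1) →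
      MeasureTheory.AEStronglyMeasurable g (MeasureTheory.volume.restrict (uIoc 0 1)) := by
    intro g hg
    rw [uIoc_of_le zero_le_one]
    exact (hg.mono Ioc_subset_Icc_self).aestronglyMeasurable measurableSet_Ioc
  refine (intervalIntegral.hasDerivAt_integral_of_dominated_loc_of_deriv_le
    (F := h) (F' := h') (bound := fun _ => B)
    (s := Ioo (s - 1) (s + 1)) (Ioo_mem_nhds (by linarith) (by linarith))
    (Eventually.of_forall fun σ => hI (hc σ))
    ((hc s).intervalIntegrable_of_Icc zero_le_one) (hI hsl)
    (Eventually.of_forall fun t ht σ hσ => ?_) intervalIntegrable_const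
    (Eventually.of_forall fun t ht σ hσ => ?_)).2
  · rw [uIoc_of_le zero_le_one] at ht
    exact hB (σ, t) ⟨Ioo_subset_Icc_self hσ, Ioc_subset_Icc_self ht⟩
  · rw [uIoc_of_le zero_le_one] at ht
    exact hd σ t (Ioc_subset_Icc_self ht)

/-- Continuous convergence on a compact interval is uniform. -/
theorem eventually_forall_Icc_of_tendsto {X : Type*} [TopologicalSpace X] {u : ℝ × ℝ → X}
    {x : ℝ → X} {l : Filter ℝ} (h : ∀ t ∈ Icc (0 : ℝ) 1, Tendsto u (l ×ˢ 𝓝[Icc 0 1] t) (𝓝 (x t)))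
    {O : Set X} (hO : IsOpen O) (hx : ∀ t ∈ Icc (0 : ℝ) 1, x t ∈ O) :
    ∀ᶠ s in l, ∀ t ∈ Icc (0 : ℝ) 1, u (s, t) ∈ O := by
  refine (isCompact_Icc (a := (0 : ℝ)) (b := 1)).induction_on
    (p := fun A => ∀ᶠ s in l, ∀ t ∈ A, u (s, t) ∈ O) ?_ ?_ ?_ ?_
  · simp
  · intro A B hAB hB
    filter_upwards [hB] with s hs t ht using hs t (hAB ht)
  · intro A B hA hB
    filter_upwards [hA, hB] with s h1 h2 t ht using ht.elim (h1 t) (h2 t)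
  · intro t ht
    have h1 := (h t ht).eventually (hO.mem_nhds (hx t ht))
    obtain ⟨pa, ha, pb, hb, hab⟩ := eventually_prod_iff.1 h1
    exact ⟨{τ | pb τ}, hb, ha.mono fun s hs τ hτ => hab hs hτ⟩

/-! ### The maximum principle -/

/-- The scalar functions attached to a Floer strip `u`, together with the equations that they satisfy
where `f > r₀`. Here `f` is the value of the Hamiltonian along `u` without its constant,
`α = λ(∂_t u)`, `γ = λ(∂_s u)`, `e = |∂_s u|²`, `m = c_J⁻¹` comes from the almost complex structure,
and `b` is the logarithmic derivative, with respect to the parameter of the family, of the slope of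
the Hamiltonian. The derivative `∂_s b` is the sum of `b_s`, where only the parameter moves, and
`b_u`, where only the point of `N` moves; `κ` is the part of `e / f` that controls `b_u`. -/
structure StripData where
  (f α γ e m b : ℝ → ℝ → ℝ)
  (m_s b_s b_u κ : ℝ → ℝ → ℝ)
  r₀ : ℝ
  r₀_pos : 0 < r₀
  continuousOn_f : ContinuousOn (fun p : ℝ × ℝ => f p.1 p.2) (univ ×ˢ Icc 0 1)
  m_pos : ∀ s, ∀ t ∈ Icc (0 : ℝ) 1, 0 < m s t
  f_s : ∀ s, ∀ t ∈ Icc (0 : ℝ) 1, r₀ < f s t →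
    HasDerivAt (fun σ => f σ t) (b s t * f s t + (f s t - α s t) / m s t) s
  f_t : ∀ s, ∀ t ∈ Icc (0 : ℝ) 1, r₀ < f s t →
    HasDerivWithinAt (fun τ => f s τ) (γ s t / m s t) (Icc 0 1) t
  curl : ∀ s, ∀ t ∈ Icc (0 : ℝ) 1, r₀ < f s t → ∃ α_s γ_t,
    HasDerivAt (fun σ => α σ t) α_s s ∧ HasDerivWithinAt (fun τ => γ s τ) γ_t (Icc 0 1) t ∧
    α_s - γ_t = (f s t - α s t) / m s t - e s t
  hasDerivAt_m : ∀ s, ∀ t ∈ Icc (0 : ℝ) 1, HasDerivAt (fun σ => m σ t) (m_s s t) s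
  differentiable_m : ∀ s, ∀ t ∈ Icc (0 : ℝ) 1, DifferentiableWithinAt ℝ (fun τ => m s τ) (Icc 0 1) t
  hasDerivAt_b : ∀ s, ∀ t ∈ Icc (0 : ℝ) 1, r₀ < f s t →
    HasDerivAt (fun σ => b σ t) (b_s s t + b_u s t) s
  κ_nonneg : ∀ s, ∀ t ∈ Icc (0 : ℝ) 1, 0 ≤ κ s t
  energy : ∀ s, ∀ t ∈ Icc (0 : ℝ) 1, r₀ < f s t →
    (f s t - α s t) ^ 2 / (m s t * f s t) + f s t * κ s t ≤ e s t
  γ_zero : ∀ s, γ s 0 = 0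
  γ_one : ∀ s, γ s 1 = 0

namespace StripData

variable (D : StripData)

/-- At a maximum of `f e^φ` with `φ = φ(s)`, the second derivative of `φ` is bounded above. The Lagrangian
boundary condition `γ = 0` serves as a Neumann condition, so that maxima at `t = 0, 1` are treated
like interior ones. -/
theorem second_deriv_le_of_isMaxOn {φ φ' : ℝ → ℝ} {φ'' : ℝ} {S₁ S₂ s t c : ℝ}
    (hs : s ∈ Ioo S₁ S₂) (ht : t ∈ Icc (0 : ℝ) 1) (hf : D.r₀ < D.f s t)
    (hφ : ∀ s, HasDerivAt φ (φ' s) s) (hφ' : HasDerivAt φ' φ'' s)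
    (hmax : ∀ σ ∈ Icc S₁ S₂, ∀ τ ∈ Icc (0 : ℝ) 1,
      D.f σ τ * Real.exp (φ σ) ≤ D.f s t * Real.exp (φ s))
    (hc : 0 ≤ c) (hu : D.b_u s t ^ 2 ≤ c * D.κ s t) :
    φ'' ≤ - D.b_s s t + c * D.m s t / 4 - D.b s t * φ' s - D.b s t / D.m s t
      - (φ' s + D.b s t) * D.m_s s t / D.m s t := by
  have hm := D.m_pos s t ht
  have hf0 : 0 < D.f s t := D.r₀_pos.trans hf
  have hS : s ∈ Icc S₁ S₂ := Ioo_subset_Icc_self hs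
  obtain ⟨α_s, γ_t, hα, hγ, hcurl⟩ := D.curl s t ht hf
  -- the points near `(s, t)` where the equations hold
  have hcs : ContinuousAt (fun σ => D.f σ t) s := (D.f_s s t ht hf).continuousAt
  have hct : ContinuousWithinAt (fun τ => D.f s τ) (Icc 0 1) t := (D.f_t s t ht hf).continuousWithinAt
  have hevs : ∀ᶠ σ in 𝓝 s, D.r₀ < D.f σ t := hcs.eventually_const_lt hf
  have hevt : ∀ᶠ τ in 𝓝[Icc 0 1] t, D.r₀ < D.f s τ := hct.eventually_const_lt hf
  -- the maximum in the direction of `t`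
  have hmaxt : ∀ τ ∈ Icc (0 : ℝ) 1, D.f s τ ≤ D.f s t := fun τ hτ =>
    le_of_mul_le_mul_right (hmax s hS τ hτ) (Real.exp_pos _)
  have hγ0 : D.γ s t = 0 := by
    rcases ht.1.eq_or_lt with h | h
    · rw [← h]; exact D.γ_zero s
    rcases ht.2.eq_or_lt with h' | h'
    · rw [h']; exact D.γ_one s
    have hnh : Icc (0 : ℝ) 1 ∈ 𝓝 t := Icc_mem_nhds h h'
    have h1 : IsLocalMax (fun τ => D.f s τ) t := by
      filter_upwards [hnh] with τ hτ using hmaxt τ hτ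
    have h2 := h1.hasDerivAt_eq_zero ((D.f_t s t ht hf).hasDerivAt hnh)
    rcases div_eq_zero_iff.1 h2 with h3 | h3
    · exact h3
    · exact absurd h3 hm.ne'
  have hγt : γ_t ≤ 0 := by
    obtain ⟨m_t, hm_t⟩ : ∃ m_t, HasDerivWithinAt (fun τ => D.m s τ) m_t (Icc 0 1) t :=
      ⟨_, (D.differentiable_m s t ht).hasDerivWithinAt⟩
    have h1 := hγ.div hm_t hm.ne'
    have h2 := second_deriv_nonpos_of_isMaxOn zero_lt_one ht
      (by filter_upwards [hevt, self_mem_nhdsWithin] with τ h1 h2 using D.f_t s τ h2 h1) h1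
      (show D.γ s t / D.m s t = 0 by rw [hγ0, zero_div]) hmaxt
    rw [hγ0, zero_mul, sub_zero] at h2
    rcases div_nonpos_iff.1 h2 with ⟨h3, h4⟩ | ⟨h3, h4⟩
    · exact absurd h4 (not_le.2 (by positivity))
    · exact nonpos_of_mul_nonpos_left h3 hm
  -- the maximum in the direction of `s`
  set f := D.f s t with hfdef
  set m := D.m s t with hmdef
  set b := D.b s t with hbdef
  set p := φ' s with hp
  set P := (f - D.α s t) / m with hP
  have hnhs : Icc S₁ S₂ ∈ 𝓝 s := Icc_mem_nhds hs.1 hs.2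
  let g' : ℝ → ℝ := fun σ => (D.b σ t * D.f σ t + (D.f σ t - D.α σ t) / D.m σ t + φ' σ * D.f σ t) *
    Real.exp (φ σ)
  have hgd : ∀ᶠ σ in 𝓝 s, HasDerivAt (fun σ => D.f σ t * Real.exp (φ σ)) (g' σ) σ := by
    filter_upwards [hevs] with σ hσ
    refine ((D.f_s σ t ht hσ).mul (hφ σ).exp).congr_deriv ?_
    simp only [g']; ring
  have hfs0 : b * f + P + p * f = 0 := by
    have h1 : IsLocalMax (fun σ => D.f σ t * Real.exp (φ σ)) s := by
      filter_upwards [hnhs] with σ hσ using hmax σ hσ t ht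
    have h2 := h1.hasDerivAt_eq_zero hgd.self_of_nhds
    exact (mul_eq_zero.1 h2).resolve_right (Real.exp_pos _).ne'
  have hfs := D.f_s s t ht hf
  have hfs' : b * f + P = - (p * f) := by linarith
  have hd2 := (((D.hasDerivAt_b s t ht hf).mul hfs).add
    ((hfs.sub hα).div (D.hasDerivAt_m s t ht) hm.ne')).add (hφ'.mul hfs)
  have hg2 := hd2.mul (hφ s).exp
  have hsec := second_deriv_nonpos_of_isMaxOn (h := fun σ => D.f σ t * Real.exp (φ σ)) (h' := g')
    (hs.1.trans hs.2) hS (by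
      filter_upwards [mem_nhdsWithin_of_mem_nhds hgd] with σ hσ using hσ.hasDerivWithinAt)
    (hg2.hasDerivWithinAt) (by
      change (b * f + P + p * f) * _ = 0
      rw [hfs0, zero_mul]) (fun σ hσ => hmax σ hσ t ht)
  have hsec' : ((D.b_s s t + D.b_u s t) * f + b * (b * f + P) +
      ((b * f + P - α_s) * m - (f - D.α s t) * D.m_s s t) / m ^ 2 + (φ'' * f + p * (b * f + P))) *
        Real.exp (φ s) + (b * f + P + p * f) * (Real.exp (φ s) * p) ≤ 0 := hsec
  rw [hfs0, zero_mul, add_zero] at hsec'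
  have h1 := nonpos_of_mul_nonpos_left hsec' (Real.exp_pos _)
  -- the lower bound for the energy
  have hen := D.energy s t ht hf
  have hfα : f - D.α s t = P * m := by rw [hP]; field_simp
  have hPf : P = - (p + b) * f := by linarith
  rw [← hfdef, ← hmdef, hfα] at hen
  have h2 : (P * m) ^ 2 / (m * f) = (p + b) ^ 2 * m * f := by rw [hPf]; field_simp
  rw [h2] at hen
  have h3 : ((b * f + P - α_s) * m - (f - D.α s t) * D.m_s s t) / m ^ 2 =
      (b * f + P - α_s - P * D.m_s s t) / m := by rw [hfα]; field_simp
  rw [h3, hfs'] at h1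
  have h4 : f * ((p + b) + (p + b) ^ 2 * m + D.κ s t) ≤ - α_s := by
    have : f * ((p + b) + (p + b) ^ 2 * m + D.κ s t) =
      -P + ((p + b) ^ 2 * m * f + f * D.κ s t) := by rw [hPf]; ring
    linarith
  have h5 : f * (b + (p + b) ^ 2 * m + D.κ s t + (p + b) * D.m_s s t) / m ≤
      (-(p * f) - α_s - P * D.m_s s t) / m := by
    refine div_le_div_of_nonneg_right ?_ hm.le
    have : f * (b + (p + b) ^ 2 * m + D.κ s t + (p + b) * D.m_s s t) =
      -(p * f) + f * ((p + b) + (p + b) ^ 2 * m + D.κ s t) - P * D.m_s s t := by rw [hPf]; ring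
    linarith
  have h6 : f * (b + (p + b) ^ 2 * m + D.κ s t + (p + b) * D.m_s s t) / m =
      f * (b / m + (p + b) ^ 2 + D.κ s t / m + (p + b) * D.m_s s t / m) := by field_simp
  rw [h6] at h5
  have h7 : f * (D.b_s s t + D.b_u s t - b * p + (b / m + (p + b) ^ 2 + D.κ s t / m +
      (p + b) * D.m_s s t / m) + φ'' - p ^ 2) ≤ 0 := by
    have : f * (D.b_s s t + D.b_u s t - b * p + (b / m + (p + b) ^ 2 + D.κ s t / m +
      (p + b) * D.m_s s t / m) + φ'' - p ^ 2) = (D.b_s s t + D.b_u s t) * f + b * -(p * f) +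
      f * (b / m + (p + b) ^ 2 + D.κ s t / m + (p + b) * D.m_s s t / m) +
      (φ'' * f + p * -(p * f)) := by ring
    linarith
  have h8 := nonpos_of_mul_nonpos_right h7 hf0
  -- completing the square
  have h9 : - D.b_u s t - D.κ s t / m ≤ c * m / 4 := by
    have hκ := D.κ_nonneg s t ht
    have e1 : 0 ≤ c * m / 4 + D.κ s t / m := by positivity
    have e2 : D.b_u s t ^ 2 ≤ (c * m / 4 + D.κ s t / m) ^ 2 := by
      have e3 : (c * m / 4 + D.κ s t / m) ^ 2 - c * D.κ s t = (c * m / 4 - D.κ s t / m) ^ 2 := by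
        field_simp; ring
      have e4 := sq_nonneg (c * m / 4 - D.κ s t / m)
      linarith
    have := (abs_le_of_sq_le_sq' e2 e1).1
    linarith
  have h10 : (p + b) ^ 2 = p ^ 2 + 2 * (b * p) + b ^ 2 := by ring
  have h11 := sq_nonneg b
  linarith

/-- The maximum principle on a rectangle: if `φ''` exceeds the bound of `second_deriv_le_of_isMaxOn`, then
the maximum of `f e^φ` is attained on the sides `s = S₁, S₂` or where `f ≤ r₀`. -/
theorem le_of_second_deriv_gt {φ φ' φ'' : ℝ → ℝ} {S₁ S₂ R Φ : ℝ} (hS : S₁ ≤ S₂) (hR : D.r₀ ≤ R)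
    (hφ : ∀ s, HasDerivAt φ (φ' s) s) (hφ' : ∀ s, HasDerivAt φ' (φ'' s) s)
    (hφ0 : ∀ s ∈ Icc S₁ S₂, 0 ≤ φ s) (hφΦ : ∀ s ∈ Icc S₁ S₂, φ s ≤ Φ)
    (h₁ : ∀ t ∈ Icc (0 : ℝ) 1, D.f S₁ t ≤ R) (h₂ : ∀ t ∈ Icc (0 : ℝ) 1, D.f S₂ t ≤ R)
    (h : ∀ s ∈ Ioo S₁ S₂, ∀ t ∈ Icc (0 : ℝ) 1, D.r₀ < D.f s t → ∃ c : ℝ, 0 ≤ c ∧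
      D.b_u s t ^ 2 ≤ c * D.κ s t ∧
      - D.b_s s t + c * D.m s t / 4 - D.b s t * φ' s - D.b s t / D.m s t
        - (φ' s + D.b s t) * D.m_s s t / D.m s t < φ'' s) :
    ∀ s ∈ Icc S₁ S₂, ∀ t ∈ Icc (0 : ℝ) 1, D.f s t ≤ R * Real.exp Φ := by
  have hR0 : 0 ≤ R := D.r₀_pos.le.trans hR
  have hcont : ContinuousOn (fun p : ℝ × ℝ => D.f p.1 p.2 * Real.exp (φ p.1))
      (Icc S₁ S₂ ×ˢ Icc 0 1) := by
    refine (D.continuousOn_f.mono (prod_mono (subset_univ _) Subset.rfl)).mul ?_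
    have : Continuous φ := continuous_iff_continuousAt.2 fun s => (hφ s).continuousAt
    fun_prop
  obtain ⟨⟨s₁, t₁⟩, ⟨hs₁, ht₁⟩, hmax⟩ := (isCompact_Icc.prod isCompact_Icc).exists_isMaxOn
    ⟨(S₁, 0), left_mem_Icc.2 hS, left_mem_Icc.2 zero_le_one⟩ hcont
  have hmax' : ∀ σ ∈ Icc S₁ S₂, ∀ τ ∈ Icc (0 : ℝ) 1,
      D.f σ τ * Real.exp (φ σ) ≤ D.f s₁ t₁ * Real.exp (φ s₁) := fun σ hσ τ hτ =>
    hmax (mk_mem_prod hσ hτ)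
  have hbound : D.f s₁ t₁ ≤ R := by
    by_contra! hlt
    have hs₁' : s₁ ∈ Ioo S₁ S₂ := by
      refine ⟨lt_of_le_of_ne hs₁.1 ?_, lt_of_le_of_ne hs₁.2 ?_⟩
      · rintro rfl; exact absurd (h₁ t₁ ht₁) (not_le.2 hlt)
      · rintro rfl; exact absurd (h₂ t₁ ht₁) (not_le.2 hlt)
    have hlt' := hR.trans_lt hlt
    obtain ⟨c, hc, hu, hlt2⟩ := h s₁ hs₁' t₁ ht₁ hlt'
    exact absurd (D.second_deriv_le_of_isMaxOn hs₁' ht₁ hlt' hφ (hφ' s₁) hmax' hc hu)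
      (not_le.2 hlt2)
  intro s hs t ht
  have h3 := hmax' s hs t ht
  have h4 : D.f s₁ t₁ * Real.exp (φ s₁) ≤ R * Real.exp Φ :=
    mul_le_mul hbound (Real.exp_le_exp.2 (hφΦ s₁ hs₁)) (Real.exp_pos _).le hR0
  rcases le_or_gt (D.f s t) 0 with h5 | h5
  · exact h5.trans (by positivity)
  · have h6 : D.f s t * 1 ≤ D.f s t * Real.exp (φ s) :=
      mul_le_mul_of_nonneg_left (Real.one_le_exp (hφ0 s hs)) h5.le
    linarith

/-- The maximum principle where nothing depends on `s`: there is no loss of constants, whatever the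
length of the rectangle. -/
theorem le_of_stationary {S₁ S₂ R : ℝ} (hS : S₁ ≤ S₂) (hR : D.r₀ ≤ R)
    (h₁ : ∀ t ∈ Icc (0 : ℝ) 1, D.f S₁ t ≤ R) (h₂ : ∀ t ∈ Icc (0 : ℝ) 1, D.f S₂ t ≤ R)
    (h : ∀ s ∈ Ioo S₁ S₂, ∀ t ∈ Icc (0 : ℝ) 1, D.r₀ < D.f s t →
      D.b s t = 0 ∧ D.b_s s t = 0 ∧ D.b_u s t = 0 ∧ D.m_s s t = 0) :
    ∀ s ∈ Icc S₁ S₂, ∀ t ∈ Icc (0 : ℝ) 1, D.f s t ≤ R := by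
  intro s hs t ht
  have hR0 : 0 ≤ R := D.r₀_pos.le.trans hR
  set T := max (S₁ ^ 2) (S₂ ^ 2) with hT
  have hlim : Tendsto (fun ε : ℝ => R * Real.exp (ε * T)) (𝓝[>] 0) (𝓝 R) := by
    have : Continuous fun ε : ℝ => R * Real.exp (ε * T) := by fun_prop
    simpa using (this.tendsto 0).mono_left nhdsWithin_le_nhds
  refine ge_of_tendsto hlim ?_
  filter_upwards [self_mem_nhdsWithin] with ε (hε : 0 < ε)
  refine D.le_of_second_deriv_gt (φ := fun s => ε * s ^ 2) (φ' := fun s => ε * (2 * s))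
    (φ'' := fun _ => ε * 2) hS hR ?_ ?_ (fun s _ => by positivity) ?_ h₁ h₂ ?_ s hs t ht
  · intro s
    refine ((hasDerivAt_pow 2 s).const_mul ε).congr_deriv ?_
    simp
  · intro s
    refine (((hasDerivAt_id s).const_mul 2).const_mul ε).congr_deriv ?_
    simp
  · intro s hs
    refine mul_le_mul_of_nonneg_left ?_ hε.le
    rcases le_total 0 s with h0 | h0
    · exact (pow_le_pow_left₀ h0 hs.2 2).trans (le_max_right _ _)
    · refine le_trans ?_ (le_max_left _ _)
      nlinarith [hs.1]
  · intro s hs t ht hf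
    obtain ⟨h3, h4, h5, h6⟩ := h s hs t ht hf
    refine ⟨0, le_rfl, by rw [h5]; simp, ?_⟩
    rw [h3, h4, h6]; simp; exact hε

/-- The maximum principle with bounded coefficients: the constant depends on the bounds only. -/
theorem exists_factor (B c m₁ m₂ S : ℝ) (hB : 0 ≤ B) (hc : 0 ≤ c) (hm₁ : 0 < m₁) : ∃ F : ℝ, 0 ≤ F ∧
    ∀ (D : StripData) (S₁ S₂ R : ℝ), -S ≤ S₁ → S₁ ≤ S₂ → S₂ ≤ S → D.r₀ ≤ R →
      (∀ t ∈ Icc (0 : ℝ) 1, D.f S₁ t ≤ R) → (∀ t ∈ Icc (0 : ℝ) 1, D.f S₂ t ≤ R) →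
      (∀ s ∈ Ioo S₁ S₂, ∀ t ∈ Icc (0 : ℝ) 1, D.r₀ < D.f s t → D.b_u s t ^ 2 ≤ c * D.κ s t ∧
        |D.b s t| ≤ B ∧ |D.b_s s t| ≤ B ∧ |D.m_s s t| ≤ B ∧ m₁ ≤ D.m s t ∧ D.m s t ≤ m₂) →
      ∀ s ∈ Icc S₁ S₂, ∀ t ∈ Icc (0 : ℝ) 1, D.f s t ≤ R * F := by
  -- `φ = A e^{ks}` with `k` and `A` large
  obtain ⟨C₁, hC₁⟩ : ∃ C₁, C₁ = B + c * |m₂| / 4 + B / m₁ + B * B / m₁ + (B + B / m₁) + 1 :=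
    ⟨_, rfl⟩
  have hC₁0 : 0 < C₁ := by rw [hC₁]; positivity
  obtain ⟨k, hk⟩ : ∃ k, k = C₁ + 1 := ⟨_, rfl⟩
  obtain ⟨A, hA⟩ : ∃ A, A = (C₁ + 1) * Real.exp (k * S) := ⟨_, rfl⟩
  have hk0 : 0 < k := by rw [hk]; positivity
  have hA0 : 0 < A := by rw [hA]; positivity
  refine ⟨Real.exp (A * Real.exp (k * S)), (Real.exp_pos _).le, ?_⟩
  intro D S₁ S₂ R hS₁ hS₁₂ hS₂ hR h₁ h₂ h
  have hlow : ∀ s, -S ≤ s → C₁ + 1 ≤ A * Real.exp (k * s) := by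
    intro s hs
    rw [hA, mul_assoc, ← Real.exp_add]
    have h1 : 0 ≤ k * S + k * s := by
      rw [← mul_add]; exact mul_nonneg hk0.le (by linarith)
    have h2 := mul_le_mul_of_nonneg_left (Real.one_le_exp h1) (by linarith : 0 ≤ C₁ + 1)
    linarith
  refine D.le_of_second_deriv_gt (φ := fun s => A * Real.exp (k * s))
    (φ' := fun s => A * (Real.exp (k * s) * k)) (φ'' := fun s => A * (Real.exp (k * s) * k * k))
    hS₁₂ hR ?_ ?_ (fun s _ => by positivity) ?_ h₁ h₂ ?_
  · intro s
    exact (((((hasDerivAt_id s).const_mul k).congr_deriv (mul_one k)).exp).const_mul A)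
  · intro s
    exact ((((((hasDerivAt_id s).const_mul k).congr_deriv (mul_one k)).exp).mul_const k).const_mul A)
  · intro s hs
    refine mul_le_mul_of_nonneg_left (Real.exp_le_exp.2 ?_) hA0.le
    exact mul_le_mul_of_nonneg_left (hs.2.trans hS₂) (by positivity)
  · intro s hs t ht hf
    obtain ⟨hu, hb, hbs, hms, hm1, hm2⟩ := h s hs t ht hf
    refine ⟨c, hc, hu, ?_⟩
    have hm : 0 < D.m s t := hm₁.trans_le hm1
    obtain ⟨m, hmdef⟩ : ∃ m, m = D.m s t := ⟨_, rfl⟩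
    obtain ⟨x, hx⟩ : ∃ x, x = A * Real.exp (k * s) := ⟨_, rfl⟩
    have hxl := hlow s (hS₁.trans hs.1.le)
    rw [← hx] at hxl
    have e1 : A * (Real.exp (k * s) * k) = k * x := by rw [hx]; ring
    have e2 : A * (Real.exp (k * s) * k * k) = k * (k * x) := by rw [hx]; ring
    rw [e1, e2]
    obtain ⟨p, hp⟩ : ∃ p, p = k * x := ⟨_, rfl⟩
    rw [← hp, ← hmdef]
    rw [← hmdef] at hm hm1 hm2
    have hx0 : 0 ≤ x := by linarith
    have hp0 : 0 ≤ p := by rw [hp]; positivity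
    have f1 : - D.b_s s t ≤ B := (neg_le_abs _).trans hbs
    have f2 : c * m / 4 ≤ c * |m₂| / 4 := by
      have : m ≤ |m₂| := hm2.trans (le_abs_self _)
      gcongr
    have f3 : - (D.b s t * p) ≤ B * p := by
      have : -D.b s t ≤ B := (neg_le_abs _).trans hb
      have := mul_le_mul_of_nonneg_right this hp0
      linarith
    have f4 : - (D.b s t / m) ≤ B / m₁ := by
      rw [← neg_div]
      exact div_le_div₀ hB ((neg_le_abs _).trans hb) hm₁ hm1
    have f5 : - ((p + D.b s t) * D.m_s s t / m) ≤ (p + B) * B / m₁ := by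
      rw [← neg_div]
      refine div_le_div₀ (by positivity) ?_ hm₁ hm1
      calc -((p + D.b s t) * D.m_s s t) ≤ |(p + D.b s t) * D.m_s s t| := neg_le_abs _
        _ = |p + D.b s t| * |D.m_s s t| := abs_mul _ _
        _ ≤ (p + B) * B := by
          refine mul_le_mul ?_ hms (abs_nonneg _) (by positivity)
          calc |p + D.b s t| ≤ |p| + |D.b s t| := abs_add_le _ _
            _ ≤ p + B := by rw [abs_of_nonneg hp0]; linarith
    have f6 : (p + B) * B / m₁ = p * (B / m₁) + B * B / m₁ := by field_simp
    have f7 : C₁ < p := by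
      have h1 : 1 * x ≤ k * x := mul_le_mul_of_nonneg_right (by linarith) hx0
      linarith
    have g1 : 0 ≤ B / m₁ := by positivity
    have g2 : 0 ≤ c * |m₂| / 4 := by positivity
    have g3 : 0 ≤ B * B / m₁ := by positivity
    have f8 : (B + B / m₁) * p ≤ C₁ * p := mul_le_mul_of_nonneg_right (by linarith) hp0
    have f10 : k * p = C₁ * p + p := by rw [hk]; ring
    have f11 : (B + B / m₁) * p = B * p + p * (B / m₁) := by ring
    linarith

end StripData

variable {n : ℕ} [NeZero n]
  {M : Type*} [TopologicalSpace M] [ChartedSpace (EuclideanHalfSpace (2 * n)) M]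
  [IsManifold (𝓡∂ (2 * n)) ∞ M]
  {N : Type*} [TopologicalSpace N] [ChartedSpace (EuclideanSpace ℝ (Fin (2 * n - 1))) N]
  [IsManifold (𝓡 (2 * n - 1)) ∞ N]
  {L : Type*} [TopologicalSpace L] [ChartedSpace (EuclideanHalfSpace n) L]
  [IsManifold (𝓡∂ n) ∞ L]
  {Q : LiouvilleQuadruple n M N L}
  {W : Type*} [TopologicalSpace W] [ChartedSpace (EuclideanSpace ℝ (Fin (2 * n))) W]
  [IsManifold (𝓡 (2 * n)) ∞ W]

namespace Completion

/-! ### The Liouville form and the symplectic form on the cylindrical part -/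

section

/-- The model space of the completion. -/
abbrev EW (n : ℕ) : Type := EuclideanSpace ℝ (Fin (2 * n))

/-- The model space of the boundary. -/
abbrev EN (n : ℕ) : Type := EuclideanSpace ℝ (Fin (2 * n - 1))

variable (C : Completion Q W)

/-- The Liouville vector field `X`, with values in the model space. This and the definitions below
restate fields on tangent spaces as functions with values in one fixed normed space, on which
linear algebra and estimates can be done without dependent types. -/
def Xv (x : W) : EW n := C.X x

/-- The Liouville form `λ`, as a field of linear forms on the model space. -/
def lamv (x : W) : EW n →L[ℝ] ℝ := C.lam x

/-- The contact form on the boundary, as a field of linear forms on the model space. -/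
def _root_.Floer.LiouvilleQuadruple.bdryLamv (Q : LiouvilleQuadruple n M N L) (z : N) :
    EN n →L[ℝ] ℝ := Q.bdryLam z

/-- The exterior derivative of the contact form on the boundary, on the model space. -/
def _root_.Floer.LiouvilleQuadruple.dBdryLam (Q : LiouvilleQuadruple n M N L) (z : N)
    (v w : EN n) : ℝ := OneForm.d Q.bdryLam z v w

/-- The symplectic form `dλ`, as a continuous bilinear form on the model space. It agrees with `C.Ω`
by definition. -/
def Om (x : W) : EW n →L[ℝ] EW n →L[ℝ] ℝ :=
  let D := fderivWithin ℝ (OneForm.inChart C.lam x) (range (𝓡 (2 * n)))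
    (extChartAt (𝓡 (2 * n)) x x)
  let A : EW n →L[ℝ] EW n := chartDeriv (I := 𝓡 (2 * n)) x
  D.bilinearComp A A - (D.bilinearComp A A).flip

theorem Om_antisymm (x : W) (v w : EW n) : C.Om x v w = - C.Om x w v := by
  simp only [Om, sub_apply, ContinuousLinearMap.flip_apply]; ring

theorem Om_self (x : W) (v : EW n) : C.Om x v v = 0 := by
  have := C.Om_antisymm x v v; linarith

/-- The horizontal part of the derivative of `cyl`: the derivative in the direction of `N`. -/
def hor (z : N) (ρ : ℝ) : EN n →L[ℝ] EW n :=
  mfderiv (𝓡 (2 * n - 1)) (𝓡 (2 * n)) (fun z' => C.cyl z' ρ) z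

/-- The derivative of `cyl : N × (0, ∞) → W` at `(z, ρ)`; the direction `∂_ρ` is mapped to `ρ⁻¹ X`. -/
def dcyl (z : N) (ρ : ℝ) : EN n × ℝ →L[ℝ] EW n :=
  (C.hor z ρ).coprod ((1 : ℝ →L[ℝ] ℝ).smulRight (ρ⁻¹ • C.Xv (C.cyl z ρ)))

theorem dcyl_apply (z : N) (ρ : ℝ) (w : EN n) (τ : ℝ) :
    C.dcyl z ρ (w, τ) = C.hor z ρ w + τ • (ρ⁻¹ • C.Xv (C.cyl z ρ)) := rfl

theorem contMDiffAt_cyl {z : N} {ρ : ℝ} (hρ : 0 < ρ) :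
    ContMDiffAt ((𝓡 (2 * n - 1)).prod 𝓘(ℝ, ℝ)) (𝓡 (2 * n)) ∞
      (fun p : N × ℝ => C.cyl p.1 p.2) (z, ρ) :=
  C.cyl_smooth.contMDiffAt (prod_mem_nhds univ_mem (Ioi_mem_nhds hρ))

theorem hasMFDerivAt_cyl {z : N} {ρ : ℝ} (hρ : 0 < ρ) :
    HasMFDerivAt ((𝓡 (2 * n - 1)).prod 𝓘(ℝ, ℝ)) (𝓡 (2 * n))
      (fun p : N × ℝ => C.cyl p.1 p.2) (z, ρ) (C.dcyl z ρ) := by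
  have h := (C.contMDiffAt_cyl (z := z) hρ).mdifferentiableAt (by simp)
  have h2 := h.hasMFDerivAt
  have h3 : mfderiv ((𝓡 (2 * n - 1)).prod 𝓘(ℝ, ℝ)) (𝓡 (2 * n))
      (fun p : N × ℝ => C.cyl p.1 p.2) (z, ρ) = C.dcyl z ρ := by
    refine ContinuousLinearMap.ext fun v => ?_
    rw [mfderiv_prod_eq_add_apply h]
    refine congrArg₂ (· + ·) rfl ?_
    have h4 := C.deriv_cyl z ρ hρ
    let B : ℝ →L[ℝ] EW n := mfderiv 𝓘(ℝ, ℝ) (𝓡 (2 * n)) (C.cyl z) ρ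
    have h4' : B 1 = ρ⁻¹ • C.Xv (C.cyl z ρ) := h4
    change B v.2 = v.2 • (ρ⁻¹ • C.Xv (C.cyl z ρ))
    rw [← h4', ← map_smul, smul_eq_mul, mul_one]
  rw [h3] at h2
  exact h2

theorem lamv_Xv {z : N} {ρ : ℝ} (hρ : 1 ≤ ρ) : C.lamv (C.cyl z ρ) (C.Xv (C.cyl z ρ)) = 0 := by
  have h := (C.lam_cyl z ρ hρ).2
  have h0 : (0 : ℝ) < ρ := by linarith
  rw [C.deriv_cyl z ρ h0, map_smul, smul_eq_mul] at h
  exact (mul_eq_zero.1 h).resolve_left (inv_ne_zero h0.ne')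

theorem lamv_hor {z : N} {ρ : ℝ} (hρ : 1 ≤ ρ) (w : EN n) :
    C.lamv (C.cyl z ρ) (C.hor z ρ w) = ρ * Q.bdryLamv z w :=
  (C.lam_cyl z ρ hρ).1 w

theorem lamv_dcyl {z : N} {ρ : ℝ} (hρ : 1 ≤ ρ) (w : EN n) (τ : ℝ) :
    C.lamv (C.cyl z ρ) (C.dcyl z ρ (w, τ)) = ρ * Q.bdryLamv z w := by
  rw [dcyl_apply, map_add, map_smul, map_smul, C.lamv_hor hρ, C.lamv_Xv hρ]; simp

/-- `cyl`, with its first argument expressed in the chart at `z`. -/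
def cylMap (z : N) (q : EN n × ℝ) : W :=
  C.cyl ((extChartAt (𝓡 (2 * n - 1)) z).symm q.1) q.2

/-- The derivative of the inverse of the chart at `z`. -/
def invDeriv (z : N) (y : EN n) : EN n →L[ℝ] EN n := chartInvDeriv (I := 𝓡 (2 * n - 1)) z y

theorem contMDiffOn_cylMap (z : N) :
    ContMDiffOn 𝓘(ℝ, EN n × ℝ) (𝓡 (2 * n)) ∞ (C.cylMap z)
      ((extChartAt (𝓡 (2 * n - 1)) z).target ×ˢ Ioi 0) := by
  have h1 : ContMDiffOn 𝓘(ℝ, EN n × ℝ) ((𝓡 (2 * n - 1)).prod 𝓘(ℝ, ℝ)) ∞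
      (fun q : EN n × ℝ => ((extChartAt (𝓡 (2 * n - 1)) z).symm q.1, q.2))
      ((extChartAt (𝓡 (2 * n - 1)) z).target ×ˢ Ioi 0) := by
    apply ContMDiffOn.prodMk
    · exact (contMDiffOn_extChartAt_symm z).comp contDiff_fst.contMDiff.contMDiffOn (fun q hq => hq.1)
    · exact contDiff_snd.contMDiff.contMDiffOn
  exact C.cyl_smooth.comp h1 (fun q hq => ⟨mem_univ _, hq.2⟩)

omit [NeZero n] in
theorem hasMFDerivAt_extChartAt_symm (z : N) {y : EN n}
    (hy : y ∈ (extChartAt (𝓡 (2 * n - 1)) z).target) :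
    HasMFDerivAt (𝓡 (2 * n - 1)) (𝓡 (2 * n - 1)) (extChartAt (𝓡 (2 * n - 1)) z).symm y
      (invDeriv z y) := by
  have := (mdifferentiableWithinAt_extChartAt_symm (I := 𝓡 (2 * n - 1)) hy).hasMFDerivWithinAt
  exact this.hasMFDerivAt (by simp)

theorem hasMFDerivAt_cylMap (z : N) {y : EN n} {ρ : ℝ}
    (hy : y ∈ (extChartAt (𝓡 (2 * n - 1)) z).target) (hρ : 0 < ρ) :
    HasMFDerivAt 𝓘(ℝ, EN n × ℝ) (𝓡 (2 * n)) (C.cylMap z) (y, ρ)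
      ((C.dcyl ((extChartAt (𝓡 (2 * n - 1)) z).symm y) ρ).comp
        ((invDeriv z y).prodMap (ContinuousLinearMap.id ℝ ℝ))) := by
  have h1 : HasMFDerivAt 𝓘(ℝ, EN n × ℝ) (𝓡 (2 * n - 1))
      (fun q : EN n × ℝ => (extChartAt (𝓡 (2 * n - 1)) z).symm q.1) (y, ρ)
      ((invDeriv z y).comp (ContinuousLinearMap.fst ℝ (EN n) ℝ)) :=
    (hasMFDerivAt_extChartAt_symm z hy).comp (f := Prod.fst) (y, ρ)
      (hasFDerivAt_fst (𝕜 := ℝ) (p := (y, ρ))).hasMFDerivAt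
  have h2 : HasMFDerivAt 𝓘(ℝ, EN n × ℝ) 𝓘(ℝ, ℝ)
      (fun q : EN n × ℝ => q.2) (y, ρ) (ContinuousLinearMap.snd ℝ (EN n) ℝ) :=
    (hasFDerivAt_snd (𝕜 := ℝ) (p := (y, ρ))).hasMFDerivAt
  exact (C.hasMFDerivAt_cyl (z := (extChartAt (𝓡 (2 * n - 1)) z).symm y) hρ).comp
    (f := fun q : EN n × ℝ => ((extChartAt (𝓡 (2 * n - 1)) z).symm q.1, q.2)) (y, ρ) (h1.prodMk h2)

/-- The contact form on the boundary in the chart at `z`. -/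
def lamChart (Q : LiouvilleQuadruple n M N L) (z : N) (y : EN n) : EN n →L[ℝ] ℝ :=
  OneForm.inChart Q.bdryLam z y

theorem lamChart_apply (z : N) (y v : EN n) :
    lamChart Q z y v = Q.bdryLamv ((extChartAt (𝓡 (2 * n - 1)) z).symm y) (invDeriv z y v) := rfl

theorem uniqueDiffOn_target_prod (z : N) :
    UniqueDiffOn ℝ ((extChartAt (𝓡 (2 * n - 1)) z).target ×ˢ Ici (1 : ℝ)) :=
  (isOpen_extChartAt_target z).uniqueDiffOn.prod (uniqueDiffOn_Ici 1)

theorem mfderivWithin_cylMap (z : N) {y : EN n} {ρ : ℝ}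
    (hy : y ∈ (extChartAt (𝓡 (2 * n - 1)) z).target) (hρ : 1 ≤ ρ) (v : EN n × ℝ):
    (mfderivWithin 𝓘(ℝ, EN n × ℝ) (𝓡 (2 * n)) (C.cylMap z)
      ((extChartAt (𝓡 (2 * n - 1)) z).target ×ˢ Ici (1 : ℝ)) (y, ρ) : EN n × ℝ →L[ℝ] EW n) v =
      C.dcyl ((extChartAt (𝓡 (2 * n - 1)) z).symm y) ρ (invDeriv z y v.1, v.2) := by
  have h0 : (0 : ℝ) < ρ := by linarith
  rw [(C.hasMFDerivAt_cylMap z hy h0).hasMFDerivWithinAt.mfderivWithin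
    ((uniqueDiffOn_target_prod z) (y, ρ) ⟨hy, hρ⟩).uniqueMDiffWithinAt]
  rfl

/-- On the cylindrical part, `λ` is `ρ` times the contact form of the boundary. -/
theorem pullback_cylMap (z : N) {q : EN n × ℝ}
    (hq : q ∈ (extChartAt (𝓡 (2 * n - 1)) z).target ×ˢ Ici (1 : ℝ)) :
    pullbackWithin C.lam (C.cylMap z) ((extChartAt (𝓡 (2 * n - 1)) z).target ×ˢ Ici (1 : ℝ)) q =
      q.2 • (lamChart Q z q.1).comp (ContinuousLinearMap.fst ℝ (EN n) ℝ) := by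
  obtain ⟨y, ρ⟩ := q
  refine ContinuousLinearMap.ext fun v => ?_
  change C.lamv (C.cyl _ ρ) ((mfderivWithin 𝓘(ℝ, EN n × ℝ) (𝓡 (2 * n)) (C.cylMap z)
      ((extChartAt (𝓡 (2 * n - 1)) z).target ×ˢ Ici (1 : ℝ)) (y, ρ) : EN n × ℝ →L[ℝ] EW n) v) =
      ρ * lamChart Q z y v.1
  rw [C.mfderivWithin_cylMap z hq.1 hq.2, C.lamv_dcyl hq.2, lamChart_apply]

theorem contDiffOn_pullback_cylMap (z : N) : ContDiffOn ℝ ∞ (pullbackWithin C.lam (C.cylMap z)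
    ((extChartAt (𝓡 (2 * n - 1)) z).target ×ˢ Ici (1 : ℝ)))
    ((extChartAt (𝓡 (2 * n - 1)) z).target ×ˢ Ici (1 : ℝ)) :=
  contDiffOn_pullbackWithin C.smooth_lam ((C.contMDiffOn_cylMap z).mono
    (prod_mono le_rfl (fun _ h => lt_of_lt_of_le zero_lt_one (mem_Ici.1 h)))) (uniqueDiffOn_target_prod z)

/-- The contact form is smooth, being the restriction of the pullback of `λ` to `ρ = 1`. -/
theorem contDiffOn_lamChart (C : Completion Q W) (z : N) :
    ContDiffOn ℝ ∞ (lamChart Q z) (extChartAt (𝓡 (2 * n - 1)) z).target := by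
  have h := (C.contDiffOn_pullback_cylMap z).comp
    (f := fun y : EN n => (y, (1 : ℝ))) (s := (extChartAt (𝓡 (2 * n - 1)) z).target)
    (contDiff_id.prodMk contDiff_const).contDiffOn (fun y hy => ⟨hy, mem_Ici.2 le_rfl⟩)
  have h2 : ContDiffOn ℝ ∞ (fun y => (pullbackWithin C.lam (C.cylMap z)
    ((extChartAt (𝓡 (2 * n - 1)) z).target ×ˢ Ici (1 : ℝ)) (y, 1)).comp
      (ContinuousLinearMap.inl ℝ (EN n) ℝ)) (extChartAt (𝓡 (2 * n - 1)) z).target :=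
    ContDiffOn.clm_comp h contDiffOn_const
  refine h2.congr fun y hy => ?_
  refine ContinuousLinearMap.ext fun v => ?_
  rw [ContinuousLinearMap.comp_apply,
    C.pullback_cylMap z ⟨hy, mem_Ici.2 le_rfl⟩]
  simp

theorem dBdryLam_apply (z : N) (v w : EN n) : Q.dBdryLam z v w =
    fderiv ℝ (lamChart Q z) (extChartAt (𝓡 (2 * n - 1)) z z) v w -
      fderiv ℝ (lamChart Q z) (extChartAt (𝓡 (2 * n - 1)) z z) w v := by
  have h : ∀ v : EN n, (chartDeriv (I := 𝓡 (2 * n - 1)) z : EN n →L[ℝ] EN n) v = v := fun v =>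
    DFunLike.congr_fun (mfderiv_extChartAt_self (I := 𝓡 (2 * n - 1)) (x := z)) v
  change fderivWithin ℝ (lamChart Q z) (range (𝓡 (2 * n - 1))) (extChartAt (𝓡 (2 * n - 1)) z z)
      ((chartDeriv (I := 𝓡 (2 * n - 1)) z : EN n →L[ℝ] EN n) v)
      ((chartDeriv (I := 𝓡 (2 * n - 1)) z : EN n →L[ℝ] EN n) w) -
    fderivWithin ℝ (lamChart Q z) (range (𝓡 (2 * n - 1))) (extChartAt (𝓡 (2 * n - 1)) z z)
      ((chartDeriv (I := 𝓡 (2 * n - 1)) z : EN n →L[ℝ] EN n) w)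
      ((chartDeriv (I := 𝓡 (2 * n - 1)) z : EN n →L[ℝ] EN n) v) = _
  rw [h, h, show range (𝓡 (2 * n - 1)) = univ by simp, fderivWithin_univ]

theorem invDeriv_self (z : N) (v : EN n) :
    invDeriv z (extChartAt (𝓡 (2 * n - 1)) z z) v = v :=
  DFunLike.congr_fun (mfderivWithin_range_extChartAt_symm (I := 𝓡 (2 * n - 1)) (x := z)) v

/-- The symplectic form on the cylindrical part: `d(ρ λ) = dρ ∧ λ + ρ dλ`. At `ρ = 1` the derivatives
are one-sided, because the formula `λ(z, ρ) = ρ λ(z)` is only given for `ρ ≥ 1`. -/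
theorem Om_dcyl {z : N} {ρ : ℝ} (hρ : 1 ≤ ρ) (w₁ w₂ : EN n) (τ₁ τ₂ : ℝ) :
    C.Om (C.cyl z ρ) (C.dcyl z ρ (w₁, τ₁)) (C.dcyl z ρ (w₂, τ₂)) =
      τ₁ * Q.bdryLamv z w₂ - τ₂ * Q.bdryLamv z w₁ + ρ * Q.dBdryLam z w₁ w₂ := by
  set y := extChartAt (𝓡 (2 * n - 1)) z z with hy
  have hyt : y ∈ (extChartAt (𝓡 (2 * n - 1)) z).target := mem_extChartAt_target z
  set S : Set (EN n × ℝ) := (extChartAt (𝓡 (2 * n - 1)) z).target ×ˢ Ici (1 : ℝ) with hSd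
  have hmem : (y, ρ) ∈ S := ⟨hyt, hρ⟩
  have hcl : (y, ρ) ∈ closure (interior S) := by
    rw [hSd, interior_prod_eq, closure_prod_eq, interior_Ici, closure_Ioi,
      (isOpen_extChartAt_target z).interior_eq]
    exact ⟨subset_closure hyt, hρ⟩
  have huS : ContMDiffOn 𝓘(ℝ, EN n × ℝ) (𝓡 (2 * n)) ∞ (C.cylMap z) S := (C.contMDiffOn_cylMap z).mono
    (prod_mono le_rfl (fun _ h => lt_of_lt_of_le zero_lt_one (mem_Ici.1 h)))
  have key := fderivWithin_pullbackWithin_sub C.smooth_lam huS (uniqueDiffOn_target_prod z) hmem hcl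
    (w₁, τ₁) (w₂, τ₂)
  have hd : ∀ v : EN n × ℝ, (mfderivWithin 𝓘(ℝ, EN n × ℝ) (𝓡 (2 * n)) (C.cylMap z) S (y, ρ) :
      EN n × ℝ →L[ℝ] EW n) v = C.dcyl z ρ v := by
    intro v
    rw [C.mfderivWithin_cylMap z hyt hρ, invDeriv_self, extChartAt_to_inv]
  have hpt : C.cylMap z (y, ρ) = C.cyl z ρ := by
    simp only [cylMap, hy, extChartAt_to_inv]
  have e1 : OneForm.d C.lam (C.cylMap z (y, ρ))
      (mfderivWithin 𝓘(ℝ, EN n × ℝ) (𝓡 (2 * n)) (C.cylMap z) S (y, ρ) (w₁, τ₁))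
      (mfderivWithin 𝓘(ℝ, EN n × ℝ) (𝓡 (2 * n)) (C.cylMap z) S (y, ρ) (w₂, τ₂)) =
      C.Om (C.cyl z ρ) (C.dcyl z ρ (w₁, τ₁)) (C.dcyl z ρ (w₂, τ₂)) := by
    rw [← hd, ← hd, ← hpt]; rfl
  rw [← e1, ← key, dBdryLam_apply, ← hy]
  have hl : HasFDerivAt (lamChart Q z) (fderiv ℝ (lamChart Q z) y) y :=
    (((contDiffOn_lamChart C z).contDiffAt ((isOpen_extChartAt_target z).mem_nhds hyt)).differentiableAt
      (by simp)).hasFDerivAt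
  have hl1 : HasFDerivAt (fun q : EN n × ℝ => lamChart Q z q.1)
      ((fderiv ℝ (lamChart Q z) y).comp (ContinuousLinearMap.fst ℝ (EN n) ℝ)) (y, ρ) :=
    hl.comp (f := Prod.fst) (y, ρ) hasFDerivAt_fst
  have hl2 := hl1.clm_comp (hasFDerivAt_const (ContinuousLinearMap.fst ℝ (EN n) ℝ) (y, ρ))
  -- the pullback of `λ` is `ρ λ`, to be differentiated by the product rule
  have hl3 := (hasFDerivAt_snd (𝕜 := ℝ) (p := (y, ρ))).smul hl2
  have hl4 := (hl3.hasFDerivWithinAt (s := S)).congr_of_eventuallyEq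
    (f₁ := pullbackWithin C.lam (C.cylMap z) S)
    (Filter.eventually_of_mem self_mem_nhdsWithin fun q hq => C.pullback_cylMap z hq)
    (C.pullback_cylMap z hmem)
  rw [hl4.fderivWithin (uniqueDiffOn_target_prod z _ hmem)]
  have hb : ∀ v, lamChart Q z y v = Q.bdryLamv z v := by
    intro v; rw [lamChart_apply, hy, invDeriv_self, extChartAt_to_inv]
  simp [hb]
  ring

end

/-! ### The cylindrical part is a local diffeomorphism -/

section

/-- The derivative of the identification of `N` with the boundary of `M`. -/
def dbdry (Q : LiouvilleQuadruple n M N L) (z : N) : EN n →L[ℝ] EW n :=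
  mfderiv (𝓡 (2 * n - 1)) (𝓡∂ (2 * n)) Q.bdry z

/-- Tangent vectors of the boundary have vanishing zeroth coordinate, because that coordinate is
nonnegative on `M` and vanishes at `bdry z`. -/
theorem fst_coord_bdry_deriv (Q : LiouvilleQuadruple n M N L) (z : N) (w : EN n) :
    dbdry Q z w 0 = 0 := by
  set p := Q.bdry z with hp
  let π₀ : EW n →L[ℝ] ℝ := EuclideanSpace.proj 0
  let D : EN n →L[ℝ] EW n := mfderiv (𝓡 (2 * n - 1)) (𝓡∂ (2 * n)) Q.bdry z
  have hb : extChartAt (𝓡∂ (2 * n)) p p ∈ frontier (range (𝓡∂ (2 * n))) := by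
    have : p ∈ (𝓡∂ (2 * n)).boundary M := by rw [← Q.range_bdry]; exact mem_range_self z
    exact this
  rw [frontier_range_modelWithCornersEuclideanHalfSpace] at hb
  have h1 : HasMFDerivAt (𝓡 (2 * n - 1)) 𝓘(ℝ, EW n)
      (fun z' => extChartAt (𝓡∂ (2 * n)) p (Q.bdry z')) z D := by
    have := (mdifferentiableAt_extChartAt (I := 𝓡∂ (2 * n))
      (mem_chart_source _ p)).hasMFDerivAt.comp z
      ((Q.bdry_embedding.contMDiff z).mdifferentiableAt (by simp)).hasMFDerivAt
    rw [mfderiv_extChartAt_self] at this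
    exact this
  have h2 : HasFDerivWithinAt (fun y => extChartAt (𝓡∂ (2 * n)) p
      (Q.bdry ((extChartAt (𝓡 (2 * n - 1)) z).symm y))) D (range (𝓡 (2 * n - 1)))
      (extChartAt (𝓡 (2 * n - 1)) z z) := h1.2
  have h3 : HasFDerivAt (fun y => extChartAt (𝓡∂ (2 * n)) p
      (Q.bdry ((extChartAt (𝓡 (2 * n - 1)) z).symm y))) D (extChartAt (𝓡 (2 * n - 1)) z z) :=
    h2.hasFDerivAt (by simp)
  have h4 := π₀.hasFDerivAt.comp (extChartAt (𝓡 (2 * n - 1)) z z) h3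
  -- the zeroth coordinate has a minimum at the point
  have h5 : IsLocalMin (π₀ ∘ fun y => extChartAt (𝓡∂ (2 * n)) p
      (Q.bdry ((extChartAt (𝓡 (2 * n - 1)) z).symm y))) (extChartAt (𝓡 (2 * n - 1)) z z) := by
    refine Filter.Eventually.of_forall fun y => ?_
    have h6 : ∀ q, 0 ≤ π₀ (extChartAt (𝓡∂ (2 * n)) p q) := by
      intro q
      have : extChartAt (𝓡∂ (2 * n)) p q ∈ range (𝓡∂ (2 * n)) := by
        rw [extChartAt_coe]; exact mem_range_self _
      rw [range_modelWithCornersEuclideanHalfSpace] at this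
      exact this
    have h7 : π₀ (extChartAt (𝓡∂ (2 * n)) p p) = 0 := hb.symm
    have h8 : (π₀ ∘ fun y => extChartAt (𝓡∂ (2 * n)) p
      (Q.bdry ((extChartAt (𝓡 (2 * n - 1)) z).symm y))) (extChartAt (𝓡 (2 * n - 1)) z z) = 0 := by
      simp only [Function.comp_apply, extChartAt_to_inv]
      exact h7
    rw [h8]
    exact h6 _
  have h9 := h5.hasFDerivAt_eq_zero h4
  exact DFunLike.congr_fun h9 w

variable (C : Completion Q W)

/-- The Liouville vector field is transverse to the boundary, so that `cyl` is an immersion at `ρ = 1`. -/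
theorem dcyl_one_injective (z : N) : Function.Injective (C.dcyl z 1) := by
  rw [injective_iff_map_eq_zero]
  rintro ⟨w, τ⟩ h
  let D : EN n →L[ℝ] EW n := mfderiv (𝓡 (2 * n - 1)) (𝓡∂ (2 * n)) Q.bdry z
  let A : EW n →L[ℝ] EW n := mfderiv (𝓡∂ (2 * n)) (𝓡 (2 * n)) C.incl (Q.bdry z)
  let Y : EW n := Q.X (Q.bdry z)
  have hA : Function.Injective A := C.incl_embedding.immersion (Q.bdry z)
  have hD : Function.Injective D := Q.bdry_embedding.immersion z
  have e1 : C.hor z 1 = A.comp D := by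
    have h0 : (fun z' => C.cyl z' 1) = C.incl ∘ Q.bdry := funext fun z' => C.cyl_one z'
    have h1 := ((C.incl_embedding.contMDiff (Q.bdry z)).mdifferentiableAt (by simp)).hasMFDerivAt.comp z
      ((Q.bdry_embedding.contMDiff z).mdifferentiableAt (by simp)).hasMFDerivAt
    rw [hor, h0]
    exact h1.mfderiv
  have e2 : C.Xv (C.cyl z 1) = A Y := by
    have h1 : ∀ x, x = C.incl (Q.bdry z) → C.Xv x = C.Xv (C.incl (Q.bdry z)) := by rintro _ rfl; rfl
    rw [h1 _ (C.cyl_one z)]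
    exact C.X_incl (Q.bdry z)
  rw [dcyl_apply, e1, e2, inv_one, one_smul, ContinuousLinearMap.comp_apply, ← map_smul, ← map_add] at h
  have h3 : D w + τ • Y = 0 := hA (by rw [h, map_zero])
  have h4 := congrArg (fun v : EW n => v 0) h3
  have h5 : D w 0 = 0 := fst_coord_bdry_deriv Q z w
  -- the vector field points outwards, that is, its zeroth coordinate is negative
  have h6 : Y 0 < 0 := by
    have := Q.outward z
    have h7 : (chartDeriv (I := 𝓡∂ (2 * n)) (Q.bdry z) (Q.X (Q.bdry z)) : EW n) = Y :=
      DFunLike.congr_fun (mfderiv_extChartAt_self (I := 𝓡∂ (2 * n)) (x := Q.bdry z)) Y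
    rw [h7] at this
    exact this
  simp [h5] at h4
  have hτ : τ = 0 := by
    rcases h4 with h4 | h4
    · exact h4
    · exact absurd h4 h6.ne
  rw [hτ, zero_smul, add_zero] at h3
  have hw : w = 0 := hD (by rw [h3, map_zero])
  rw [hw, hτ]; rfl

/-- The symplectic form is nondegenerate, because it tames an almost complex structure. -/
theorem CompatibleACS.eq_zero_of_Om_eq_zero {C : Completion Q W} (J : C.CompatibleACS) {x : W} {v : EW n}
    (hv : ∀ w, C.Om x v w = 0) : v = 0 := by
  by_contra hne
  exact (J.pos x v hne).ne' (hv (J.toFun x v))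

theorem finrank_EN : Module.finrank ℝ (EN n × ℝ) = Module.finrank ℝ (EW n) := by
  have := NeZero.pos n
  simp; omega

theorem bijective_of_injective {D : EN n × ℝ →L[ℝ] EW n} (h : Function.Injective D) :
    Function.Bijective D :=
  ⟨h, (LinearMap.injective_iff_surjective_of_finrank_eq_finrank (f := (D : EN n × ℝ →ₗ[ℝ] EW n))
    finrank_EN).1 h⟩

/-- `cyl` is a local diffeomorphism where `ρ ≥ 1`. A vector in the kernel of its derivative at `ρ` is,
up to a scaling, in the kernel of `dλ` at `ρ = 1`, where `cyl` is an immersion. -/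
theorem dcyl_bijective (J : C.CompatibleACS) (z : N) {ρ : ℝ} (hρ : 1 ≤ ρ) :
    Function.Bijective (C.dcyl z ρ) := by
  apply bijective_of_injective
  rw [injective_iff_map_eq_zero]
  rintro ⟨w, τ⟩ h
  have h0 : (0 : ℝ) < ρ := by linarith
  have h1 : ∀ q, C.Om (C.cyl z ρ) (C.dcyl z ρ (w, τ)) (C.dcyl z ρ q) = 0 := by
    intro q; rw [h]; simp
  -- contraction with `∂_ρ`
  have h2 : Q.bdryLamv z w = 0 := by
    have := h1 (0, 1)
    rw [C.Om_dcyl hρ] at this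
    have h5 : Q.dBdryLam z w 0 = 0 := by rw [dBdryLam_apply]; simp
    rw [h5] at this
    simpa using this
  -- the formula for `Ω` at `ρ` becomes the formula at `1` when `w` is replaced by `ρ w`
  have h3 : C.dcyl z 1 (ρ • w, τ) = 0 := by
    refine J.eq_zero_of_Om_eq_zero (x := C.cyl z 1) fun v => ?_
    obtain ⟨⟨w', τ'⟩, rfl⟩ := (bijective_of_injective (C.dcyl_one_injective z)).2 v
    have := h1 (w', 0)
    rw [C.Om_dcyl hρ] at this
    rw [C.Om_dcyl le_rfl, map_smul, h2]
    have h5 : Q.dBdryLam z (ρ • w) w' = ρ * Q.dBdryLam z w w' := by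
      rw [dBdryLam_apply, dBdryLam_apply]; simp; ring
    rw [h5]
    simp at this ⊢
    linarith
  have h4 : (ρ • w, τ) = (0 : EN n × ℝ) := C.dcyl_one_injective z (by rw [h3, map_zero])
  have h6 : ρ • w = 0 ∧ τ = 0 := by simpa using h4
  have h7 : w = 0 := (smul_eq_zero.1 h6.1).resolve_left h0.ne'
  rw [h7, h6.2]; rfl

end

/-! ### The projection of the cylindrical part -/

section

variable (C : Completion Q W)

open Classical in
/-- The inverse of `cyl` on the part `∂M × (1, ∞)` of the completion, that is, outside the image of `M`.
Inside the image of `M` its values are arbitrary. -/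
def pr [Nonempty N] (x : W) : N × ℝ := Classical.epsilon fun q => 1 < q.2 ∧ C.cyl q.1 q.2 = x

theorem pr_spec [Nonempty N] {x : W} (hx : x ∉ range C.incl) :
    1 < (C.pr x).2 ∧ C.cyl (C.pr x).1 (C.pr x).2 = x := by
  rcases C.cover x with h | ⟨z, ρ, h1, h2⟩
  · exact absurd h hx
  · exact Classical.epsilon_spec (p := fun q : N × ℝ => 1 < q.2 ∧ C.cyl q.1 q.2 = x) ⟨(z, ρ), h1, h2⟩

theorem pr_cyl [Nonempty N] {z : N} {ρ : ℝ} (hρ : 1 < ρ) : C.pr (C.cyl z ρ) = (z, ρ) := by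
  obtain ⟨h1, h2⟩ := C.pr_spec (C.disjoint z ρ hρ)
  obtain ⟨h3, h4⟩ := C.cyl_injective _ _ _ _ h1.le hρ.le h2
  exact Prod.ext h3 h4

/-- The inverse of `cyl` is smooth, by the inverse function theorem in charts. -/
theorem contMDiffAt_pr [Nonempty N] (J : C.CompatibleACS) {z : N} {ρ : ℝ} (hρ : 1 < ρ) :
    ContMDiffAt (𝓡 (2 * n)) ((𝓡 (2 * n - 1)).prod 𝓘(ℝ, ℝ)) ∞ C.pr (C.cyl z ρ) := by
  have h0 : (0 : ℝ) < ρ := by linarith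
  set x := C.cyl z ρ with hx
  set y := extChartAt (𝓡 (2 * n - 1)) z z with hy
  have hyt : y ∈ (extChartAt (𝓡 (2 * n - 1)) z).target := mem_extChartAt_target z
  set φ := extChartAt (𝓡 (2 * n)) x with hφ
  have hpt : C.cylMap z (y, ρ) = x := by simp only [cylMap, hy, extChartAt_to_inv, hx]
  let F : EN n × ℝ → EW n := φ ∘ C.cylMap z
  have hopen : IsOpen ((extChartAt (𝓡 (2 * n - 1)) z).target ×ˢ Ioi (0 : ℝ)) :=
    (isOpen_extChartAt_target z).prod isOpen_Ioi
  have hcylAt : ContMDiffAt 𝓘(ℝ, EN n × ℝ) (𝓡 (2 * n)) ∞ (C.cylMap z) (y, ρ) :=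
    (C.contMDiffOn_cylMap z).contMDiffAt (hopen.mem_nhds ⟨hyt, h0⟩)
  have hF : ContDiffAt ℝ ∞ F (y, ρ) := by
    rw [← contMDiffAt_iff_contDiffAt]
    exact ContMDiffAt.comp_of_eq (g := φ) (y := x) contMDiffAt_extChartAt hcylAt hpt
  have hD := C.dcyl_bijective J z hρ.le
  let D : (EN n × ℝ) ≃L[ℝ] EW n :=
    (LinearEquiv.ofBijective (C.dcyl z ρ : EN n × ℝ →ₗ[ℝ] EW n) hD).toContinuousLinearEquiv
  have hF' : HasFDerivAt F (D : EN n × ℝ →L[ℝ] EW n) (y, ρ) := by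
    have h1 := C.hasMFDerivAt_cylMap z hyt h0
    have h2 : HasMFDerivAt (𝓡 (2 * n)) 𝓘(ℝ, EW n) φ (C.cylMap z (y, ρ))
        (ContinuousLinearMap.id ℝ (EW n)) := by
      rw [hpt]
      have := (mdifferentiableAt_extChartAt (I := 𝓡 (2 * n)) (mem_chart_source _ x)).hasMFDerivAt
      rw [mfderiv_extChartAt_self] at this
      exact this
    have h3 := hasMFDerivAt_iff_hasFDerivAt.1 (h2.comp (y, ρ) h1)
    have h4 : (D : EN n × ℝ →L[ℝ] EW n) = (ContinuousLinearMap.id ℝ (EW n)).comp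
       ((C.dcyl ((extChartAt (𝓡 (2 * n - 1)) z).symm y) ρ).comp
        ((invDeriv z y).prodMap (ContinuousLinearMap.id ℝ ℝ))) := by
      refine ContinuousLinearMap.ext fun v => ?_
      change C.dcyl z ρ v = C.dcyl ((extChartAt (𝓡 (2 * n - 1)) z).symm y) ρ (invDeriv z y v.1, v.2)
      rw [hy, invDeriv_self, extChartAt_to_inv]
    rw [h4]
    exact h3
  have hstrict := hF.hasStrictFDerivAt' hF' (by simp)
  have hG := hF.to_localInverse hF' (by simp)
  have hGy : hF.localInverse hF' (by simp) (φ x) = (y, ρ) := by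
    have := hF.localInverse_apply_image hF' (by simp)
    rwa [show F (y, ρ) = φ x by simp only [F, Function.comp_apply, hpt]] at this
  set G := hF.localInverse hF' (by simp) with hGdef
  have hFx : F (y, ρ) = φ x := by simp only [F, Function.comp_apply, hpt]
  rw [hFx] at hG
  have hφx : ContMDiffAt (𝓡 (2 * n)) 𝓘(ℝ, EW n) ∞ φ x := contMDiffAt_extChartAt
  have hGφ : ContMDiffAt (𝓡 (2 * n)) 𝓘(ℝ, EN n × ℝ) ∞ (G ∘ φ) x :=
    hG.contMDiffAt.comp x hφx
  have hGφx : (G ∘ φ) x = (y, ρ) := hGy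
  have hlift : ContMDiffAt (𝓡 (2 * n)) ((𝓡 (2 * n - 1)).prod 𝓘(ℝ, ℝ)) ∞
      (fun x' => ((extChartAt (𝓡 (2 * n - 1)) z).symm (G (φ x')).1, (G (φ x')).2)) x := by
    apply ContMDiffAt.prodMk
    · refine ContMDiffAt.comp_of_eq (y := y)
        ((contMDiffOn_extChartAt_symm z).contMDiffAt ((isOpen_extChartAt_target z).mem_nhds hyt))
        (contDiff_fst.contMDiff.contMDiffAt.comp x hGφ) ?_
      exact congrArg Prod.fst hGφx
    · exact contDiff_snd.contMDiff.contMDiffAt.comp x hGφ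
  refine hlift.congr_of_eventuallyEq ?_
  have hc : ContinuousAt (G ∘ φ) x := hGφ.continuousAt
  have ev1 : ∀ᶠ x' in 𝓝 x, G (φ x') ∈ (extChartAt (𝓡 (2 * n - 1)) z).target ×ˢ Ioi (1 : ℝ) := by
    apply hc.eventually_mem
    rw [hGφx]
    exact ((isOpen_extChartAt_target z).prod isOpen_Ioi).mem_nhds ⟨hyt, hρ⟩
  have ev2 : ∀ᶠ x' in 𝓝 x, C.cylMap z (G (φ x')) ∈ φ.source := by
    have : ContinuousAt (C.cylMap z ∘ (G ∘ φ)) x :=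
      ContinuousAt.comp_of_eq hcylAt.continuousAt hc hGφx
    apply this.eventually_mem
    rw [Function.comp_apply, hGφx, hpt]
    exact extChartAt_source_mem_nhds x
  have ev3 : ∀ᶠ x' in 𝓝 x, F (G (φ x')) = φ x' := by
    have h1 := hstrict.eventually_right_inverse
    rw [hFx] at h1
    exact hφx.continuousAt.eventually h1
  have ev4 : ∀ᶠ x' in 𝓝 x, x' ∈ φ.source := extChartAt_source_mem_nhds x
  filter_upwards [ev1, ev2, ev3, ev4] with x' h1 h2 h3 h4
  have h5 : C.cylMap z (G (φ x')) = x' := φ.injOn h2 h4 h3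
  have h6 := C.pr_cyl (z := (extChartAt (𝓡 (2 * n - 1)) z).symm (G (φ x')).1) h1.2
  change C.pr (C.cylMap z (G (φ x'))) = _ at h6
  rw [h5] at h6
  exact h6

end

/-! ### Hamiltonians and compatible almost complex structures at infinity -/

section

/-- The derivative of a function on the completion, as a form on the model space. -/
def dW (G : W → ℝ) (x : W) : EW n →L[ℝ] ℝ := mfderiv (𝓡 (2 * n)) 𝓘(ℝ, ℝ) G x

/-- The derivative of a function on the boundary, as a form on the model space. -/
def dN (g : N → ℝ) (z : N) : EN n →L[ℝ] ℝ := mfderiv (𝓡 (2 * n - 1)) 𝓘(ℝ, ℝ) g z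

variable (C : Completion Q W)

/-- The Hamiltonian vector field, with values in the model space. -/
def hamv (H : W → ℝ) (x : W) : EW n := C.hamVF H x

/-- The almost complex structure, as an endomorphism of the model space. -/
def CompatibleACS.Jv {C : Completion Q W} (J : C.CompatibleACS) (x : W) : EW n →L[ℝ] EW n :=
  J.toFun x

/-- The squared norm of a vector for the Riemannian metric `Ω(·, J ·)`. -/
def CompatibleACS.nsq {C : Completion Q W} (J : C.CompatibleACS) (x : W) (v : EW n) : ℝ :=
  C.Om x v (J.Jv x v)

section ACS

section

variable {C} (J : C.CompatibleACS) {x : W}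

theorem CompatibleACS.Jv_Jv (v : EW n) : J.Jv x (J.Jv x v) = -v := J.square x v

theorem CompatibleACS.Om_Jv_symm (v w : EW n) : C.Om x v (J.Jv x w) = C.Om x w (J.Jv x v) :=
  J.symm x v w

theorem CompatibleACS.nsq_pos {v : EW n} (hv : v ≠ 0) : 0 < J.nsq x v := J.pos x v hv

theorem CompatibleACS.nsq_nonneg (v : EW n) : 0 ≤ J.nsq x v := by
  by_cases hv : v = 0
  · rw [hv, nsq]; simp
  · exact (J.nsq_pos hv).le

theorem CompatibleACS.nsq_Jv (v : EW n) : J.nsq x (J.Jv x v) = J.nsq x v := by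
  rw [nsq, nsq, J.Jv_Jv, map_neg, C.Om_antisymm, neg_neg]

theorem CompatibleACS.nsq_add (v w : EW n) :
    J.nsq x (v + w) = J.nsq x v + 2 * C.Om x v (J.Jv x w) + J.nsq x w := by
  simp only [nsq, map_add, add_apply]
  rw [J.Om_Jv_symm w v]; ring

theorem CompatibleACS.nsq_smul (r : ℝ) (v : EW n) : J.nsq x (r • v) = r ^ 2 * J.nsq x v := by
  simp only [nsq, map_smul, smul_apply, smul_eq_mul]; ring

/-- The Cauchy–Schwarz inequality for the metric `Ω(·, J ·)`. -/
theorem CompatibleACS.sq_Om_Jv_le (v w : EW n) :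
    C.Om x v (J.Jv x w) ^ 2 ≤ J.nsq x v * J.nsq x w := by
  have h : ∀ r : ℝ, 0 ≤ J.nsq x w * (r * r) + (2 * C.Om x v (J.Jv x w)) * r + J.nsq x v := by
    intro r
    have h1 := J.nsq_nonneg (x := x) (v + r • w)
    rw [J.nsq_add, J.nsq_smul] at h1
    simp only [map_smul, smul_eq_mul] at h1
    nlinarith
  have := discrim_le_zero h
  rw [discrim] at this
  nlinarith

end

variable {C}

/-- Every linear form is `-Ω(v, ·)` for some `v`, so that Hamiltonian vector fields exist. -/
theorem CompatibleACS.exists_hamVF (J : C.CompatibleACS) {x : W} (ℓ : EW n →L[ℝ] ℝ) : ∃ v : EW n, ∀ w, ℓ w = - C.Om x v w := by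
  have hinj : Function.Injective (C.Om x : EW n →ₗ[ℝ] (EW n →L[ℝ] ℝ)) := by
    rw [injective_iff_map_eq_zero]
    intro v hv
    refine J.eq_zero_of_Om_eq_zero (x := x) fun w => ?_
    exact DFunLike.congr_fun hv w
  have hfr : Module.finrank ℝ (EW n) = Module.finrank ℝ (EW n →L[ℝ] ℝ) :=
    ((InnerProductSpace.toDual ℝ (EW n)).toLinearEquiv.finrank_eq)
  obtain ⟨v, hv⟩ := (LinearMap.injective_iff_surjective_of_finrank_eq_finrank hfr).1 hinj (-ℓ)
  refine ⟨v, fun w => ?_⟩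
  have := DFunLike.congr_fun hv w
  change C.Om x v w = - ℓ w at this
  rw [this, neg_neg]

theorem CompatibleACS.dW_eq (J : C.CompatibleACS) {x : W} (H : W → ℝ) (w : EW n) : dW H x w = - C.Om x (C.hamv H x) w := by
  have h : ∃ v : TangentSpace (𝓡 (2 * n)) x, ∀ w, (mfderiv (𝓡 (2 * n)) 𝓘(ℝ, ℝ) H x w : ℝ) = - C.Ω x v w :=
    J.exists_hamVF (dW H x)
  have h2 := h.choose_spec w
  have h3 : C.hamv H x = h.choose := by rw [hamv, hamVF, dif_pos h]
  rw [h3]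
  exact h2

theorem CompatibleACS.Om_hamv (J : C.CompatibleACS) {x : W} (H : W → ℝ) (w : EW n) : C.Om x w (C.hamv H x) = dW H x w := by
  rw [J.dW_eq, C.Om_antisymm]

theorem CompatibleACS.dW_hamv (J : C.CompatibleACS) {x : W} (H : W → ℝ) : dW H x (C.hamv H x) = 0 := by
  rw [J.dW_eq, C.Om_self, neg_zero]

end ACS

theorem dcyl_zero {z : N} {ρ : ℝ} (hρ : ρ ≠ 0) (τ : ℝ) :
    C.dcyl z ρ (0, ρ * τ) = τ • C.Xv (C.cyl z ρ) := by
  rw [dcyl_apply, map_zero, zero_add, smul_smul]; congr 1; field_simp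

/-- `i_X Ω = λ` on the cylindrical part. -/
theorem Om_Xv (J : C.CompatibleACS) {z : N} {ρ : ℝ} (hρ : 1 ≤ ρ) (v : EW n) :
    C.Om (C.cyl z ρ) (C.Xv (C.cyl z ρ)) v = C.lamv (C.cyl z ρ) v := by
  obtain ⟨⟨w, τ⟩, rfl⟩ := (C.dcyl_bijective J z hρ).2 v
  have h0 : ρ ≠ 0 := by linarith
  have h1 := C.dcyl_zero (z := z) h0 1
  rw [one_smul] at h1
  rw [← h1, C.Om_dcyl hρ, C.lamv_dcyl hρ]
  have h5 : Q.dBdryLam z 0 w = 0 := by rw [dBdryLam_apply]; simp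
  rw [h5]; simp

/-- The lift of a tangent vector `w` of `N` to the vector at `cyl z ρ` that projects to `w` and is tangent
to the level sets of the function `(z, ρ) ↦ a(z) ρ`. On the cylindrical end every vector is the sum
of such a lift and a multiple of `X`. -/
def lift (a : N → ℝ) (z : N) (ρ : ℝ) (w : EN n) : EW n :=
  C.dcyl z ρ (w, -(ρ / a z) * dN a z w)

theorem dcyl_eq_lift (a : N → ℝ) {z : N} {ρ : ℝ} (hρ : ρ ≠ 0) (w : EN n) (τ : ℝ) :
    C.dcyl z ρ (w, τ) =
      C.lift a z ρ w + (τ / ρ + dN a z w / a z) • C.Xv (C.cyl z ρ) := by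
  rw [← C.dcyl_zero hρ, lift, ← map_add]
  congr 1
  ext1
  · simp
  · simp; field_simp; ring

/-- The exterior derivative of the contact form `a⁻¹ λ`, on the model space. -/
def dScaledLam (Q : LiouvilleQuadruple n M N L) (a : N → ℝ) (z : N) (v w : EN n) : ℝ :=
  OneForm.d (Q.scaledLam a) z v w

/-- The product rule `d(a⁻¹ λ) = a⁻¹ dλ - a⁻² da ∧ λ`. -/
theorem dScaledLam_eq (C : Completion Q W) {a : N → ℝ} {z : N}
    (ha : ContMDiffAt (𝓡 (2 * n - 1)) 𝓘(ℝ, ℝ) ∞ a z) (hz : a z ≠ 0) (v w : EN n) :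
    dScaledLam Q a z v w = (a z)⁻¹ * Q.dBdryLam z v w -
      (a z)⁻¹ ^ 2 * (dN a z v * Q.bdryLamv z w - dN a z w * Q.bdryLamv z v) := by
  set y := extChartAt (𝓡 (2 * n - 1)) z z with hy
  have hyt : y ∈ (extChartAt (𝓡 (2 * n - 1)) z).target := mem_extChartAt_target z
  have h : ∀ v : EN n, (chartDeriv (I := 𝓡 (2 * n - 1)) z : EN n →L[ℝ] EN n) v = v := fun v =>
    DFunLike.congr_fun (mfderiv_extChartAt_self (I := 𝓡 (2 * n - 1)) (x := z)) v
  let ℓ : EN n → EN n →L[ℝ] ℝ := fun y' =>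
    (a ((extChartAt (𝓡 (2 * n - 1)) z).symm y'))⁻¹ • lamChart Q z y'
  have h1 : dScaledLam Q a z v w = fderiv ℝ ℓ y v w - fderiv ℝ ℓ y w v := by
    change fderivWithin ℝ ℓ (range (𝓡 (2 * n - 1))) (extChartAt (𝓡 (2 * n - 1)) z z)
      ((chartDeriv (I := 𝓡 (2 * n - 1)) z : EN n →L[ℝ] EN n) v)
      ((chartDeriv (I := 𝓡 (2 * n - 1)) z : EN n →L[ℝ] EN n) w) -
    fderivWithin ℝ ℓ (range (𝓡 (2 * n - 1))) (extChartAt (𝓡 (2 * n - 1)) z z)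
      ((chartDeriv (I := 𝓡 (2 * n - 1)) z : EN n →L[ℝ] EN n) w)
      ((chartDeriv (I := 𝓡 (2 * n - 1)) z : EN n →L[ℝ] EN n) v) = _
    rw [h, h, show range (𝓡 (2 * n - 1)) = univ by simp, fderivWithin_univ]
  have h2 : HasFDerivAt (fun y' => a ((extChartAt (𝓡 (2 * n - 1)) z).symm y')) (dN a z) y := by
    have := (ha.mdifferentiableAt (by simp)).hasMFDerivAt.2
    exact HasFDerivWithinAt.hasFDerivAt this (by simp)
  have hl : HasFDerivAt (lamChart Q z) (fderiv ℝ (lamChart Q z) y) y :=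
    (((contDiffOn_lamChart C z).contDiffAt ((isOpen_extChartAt_target z).mem_nhds hyt)).differentiableAt
      (by simp)).hasFDerivAt
  have haz : a ((extChartAt (𝓡 (2 * n - 1)) z).symm y) = a z := by rw [hy, extChartAt_to_inv]
  have h3 := ((hasDerivAt_inv (x := a ((extChartAt (𝓡 (2 * n - 1)) z).symm y))
    (by rw [haz]; exact hz)).comp_hasFDerivAt y h2).smul hl
  have hb : ∀ v, lamChart Q z y v = Q.bdryLamv z v := by
    intro v; rw [lamChart_apply, hy, invDeriv_self, extChartAt_to_inv]
  have h4 : fderiv ℝ ℓ y = _ := HasFDerivAt.fderiv h3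
  rw [Function.comp_apply, haz] at h4
  rw [h1, h4, dBdryLam_apply, ← hy]
  simp [hb]
  ring

section Region

variable {C} [T2Space W] {K : Set W} {a : N → ℝ} {b : ℝ} {H : W → ℝ}

theorem IsContactTypeHam.eventually_eq (hH : C.IsContactTypeHam K a b H) {z : N} {ρ : ℝ}
    (hρ : 0 < ρ) (hK : C.cyl z ρ ∉ K) :
    ∀ᶠ q : N × ℝ in 𝓝 (z, ρ), C.cyl q.1 q.2 ∉ K ∧ 0 < q.2 ∧ H (C.cyl q.1 q.2) = a q.1 * q.2 + b := by
  have h1 : ContinuousAt (fun p : N × ℝ => C.cyl p.1 p.2) (z, ρ) := (C.contMDiffAt_cyl hρ).continuousAt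
  have h2 : ∀ᶠ q : N × ℝ in 𝓝 (z, ρ), C.cyl q.1 q.2 ∈ Kᶜ :=
    h1.eventually_mem (hH.core.1.isClosed.isOpen_compl.mem_nhds hK)
  have h3 : ∀ᶠ q : N × ℝ in 𝓝 (z, ρ), 0 < q.2 :=
    continuousAt_snd.eventually (lt_mem_nhds hρ)
  filter_upwards [h2, h3] with q h2 h3
  exact ⟨h2, h3, hH.eq _ _ h3 h2⟩

theorem IsContactTypeHam.dW_dcyl (hH : C.IsContactTypeHam K a b H) {z : N} {ρ : ℝ}
    (hρ : 0 < ρ) (hK : C.cyl z ρ ∉ K) (w : EN n) (τ : ℝ) :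
    dW H (C.cyl z ρ) (C.dcyl z ρ (w, τ)) = ρ * dN a z w + a z * τ := by
  have h1 : HasMFDerivAt ((𝓡 (2 * n - 1)).prod 𝓘(ℝ, ℝ)) 𝓘(ℝ, ℝ)
      (fun p : N × ℝ => H (C.cyl p.1 p.2)) (z, ρ) ((dW H (C.cyl z ρ)).comp (C.dcyl z ρ)) :=
    ((hH.smooth (C.cyl z ρ)).mdifferentiableAt (by simp)).hasMFDerivAt.comp (z, ρ)
      (C.hasMFDerivAt_cyl hρ)
  have ha := ((hH.slope_smooth z).mdifferentiableAt (by simp)).hasMFDerivAt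
  have h2 : HasMFDerivAt ((𝓡 (2 * n - 1)).prod 𝓘(ℝ, ℝ)) 𝓘(ℝ, ℝ)
      (fun p : N × ℝ => a p.1 * p.2 + b) (z, ρ)
        (ρ • (dN a z).comp (ContinuousLinearMap.fst ℝ (EN n) ℝ) +
          a z • ContinuousLinearMap.snd ℝ (EN n) ℝ) := by
    have e1 : HasMFDerivAt ((𝓡 (2 * n - 1)).prod 𝓘(ℝ, ℝ)) 𝓘(ℝ, ℝ)
      (fun p : N × ℝ => a p.1) (z, ρ) ((dN a z).comp (ContinuousLinearMap.fst ℝ (EN n) ℝ)) :=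
      ha.comp (f := Prod.fst) (z, ρ) (hasMFDerivAt_fst (z, ρ))
    have e2 : HasMFDerivAt ((𝓡 (2 * n - 1)).prod 𝓘(ℝ, ℝ)) 𝓘(ℝ, ℝ)
      (fun p : N × ℝ => p.2) (z, ρ) (ContinuousLinearMap.snd ℝ (EN n) ℝ) :=
      hasMFDerivAt_snd (z, ρ)
    have e3 := (e1.mul e2).add (hasMFDerivAt_const (I' := 𝓘(ℝ, ℝ)) b (z, ρ))
    refine HasMFDerivAt.congr_mfderiv e3 ?_
    refine ContinuousLinearMap.ext fun v => ?_
    change a z * v.2 + ρ * dN a z v.1 + 0 = ρ * dN a z v.1 + a z * v.2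
    ring
  have h3 := h1.congr_of_eventuallyEq (f₁ := fun p : N × ℝ => a p.1 * p.2 + b) (by
    filter_upwards [hH.eventually_eq hρ hK] with q hq
    exact hq.2.2.symm)
  have h4 := hasMFDerivAt_unique h3 h2
  have h5 := DFunLike.congr_fun h4 (w, τ)
  exact h5

theorem IsContactTypeHam.dW_lift (hH : C.IsContactTypeHam K a b H) {z : N} {ρ : ℝ}
    (hρ : 0 < ρ) (hK : C.cyl z ρ ∉ K) (w : EN n) : dW H (C.cyl z ρ) (C.lift a z ρ w) = 0 := by
  have := (hH.slope_pos z).ne'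
  rw [lift, hH.dW_dcyl hρ hK]; field_simp; ring

theorem IsContactTypeHam.dW_Xv (hH : C.IsContactTypeHam K a b H) {z : N} {ρ : ℝ}
    (hρ : 0 < ρ) (hK : C.cyl z ρ ∉ K) : dW H (C.cyl z ρ) (C.Xv (C.cyl z ρ)) = a z * ρ := by
  have := C.dcyl_zero (z := z) hρ.ne' 1
  rw [one_smul] at this
  rw [← this, hH.dW_dcyl hρ hK]; simp

theorem IsContactTypeHam.lamv_lift (hH : C.IsContactTypeHam K a b H) {z : N} {ρ : ℝ}
    (hρ : 1 ≤ ρ) (w : EN n) : C.lamv (C.cyl z ρ) (C.lift a z ρ w) = a z * ρ * ((a z)⁻¹ * Q.bdryLamv z w) := by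
  have := (hH.slope_pos z).ne'
  rw [lift, C.lamv_dcyl hρ]; field_simp

/-- On lifts, the symplectic form is `a(z) ρ` times the exterior derivative of `λ^a = a⁻¹ λ`. -/
theorem IsContactTypeHam.Om_lift (hH : C.IsContactTypeHam K a b H) {z : N} {ρ : ℝ}
    (hρ : 1 ≤ ρ) (v w : EN n) :
    C.Om (C.cyl z ρ) (C.lift a z ρ v) (C.lift a z ρ w) = a z * ρ * dScaledLam Q a z v w := by
  have := (hH.slope_pos z).ne'
  rw [lift, lift, C.Om_dcyl hρ, dScaledLam_eq C (hH.slope_smooth z) this]; field_simp; ring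

/-- Vectors on the cylindrical end split into a lift, tangent to the level sets of `H`, and a multiple
of the Liouville vector field. -/
theorem IsContactTypeHam.decomp (hH : C.IsContactTypeHam K a b H) (J : C.CompatibleACS) {z : N} {ρ : ℝ}
    (hρ : 1 < ρ) (hK : C.cyl z ρ ∉ K) (v : EW n) :
    ∃ w, v = C.lift a z ρ w + (dW H (C.cyl z ρ) v / (a z * ρ)) • C.Xv (C.cyl z ρ) := by
  obtain ⟨⟨w, τ⟩, rfl⟩ := (C.dcyl_bijective J z hρ.le).2 v
  have h0 : 0 < ρ := by linarith
  have := (hH.slope_pos z).ne'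
  refine ⟨w, ?_⟩
  rw [hH.dW_dcyl h0 hK, C.dcyl_eq_lift a h0.ne']
  congr 2
  field_simp; ring

/-- The Hamiltonian vector field of `a(z) ρ + b` is the lift of the Reeb vector field of `λ^a`. -/
theorem IsContactTypeHam.hamv_eq (hH : C.IsContactTypeHam K a b H) (J : C.CompatibleACS) {z : N} {ρ : ℝ}
    (hρ : 1 < ρ) (hK : C.cyl z ρ ∉ K) {R : EN n} (hR : IsReebVector (Q.scaledLam a) z R) :
    C.hamv H (C.cyl z ρ) = C.lift a z ρ R := by
  have h0 : 0 < ρ := by linarith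
  have hR1 : (a z)⁻¹ * Q.bdryLamv z R = 1 := hR.2
  have hR2 : ∀ w, dScaledLam Q a z R w = 0 := hR.1
  have h1 : ∀ w, C.Om (C.cyl z ρ) (C.hamv H (C.cyl z ρ) - C.lift a z ρ R) w = 0 := by
    intro w
    rw [map_sub, sub_apply]
    have h2 := J.dW_eq (x := C.cyl z ρ) H w
    obtain ⟨w', hw'⟩ := hH.decomp J hρ hK w
    have h3 : C.Om (C.cyl z ρ) (C.lift a z ρ R) w = - dW H (C.cyl z ρ) w := by
      conv_lhs => rw [hw']
      rw [map_add, hH.Om_lift hρ.le, hR2, map_smul, C.Om_antisymm _ _ (C.Xv _), C.Om_Xv J hρ.le,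
        hH.lamv_lift hρ.le, hR1]
      have := (hH.slope_pos z).ne'
      simp; field_simp
    rw [h3, h2]; ring
  exact sub_eq_zero.1 (J.eq_zero_of_Om_eq_zero h1)

/-- The coordinates `(z, r)` with `r = a(z) ρ`, in which contact type is defined, have as horizontal
vectors the lifts. -/
theorem IsContactTypeHam.pushHor_eq (hH : C.IsContactTypeHam K a b H) {z : N} {ρ : ℝ} (hρ : 0 < ρ)
    (w : EN n) : (mfderiv (𝓡 (2 * n - 1)) (𝓡 (2 * n)) (fun z' => C.scaledCyl a z' (a z * ρ)) z :
      EN n →L[ℝ] EW n) w = C.lift a z ρ w := by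
  have hz := (hH.slope_pos z).ne'
  have hpt : (a z)⁻¹ * (a z * ρ) = ρ := by field_simp
  have ha : HasMFDerivAt (𝓡 (2 * n - 1)) 𝓘(ℝ, ℝ) a z (dN a z) :=
    ((hH.slope_smooth z).mdifferentiableAt (by simp)).hasMFDerivAt
  have h1 : HasMFDerivAt (𝓡 (2 * n - 1)) 𝓘(ℝ, ℝ) (fun z' => (a z')⁻¹ * (a z * ρ)) z
      (((-(a z ^ 2)⁻¹) * (a z * ρ)) • dN a z) := by
    have e1 : HasDerivAt (fun r : ℝ => r⁻¹ * (a z * ρ)) (-(a z ^ 2)⁻¹ * (a z * ρ)) (a z) :=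
      (hasDerivAt_inv hz).mul_const _
    have e2 := e1.hasFDerivAt.hasMFDerivAt.comp z ha
    refine e2.congr_mfderiv (ContinuousLinearMap.ext fun v => ?_)
    change dN a z v * (-(a z ^ 2)⁻¹ * (a z * ρ)) = (-(a z ^ 2)⁻¹ * (a z * ρ)) * dN a z v
    ring
  have h2 : HasMFDerivAt (𝓡 (2 * n - 1)) ((𝓡 (2 * n - 1)).prod 𝓘(ℝ, ℝ))
      (fun z' => (z', (a z')⁻¹ * (a z * ρ))) z
      ((ContinuousLinearMap.id ℝ (EN n)).prod (((-(a z ^ 2)⁻¹) * (a z * ρ)) • dN a z)) :=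
    (hasMFDerivAt_id z).prodMk h1
  have h3 : HasMFDerivAt ((𝓡 (2 * n - 1)).prod 𝓘(ℝ, ℝ)) (𝓡 (2 * n))
      (fun p : N × ℝ => C.cyl p.1 p.2) (z, (a z)⁻¹ * (a z * ρ)) (C.dcyl z ρ) := by
    rw [hpt]; exact C.hasMFDerivAt_cyl hρ
  have h4 := h3.comp z h2
  have h5 := h4.mfderiv
  refine (DFunLike.congr_fun h5 w).trans ?_
  change C.dcyl z ρ (w, (-(a z ^ 2)⁻¹) * (a z * ρ) * dN a z w) = _
  rw [lift]
  congr 2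
  field_simp

theorem IsContactTypeHam.pushRho_eq (hH : C.IsContactTypeHam K a b H) {z : N} {ρ : ℝ} (hρ : 0 < ρ) :
    (velocity (𝓡 (2 * n)) (C.scaledCyl a z) (a z * ρ) : EW n) =
      (a z * ρ)⁻¹ • C.Xv (C.cyl z ρ) := by
  have hz := (hH.slope_pos z).ne'
  have hpt : (a z)⁻¹ * (a z * ρ) = ρ := by field_simp
  have h1 : HasMFDerivAt 𝓘(ℝ, ℝ) ((𝓡 (2 * n - 1)).prod 𝓘(ℝ, ℝ))
      (fun r : ℝ => (z, (a z)⁻¹ * r)) (a z * ρ)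
      ((0 : ℝ →L[ℝ] EN n).prod ((a z)⁻¹ • ContinuousLinearMap.id ℝ ℝ)) := by
    refine (hasMFDerivAt_const z (a z * ρ)).prodMk ?_
    exact ((hasFDerivAt_id (𝕜 := ℝ) (a z * ρ)).const_mul (a z)⁻¹).hasMFDerivAt
  have h3 : HasMFDerivAt ((𝓡 (2 * n - 1)).prod 𝓘(ℝ, ℝ)) (𝓡 (2 * n))
      (fun p : N × ℝ => C.cyl p.1 p.2) (z, (a z)⁻¹ * (a z * ρ)) (C.dcyl z ρ) := by
    rw [hpt]; exact C.hasMFDerivAt_cyl hρ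
  have h4 := h3.comp (a z * ρ) h1
  refine (DFunLike.congr_fun h4.mfderiv (1 : ℝ)).trans ?_
  change C.dcyl z ρ (0, (a z)⁻¹ * 1) = _
  have := C.dcyl_zero (z := z) hρ.ne' ((a z * ρ)⁻¹)
  rw [← this]
  congr 2
  field_simp

end Region

end

/-! ### Almost complex structures of contact type -/

section

section Region

variable {C : Completion Q W} [T2Space W] {K : Set W} {a : N → ℝ} {b : ℝ} {H : W → ℝ}

/-- An almost complex structure of contact type outside `K` maps `X` to a multiple `c⁻¹ X_H` of the
Hamiltonian vector field, and the squared norm of a lift is proportional to `a(z) ρ`. -/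
theorem IsContactTypeHam.exists_norm_form (hH : C.IsContactTypeHam K a b H) {J : C.CompatibleACS}
    (hJ : J.IsContactType K a) : ∃ c : ℝ, 0 < c ∧ ∃ q : N → EN n → ℝ, ∀ z ρ, 1 < ρ → C.cyl z ρ ∉ K →
      (∃ R, IsReebVector (Q.scaledLam a) z R) ∧
      J.Jv (C.cyl z ρ) (C.Xv (C.cyl z ρ)) = c⁻¹ • C.hamv H (C.cyl z ρ) ∧
      ∀ w, J.nsq (C.cyl z ρ) (C.lift a z ρ w) = a z * ρ * q z w := by
  obtain ⟨-, ⟨Jinf, hJ1, hJ2⟩, c, hc, hJ3⟩ := hJ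
  have hpt : ∀ z ρ, C.scaledCyl a z (a z * ρ) = C.cyl z ρ := by
    intro z ρ
    have := (hH.slope_pos z).ne'
    rw [scaledCyl]; congr 1; field_simp
  -- the two conditions on `J`, expressed on the model space
  have key : ∀ x x' : W, x = x' → ∀ v : EW n, (J.toFun x v : EW n) = J.Jv x' v := by
    rintro x _ rfl v; rfl
  have hJ2' : ∀ z ρ, 1 < ρ → C.cyl z ρ ∉ K → ∀ v : EN n, Q.scaledLam a z v = 0 →
      J.Jv (C.cyl z ρ) (C.lift a z ρ v) = C.lift a z ρ (Jinf z v) := by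
    intro z ρ hρ hK v hv
    have h0 : 0 < ρ := by linarith
    have h1 := hJ2 z (a z * ρ) (mul_pos (hH.slope_pos z) h0) (by rw [hpt]; exact hK) v hv
    have h2 := key _ _ (hpt z ρ) (C.pushHor a z (a z * ρ) v)
    have h3 : (C.pushHor a z (a z * ρ) v : EW n) = C.lift a z ρ v := hH.pushHor_eq h0 v
    have h4 : (C.pushHor a z (a z * ρ) (Jinf z v) : EW n) = C.lift a z ρ (Jinf z v) :=
      hH.pushHor_eq h0 _
    rw [← h4, ← h3, ← h2]
    exact h1
  have hJ3' : ∀ z ρ, 1 < ρ → C.cyl z ρ ∉ K → ∃ R : EN n, IsReebVector (Q.scaledLam a) z R ∧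
      J.Jv (C.cyl z ρ) (C.Xv (C.cyl z ρ)) = c⁻¹ • C.lift a z ρ R := by
    intro z ρ hρ hK
    have h0 : 0 < ρ := by linarith
    have hr : 0 < a z * ρ := mul_pos (hH.slope_pos z) h0
    obtain ⟨R, hR, h1⟩ := hJ3 z (a z * ρ) hr (by rw [hpt]; exact hK)
    refine ⟨R, hR, ?_⟩
    have h2 := key _ _ (hpt z ρ) (C.pushRho a z (a z * ρ))
    have h3 : (C.pushRho a z (a z * ρ) : EW n) = (a z * ρ)⁻¹ • C.Xv (C.cyl z ρ) := hH.pushRho_eq h0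
    have h4 : (C.pushHor a z (a z * ρ) R : EW n) = C.lift a z ρ R := hH.pushHor_eq h0 R
    rw [h3, map_smul] at h2
    have h5 : (a z * ρ)⁻¹ • J.Jv (C.cyl z ρ) (C.Xv (C.cyl z ρ)) =
        (a z * ρ * c)⁻¹ • C.lift a z ρ R := by
      rw [← h2, ← h4, ← h3]; exact h1
    have h6 := congrArg (fun v => (a z * ρ) • v) h5
    simp only [smul_smul] at h6
    rw [mul_inv_cancel₀ hr.ne', one_smul] at h6
    have h7 := (hH.slope_pos z).ne'
    rw [h6]; congr 1; field_simp
  classical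
  -- the norm is computed from the splitting of `w` into its Reeb and contact parts
  let Rz : N → EN n := fun z => Classical.epsilon fun R : EN n => IsReebVector (Q.scaledLam a) z R
  let lz : N → EN n → ℝ := fun z w => (a z)⁻¹ * Q.bdryLamv z w
  refine ⟨c, hc, fun z w => c * lz z w ^ 2 + dScaledLam Q a z (w - lz z w • Rz z)
    (Jinf z (w - lz z w • Rz z)), fun z ρ hρ hK => ?_⟩
  have h0 : 0 < ρ := by linarith
  have hr : 0 < a z * ρ := mul_pos (hH.slope_pos z) h0
  obtain ⟨R, hR, hJR⟩ := hJ3' z ρ hρ hK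
  have hRz : IsReebVector (Q.scaledLam a) z (Rz z) :=
    Classical.epsilon_spec (p := fun R : EN n => IsReebVector (Q.scaledLam a) z R) ⟨R, hR⟩
  have e1 := hH.hamv_eq J hρ hK hR
  have e2 := hH.hamv_eq J hρ hK hRz
  refine ⟨⟨R, hR⟩, by rw [hJR, e1], fun w => ?_⟩
  set ξ : EN n := w - lz z w • Rz z with hξ
  have hlR : lz z (Rz z) = 1 := hRz.2
  have hξ0 : lz z ξ = 0 := by
    have : lz z ξ = lz z w - lz z w * lz z (Rz z) := by
      simp only [lz, hξ, map_sub, map_smul, smul_eq_mul]; ring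
    rw [this, hlR]; ring
  have hlift : ∀ (v v' : EN n) (r : ℝ), C.lift a z ρ (v + r • v') =
      C.lift a z ρ v + r • C.lift a z ρ v' := by
    intro v v' r
    simp only [lift]
    rw [← map_smul, ← map_add]
    congr 1
    ext1
    · simp
    · simp; ring
  have hw : w = ξ + lz z w • Rz z := by rw [hξ]; abel
  have h1 : J.nsq (C.cyl z ρ) (C.lift a z ρ ξ) = a z * ρ * dScaledLam Q a z ξ (Jinf z ξ) := by
    rw [CompatibleACS.nsq, hJ2' z ρ hρ hK ξ hξ0]
    exact hH.Om_lift hρ.le ξ (Jinf z ξ)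
  have hXR : C.lift a z ρ (Rz z) = c • J.Jv (C.cyl z ρ) (C.Xv (C.cyl z ρ)) := by
    rw [hJR, ← e2, e1, smul_smul, mul_inv_cancel₀ hc.ne', one_smul]
  have hJl : J.Jv (C.cyl z ρ) (C.lift a z ρ (Rz z)) = -(c • C.Xv (C.cyl z ρ)) := by
    rw [hXR, map_smul, J.Jv_Jv, smul_neg]
  have hcross : ∀ v, C.Om (C.cyl z ρ) (C.lift a z ρ v) (J.Jv (C.cyl z ρ) (C.lift a z ρ (Rz z))) =
      c * (a z * ρ * lz z v) := by
    intro v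
    rw [hJl, map_neg, map_smul, C.Om_antisymm, C.Om_Xv J hρ.le, hH.lamv_lift hρ.le]
    simp [lz]
  have h2 : J.nsq (C.cyl z ρ) (C.lift a z ρ (Rz z)) = a z * ρ * c := by
    rw [CompatibleACS.nsq, hcross, hlR]; ring
  conv_lhs => rw [hw]
  rw [hlift, J.nsq_add, J.nsq_smul, h1, h2, map_smul, map_smul, hcross, hξ0]
  simp only [mul_zero, smul_eq_mul]
  ring

/-- The identities at a point `x` of the cylindrical end that the estimates use, for `H = r + b` with
`r = a(z) ρ` and an almost complex structure of contact type with constant `c`: `i_X Ω = λ`,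
`dH(X) = r` and `J X = c⁻¹ X_H`. -/
structure CompatibleACS.ConicalAt (J : C.CompatibleACS) (H : W → ℝ) (x : W) (c r : ℝ) : Prop where
  r_pos : 0 < r
  c_pos : 0 < c
  Om_Xv : ∀ v, C.Om x (C.Xv x) v = C.lamv x v
  dW_Xv : dW H x (C.Xv x) = r
  Jv_Xv : J.Jv x (C.Xv x) = c⁻¹ • C.hamv H x

namespace CompatibleACS.ConicalAt

variable {J : C.CompatibleACS} {x : W} {c r : ℝ}

theorem lamv_hamv (h : J.ConicalAt H x c r) : C.lamv x (C.hamv H x) = r := by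
  rw [← h.Om_Xv, J.Om_hamv, h.dW_Xv]

theorem lamv_Jv_Xv (h : J.ConicalAt H x c r) : C.lamv x (J.Jv x (C.Xv x)) = c⁻¹ * r := by
  rw [h.Jv_Xv, map_smul, h.lamv_hamv]; rfl

theorem dW_Jv (h : J.ConicalAt H x c r) (v : EW n) : dW H x (J.Jv x v) = - c * C.lamv x v := by
  have h1 : C.hamv H x = c • J.Jv x (C.Xv x) := by
    rw [h.Jv_Xv, smul_smul, mul_inv_cancel₀ h.c_pos.ne', one_smul]
  have h2 : J.Jv x (C.hamv H x) = - (c • C.Xv x) := by rw [h1, map_smul, J.Jv_Jv, smul_neg]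
  rw [J.dW_eq, J.Om_Jv_symm, h2, map_neg, map_smul, C.Om_antisymm, h.Om_Xv]
  simp

theorem nsq_Xv (h : J.ConicalAt H x c r) : J.nsq x (C.Xv x) = c⁻¹ * r := by
  rw [CompatibleACS.nsq, h.Om_Xv, h.lamv_Jv_Xv]

/-- The splitting into a part tangent to the level sets and a multiple of `X` is orthogonal. -/
theorem nsq_add_smul (h : J.ConicalAt H x c r) {v : EW n} (hv : dW H x v = 0) (p : ℝ) :
    J.nsq x (v + p • C.Xv x) = J.nsq x v + p ^ 2 * (c⁻¹ * r) := by
  rw [J.nsq_add, J.nsq_smul, h.nsq_Xv, map_smul, map_smul, h.Jv_Xv, map_smul, J.Om_hamv, hv]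
  simp

theorem lamv_sq_le (h : J.ConicalAt H x c r) (v : EW n) :
    C.lamv x v ^ 2 ≤ c⁻¹ * r * J.nsq x v := by
  have h1 := J.sq_Om_Jv_le (x := x) (C.Xv x) (-J.Jv x v)
  rw [map_neg, J.Jv_Jv, neg_neg, h.Om_Xv, h.nsq_Xv] at h1
  have h2 : J.nsq x (-J.Jv x v) = J.nsq x v := by
    rw [← J.nsq_Jv v, CompatibleACS.nsq, CompatibleACS.nsq]; simp
  rwa [h2] at h1

end CompatibleACS.ConicalAt

end Region

end

/-! ### The end of the completion leaves compact sets -/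

section

variable (C : Completion Q W)

/-- In the variable `log ρ`, the rays of the cylindrical part are integral curves of `X`. -/
theorem isMIntegralCurve_cyl (z : N) {ρ : ℝ} (hρ : 0 < ρ) :
    IsMIntegralCurve (fun τ => C.cyl z (ρ * Real.exp τ)) C.X := by
  intro τ
  have h0 : 0 < ρ * Real.exp τ := by positivity
  have h1 : HasMFDerivAt 𝓘(ℝ, ℝ) (𝓡 (2 * n)) (C.cyl z) (ρ * Real.exp τ)
      (mfderiv 𝓘(ℝ, ℝ) (𝓡 (2 * n)) (C.cyl z) (ρ * Real.exp τ)) := by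
    have : MDifferentiableAt 𝓘(ℝ, ℝ) (𝓡 (2 * n)) (C.cyl z) (ρ * Real.exp τ) :=
      ((C.contMDiffAt_cyl (z := z) h0).comp (ρ * Real.exp τ)
        (f := fun r : ℝ => (z, r)) (contMDiffAt_const.prodMk contMDiffAt_id)).mdifferentiableAt
          (by simp)
    exact this.hasMFDerivAt
  have h2 : HasMFDerivAt 𝓘(ℝ, ℝ) 𝓘(ℝ, ℝ) (fun τ => ρ * Real.exp τ) τ
      ((1 : ℝ →L[ℝ] ℝ).smulRight (ρ * Real.exp τ)) :=
    (((Real.hasDerivAt_exp τ).const_mul ρ).hasFDerivAt).hasMFDerivAt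
  have h3 := h1.comp τ h2
  refine h3.congr_mfderiv (ContinuousLinearMap.ext fun c' => ?_)
  let c : ℝ := c'
  let D : ℝ →L[ℝ] EW n := mfderiv 𝓘(ℝ, ℝ) (𝓡 (2 * n)) (C.cyl z) (ρ * Real.exp τ)
  have h4 : D 1 = (ρ * Real.exp τ)⁻¹ • C.Xv (C.cyl z (ρ * Real.exp τ)) := C.deriv_cyl z _ h0
  change D (c * (ρ * Real.exp τ)) = c • C.Xv (C.cyl z (ρ * Real.exp τ))
  have h5 : c * (ρ * Real.exp τ) = (c * (ρ * Real.exp τ)) • (1 : ℝ) := by simp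
  rw [h5, map_smul, h4, smul_smul]
  congr 1
  field_simp

/-- `cyl z ρ` lies in `M` for `ρ ≤ 1`. Otherwise it would be `cyl z' ρ'` with `ρ' > 1`, and by
uniqueness of integral curves of `X` the point `cyl z 1` of `∂M` would be `cyl z' (ρ' / ρ)`. -/
theorem cyl_mem_range_incl [T2Space W] (z : N) {ρ : ℝ} (h0 : 0 < ρ) (h1 : ρ ≤ 1) :
    C.cyl z ρ ∈ range C.incl := by
  rcases C.cover (C.cyl z ρ) with h | ⟨z', ρ', hρ', he⟩
  · exact h
  exfalso
  have h2 := isMIntegralCurve_Ioo_eq_of_contMDiff_boundaryless (t₀ := (0 : ℝ))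
    (C.smooth_X.of_le (by exact_mod_cast le_top)) (C.isMIntegralCurve_cyl z h0)
    (C.isMIntegralCurve_cyl z' (by linarith : 0 < ρ')) (by simp [he])
  have h3 := congrFun h2 (- Real.log ρ)
  simp only [Real.exp_neg, Real.exp_log h0] at h3
  rw [mul_inv_cancel₀ h0.ne', C.cyl_one] at h3
  refine C.disjoint z' (ρ' * ρ⁻¹) ?_ ⟨_, h3⟩
  have : 1 ≤ ρ⁻¹ := (one_le_inv₀ h0).2 h1
  nlinarith

/-- The end of the completion leaves every compact set `K`: a cluster point in `K` of points
`cyl z ρ` with `ρ → ∞` has a neighbourhood on which `ρ` is bounded. -/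
theorem exists_bound_of_isCompact [T2Space W] (J : C.CompatibleACS)
    {K : Set W} (hK : IsCompact K) : ∃ R₀ : ℝ, 1 ≤ R₀ ∧ ∀ z ρ, R₀ < ρ → C.cyl z ρ ∉ K := by
  by_contra! hcon
  have hk : ∀ k : ℕ, ∃ z ρ, (k : ℝ) + 2 < ρ ∧ C.cyl z ρ ∈ K := by
    intro k
    obtain ⟨z, ρ, h1, h2⟩ := hcon (k + 2) (by have : (0 : ℝ) ≤ k := k.cast_nonneg
                                              linarith)
    exact ⟨z, ρ, h1, h2⟩
  choose z ρ hρ hzK using hk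
  have : Nonempty N := ⟨z 0⟩
  have hρ2 : ∀ k, 2 < ρ k := fun k => by
    have : (0 : ℝ) ≤ k := k.cast_nonneg
    linarith [hρ k]
  have hρtop : Tendsto ρ atTop atTop := by
    refine tendsto_atTop_mono (fun k => ?_) tendsto_natCast_atTop_atTop
    linarith [hρ k]
  obtain ⟨w, -, hw⟩ := hK.exists_mapClusterPt_of_frequently (f := fun k => C.cyl (z k) (ρ k))
    (l := atTop) (Frequently.of_forall hzK)
  have hfr : ∀ U ∈ 𝓝 w, ∃ᶠ k in atTop, C.cyl (z k) (ρ k) ∈ U := fun U hU => hw.frequently hU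
  -- near a point of the cylindrical part, the coordinate is bounded
  have hcyl : ∀ z' ρ', 1 ≤ ρ' → C.cyl z' ρ' = w → False := by
    rintro z' ρ' h1 rfl
    have h0 : 0 < ρ' := by linarith
    have hm := map_nhds_eq_of_surjective (C.contMDiffAt_cyl (z := z') h0)
      (BoundarylessManifold.isInteriorPoint)
      (by rw [(C.hasMFDerivAt_cyl h0).mfderiv]; exact (C.dcyl_bijective J z' h1).2)
    have hU : (fun p : N × ℝ => C.cyl p.1 p.2) '' (univ ×ˢ Ioo 0 (ρ' + 1)) ∈ 𝓝 (C.cyl z' ρ') := by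
      rw [show C.cyl z' ρ' = (fun p : N × ℝ => C.cyl p.1 p.2) (z', ρ') from rfl, ← hm]
      exact image_mem_map (prod_mem_nhds univ_mem (Ioo_mem_nhds h0 (by linarith)))
    obtain ⟨k, ⟨⟨z'', ρ''⟩, ⟨-, h2, h3⟩, h4⟩, h5⟩ :=
      ((hfr _ hU).and_eventually (hρtop.eventually_gt_atTop (ρ' + 1))).exists
    have h4' : C.cyl z'' ρ'' = C.cyl (z k) (ρ k) := h4
    rcases le_or_gt ρ'' 1 with h6 | h6
    · exact C.disjoint (z k) (ρ k) (by linarith [hρ2 k])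
        (h4' ▸ C.cyl_mem_range_incl z'' h2 h6)
    · have := (C.cyl_injective _ _ _ _ h6.le (by linarith [hρ2 k]) h4').2
      simp only at h3
      linarith
  -- the cluster point is in the interior of `M`, in its boundary, or on the cylindrical part
  have hsurj : ∀ D : EW n →L[ℝ] EW n, Function.Injective D → Function.Surjective D :=
    fun D hD => (LinearMap.injective_iff_surjective (f := (D : EW n →ₗ[ℝ] EW n))).1 hD
  rcases C.cover w with ⟨p, rfl⟩ | ⟨z', ρ', h1, h2⟩
  · by_cases hp : (𝓡∂ (2 * n)).IsInteriorPoint p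
    · have hm := map_nhds_eq_of_surjective (C.incl_embedding.contMDiff p) hp
        (hsurj _ (C.incl_embedding.immersion p))
      have hU : range C.incl ∈ 𝓝 (C.incl p) := by
        rw [← hm, ← image_univ]; exact image_mem_map univ_mem
      obtain ⟨k, hk⟩ := (hfr _ hU).exists
      exact C.disjoint (z k) (ρ k) (by linarith [hρ2 k]) hk
    · have hb : p ∈ (𝓡∂ (2 * n)).boundary M :=
        (ModelWithCorners.isBoundaryPoint_iff_not_isInteriorPoint p).2 hp
      rw [← Q.range_bdry] at hb
      obtain ⟨z', rfl⟩ := hb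
      exact hcyl z' 1 le_rfl (C.cyl_one z')
  · exact hcyl z' ρ' h1.le h2

end

/-! ### Comparison of forms and metrics over compact sets -/

section

variable (C : Completion Q W)

theorem tangentBundle_trivialization_snd (x₀ : W) {x : W}
    (hx : x ∈ (chartAt (EW n) x₀).source) (v : EW n) :
    (mfderivWithin 𝓘(ℝ, EW n) (𝓡 (2 * n)) (extChartAt (𝓡 (2 * n)) x₀).symm
      (extChartAt (𝓡 (2 * n)) x₀).target (extChartAt (𝓡 (2 * n)) x₀ x) : EW n →L[ℝ] EW n)
      ((trivializationAt (EW n) (TangentSpace (𝓡 (2 * n))) x₀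
        (⟨x, v⟩ : TangentBundle (𝓡 (2 * n)) W)).2) = v := by
  have hx' : x ∈ (extChartAt (𝓡 (2 * n)) x₀).source := by rwa [extChartAt_source]
  have h1 : (trivializationAt (EW n) (TangentSpace (𝓡 (2 * n))) x₀
        (⟨x, v⟩ : TangentBundle (𝓡 (2 * n)) W)).2 =
      (mfderiv (𝓡 (2 * n)) 𝓘(ℝ, EW n) (extChartAt (𝓡 (2 * n)) x₀) x : EW n →L[ℝ] EW n) v := by
    rw [← TangentBundle.continuousLinearMapAt_trivializationAt hx]
    have hb : x ∈ (trivializationAt (EW n) (TangentSpace (𝓡 (2 * n)) (M := W)) x₀).baseSet := by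
      simpa using hx
    exact (congrFun (Trivialization.coe_linearMapAt_of_mem (R := ℝ) _ hb) v).symm
  have h2 : (mfderivWithin 𝓘(ℝ, EW n) (𝓡 (2 * n)) (extChartAt (𝓡 (2 * n)) x₀).symm
      (extChartAt (𝓡 (2 * n)) x₀).target (extChartAt (𝓡 (2 * n)) x₀ x) : EW n →L[ℝ] EW n) =
      (mfderivWithin 𝓘(ℝ, EW n) (𝓡 (2 * n)) (extChartAt (𝓡 (2 * n)) x₀).symm
      (range (𝓡 (2 * n))) (extChartAt (𝓡 (2 * n)) x₀ x) : EW n →L[ℝ] EW n) := by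
    rw [ModelWithCorners.range_eq_univ, mfderivWithin_univ, mfderivWithin_of_isOpen
      (isOpen_extChartAt_target x₀) ((extChartAt (𝓡 (2 * n)) x₀).map_source hx')]
  rw [h1, h2]
  exact DFunLike.congr_fun
    (mfderivWithin_extChartAt_symm_comp_mfderiv_extChartAt' (I := 𝓡 (2 * n)) hx') v

/-- The symplectic form depends continuously on the point and on the two vectors. -/
theorem continuousWithinAt_Om {P : Type*} [TopologicalSpace P] {x : P → W} {v w : P → EW n}
    {s : Set P} {p₀ : P}
    (hv : ContinuousWithinAt (fun p => (⟨x p, v p⟩ : TangentBundle (𝓡 (2 * n)) W)) s p₀)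
    (hw : ContinuousWithinAt (fun p => (⟨x p, w p⟩ : TangentBundle (𝓡 (2 * n)) W)) s p₀) :
    ContinuousWithinAt (fun p => C.Om (x p) (v p) (w p)) s p₀ := by
  have hx : ContinuousWithinAt x s p₀ :=
    (FiberBundle.continuous_proj (EW n) (TangentSpace (𝓡 (2 * n)) (M := W))).continuousAt.comp_continuousWithinAt hv
  set e := trivializationAt (EW n) (TangentSpace (𝓡 (2 * n)) (M := W)) (x p₀) with he
  set φ := extChartAt (𝓡 (2 * n)) (x p₀) with hφ
  have hev : ∀ᶠ p in 𝓝[s] p₀, x p ∈ (chartAt (EW n) (x p₀)).source :=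
    hx.eventually_mem ((chartAt (EW n) (x p₀)).open_source.mem_nhds (mem_chart_source _ _))
  have triv : ∀ v : P → EW n,
      ContinuousWithinAt (fun p => (⟨x p, v p⟩ : TangentBundle (𝓡 (2 * n)) W)) s p₀ →
      ContinuousWithinAt (fun p => (e (⟨x p, v p⟩ : TangentBundle (𝓡 (2 * n)) W)).2) s p₀ := by
    intro v hv
    have h1 : ContinuousAt e (⟨x p₀, v p₀⟩ : TangentBundle (𝓡 (2 * n)) W) := by
      refine e.continuousOn.continuousAt (e.open_source.mem_nhds ?_)
      rw [e.mem_source]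
      exact mem_baseSet_trivializationAt (EW n) (TangentSpace (𝓡 (2 * n)) (M := W)) (x p₀)
    exact (ContinuousAt.comp_continuousWithinAt (f := fun p =>
      (⟨x p, v p⟩ : TangentBundle (𝓡 (2 * n)) W)) h1 hv).snd
  let A := pullbackWithin C.lam φ.symm φ.target
  have hsm : ContMDiffOn 𝓘(ℝ, EW n) 𝓘(ℝ, EW n) ∞ φ.symm φ.target := contMDiffOn_extChartAt_symm _
  have hopen : IsOpen φ.target := isOpen_extChartAt_target _
  have hA : ContDiffOn ℝ ∞ A φ.target :=
    contDiffOn_pullbackWithin C.smooth_lam hsm hopen.uniqueDiffOn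
  have hD : ContinuousOn (fderivWithin ℝ A φ.target) φ.target :=
    hA.continuousOn_fderivWithin hopen.uniqueDiffOn (by simp)
  have hDc : ContinuousWithinAt (fun p => fderivWithin ℝ A φ.target (φ (x p))) s p₀ := by
    have h1 : ContinuousAt (fderivWithin ℝ A φ.target) (φ (x p₀)) :=
      hD.continuousAt (hopen.mem_nhds (mem_extChartAt_target _))
    have h2 : ContinuousAt φ (x p₀) := continuousAt_extChartAt _
    exact ContinuousAt.comp_continuousWithinAt (f := x) (h1.comp h2) hx
  have hv' := triv v hv
  have hw' := triv w hw
  have main := ((hDc.clm_apply hv').clm_apply hw').sub ((hDc.clm_apply hw').clm_apply hv')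
  have key : ∀ p, x p ∈ (chartAt (EW n) (x p₀)).source → C.Om (x p) (v p) (w p) =
      fderivWithin ℝ A φ.target (φ (x p)) (e (⟨x p, v p⟩ : TangentBundle (𝓡 (2 * n)) W)).2
        (e (⟨x p, w p⟩ : TangentBundle (𝓡 (2 * n)) W)).2 -
      fderivWithin ℝ A φ.target (φ (x p)) (e (⟨x p, w p⟩ : TangentBundle (𝓡 (2 * n)) W)).2
        (e (⟨x p, v p⟩ : TangentBundle (𝓡 (2 * n)) W)).2 := by
    intro p hp
    have hp' : x p ∈ φ.source := by rwa [hφ, extChartAt_source]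
    have h1 := fderivWithin_pullbackWithin_sub C.smooth_lam hsm hopen.uniqueDiffOn
      (φ.map_source hp') (by rw [hopen.interior_eq]; exact subset_closure (φ.map_source hp'))
      (e (⟨x p, v p⟩ : TangentBundle (𝓡 (2 * n)) W)).2
      (e (⟨x p, w p⟩ : TangentBundle (𝓡 (2 * n)) W)).2
    rw [h1]
    have h2 := tangentBundle_trivialization_snd (x p₀) hp (v p)
    have h3 := tangentBundle_trivialization_snd (x p₀) hp (w p)
    have h4 : ∀ x' : W, x' = x p → ∀ v' w' : EW n, v' = v p → w' = w p →
        C.Om (x p) (v p) (w p) = C.Om x' v' w' := by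
      rintro _ rfl _ _ rfl rfl; rfl
    exact h4 _ (φ.left_inv hp') _ _ h2 h3
  refine main.congr_of_eventuallyEq ?_ (key p₀ (mem_chart_source _ _))
  filter_upwards [hev] with p hp using key p hp

theorem SmoothACSFamily.continuousWithinAt {C : Completion Q W} {J : ℝ → ℝ → C.CompatibleACS}
    (hJ : SmoothACSFamily J) {P : Type*} [TopologicalSpace P] {σ τ : P → ℝ} {x : P → W}
    {v : P → EW n} {s : Set P} {p₀ : P} (hp₀ : p₀ ∈ s) (hτ : ∀ p ∈ s, τ p ∈ Icc (0 : ℝ) 1)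
    (hσc : ContinuousWithinAt σ s p₀) (hτc : ContinuousWithinAt τ s p₀)
    (hv : ContinuousWithinAt (fun p => (⟨x p, v p⟩ : TangentBundle (𝓡 (2 * n)) W)) s p₀) :
    ContinuousWithinAt (fun p =>
      (⟨x p, (J (σ p) (τ p)).Jv (x p) (v p)⟩ : TangentBundle (𝓡 (2 * n)) W)) s p₀ := by
  have hx : ContinuousWithinAt x s p₀ :=
    (FiberBundle.continuous_proj (EW n) (TangentSpace (𝓡 (2 * n)) (M := W))).continuousAt.comp_continuousWithinAt hv
  have h1 := (hJ (σ p₀, τ p₀, x p₀) ⟨mem_univ _, hτ p₀ hp₀, mem_univ _⟩).continuousWithinAt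
  have h2 : ContinuousWithinAt (fun p => (σ p, τ p, x p)) s p₀ := hσc.prodMk (hτc.prodMk hx)
  have h3 := ContinuousWithinAt.comp (f := fun p => (σ p, τ p, x p))
    (t := univ ×ˢ Icc (0 : ℝ) 1 ×ˢ univ) h1 h2
    (fun p hp => ⟨mem_univ _, hτ p hp, mem_univ _⟩)
  exact ContinuousWithinAt.clm_bundle_apply (F₁ := EW n) (F₂ := EW n)
    (E₁ := fun q : W => TangentSpace (𝓡 (2 * n)) q) (E₂ := fun q : W => TangentSpace (𝓡 (2 * n)) q)
    h3 hv

/-- Over a compact set, the square of a continuous family of linear forms is bounded by a constant times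
a continuous family of positive definite quadratic forms. The families need only be
homogeneous: the quotient is bounded on the unit spheres of local trivializations. -/
theorem exists_sq_le_of_isCompact [T2Space W] {P : Type*} [TopologicalSpace P] {Z : Set (P × W)} (hZ : IsCompact Z)
    {q θ : P → W → EW n → ℝ}
    (hq : ContinuousOn (fun p : P × TangentBundle (𝓡 (2 * n)) W => q p.1 p.2.proj p.2.2)
      {p | (p.1, p.2.proj) ∈ Z})
    (hθ : ContinuousOn (fun p : P × TangentBundle (𝓡 (2 * n)) W => θ p.1 p.2.proj p.2.2)
      {p | (p.1, p.2.proj) ∈ Z})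
    (q_pos : ∀ p x, (p, x) ∈ Z → ∀ v, v ≠ 0 → 0 < q p x v)
    (q_smul : ∀ p x (r : ℝ) v, q p x (r • v) = r ^ 2 * q p x v)
    (θ_smul : ∀ p x (r : ℝ) v, θ p x (r • v) = r * θ p x v) :
    ∃ c : ℝ, 0 < c ∧ ∀ p x, (p, x) ∈ Z → ∀ v, θ p x v ^ 2 ≤ c * q p x v := by
  have hloc : ∀ x₀ : W, ∃ U ∈ 𝓝 x₀, ∃ c : ℝ, 0 < c ∧ ∀ p x, (p, x) ∈ Z → x ∈ U →
      ∀ v, θ p x v ^ 2 ≤ c * q p x v := by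
    intro x₀
    have : LocallyCompactSpace W := Manifold.locallyCompact_of_finiteDimensional (𝓡 (2 * n))
    set e := trivializationAt (EW n) (TangentSpace (𝓡 (2 * n)) (M := W)) x₀ with he
    have hx₀ : x₀ ∈ e.baseSet := mem_baseSet_trivializationAt _ _ _
    obtain ⟨U, hU, hUe, hUc⟩ := local_compact_nhds (e.open_baseSet.mem_nhds hx₀)
    -- the unit spheres of a local trivialization
    let Z' : Set ((P × W) × EW n) := (Z ∩ (univ ×ˢ U)) ×ˢ Metric.sphere 0 1
    have hZ' : IsCompact Z' :=
      (hZ.inter_right (isClosed_univ.prod hUc.isClosed)).prod (isCompact_sphere _ _)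
    let ι : (P × W) × EW n → P × TangentBundle (𝓡 (2 * n)) W :=
      fun a => (a.1.1, e.toOpenPartialHomeomorph.symm (a.1.2, a.2))
    have hmem : ∀ a ∈ Z', (a.1.2, a.2) ∈ e.target := by
      rintro ⟨⟨p, x⟩, v⟩ ⟨⟨-, -, hx⟩, -⟩
      rw [e.mem_target]; exact hUe hx
    have hι : ContinuousOn ι Z' := by
      refine (continuous_fst.fst.continuousOn).prodMk ?_
      exact e.toOpenPartialHomeomorph.continuousOn_symm.comp
        ((continuous_fst.snd.prodMk continuous_snd).continuousOn) hmem
    have hproj : ∀ a ∈ Z', (ι a).2.proj = a.1.2 := fun a ha => e.proj_symm_apply (hmem a ha)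
    have hmaps : MapsTo ι Z' {p | (p.1, p.2.proj) ∈ Z} := by
      intro a ha
      simp only [mem_ofPred_eq, hproj a ha]
      exact ha.1.1
    have hq' := hq.comp hι hmaps
    have hθ' := hθ.comp hι hmaps
    have hne : ∀ a ∈ Z', ((ι a).2.2 : EW n) ≠ 0 := by
      intro a ha h0
      have h1 : e (ι a).2 = (a.1.2, a.2) := e.apply_symm_apply (hmem a ha)
      have h2 : (ι a).2 = (⟨a.1.2, (0 : EW n)⟩ : TangentBundle (𝓡 (2 * n)) W) := by
        apply TotalSpace.ext (hproj a ha)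
        exact heq_of_eq h0
      have h3 : e (⟨a.1.2, (0 : EW n)⟩ : TangentBundle (𝓡 (2 * n)) W) = (a.1.2, 0) := by
        exact e.zeroSection ℝ (hUe ha.1.2.2)
      rw [h2, h3] at h1
      have h4 : a.2 = 0 := (congrArg Prod.snd h1).symm
      have h5 := ha.2
      rw [h4] at h5
      simp at h5
    have hquot : ContinuousOn (fun a => θ (ι a).1 (ι a).2.proj (ι a).2.2 ^ 2 /
        q (ι a).1 (ι a).2.proj (ι a).2.2) Z' :=
      (hθ'.pow 2).div hq' fun a ha => (q_pos _ _ (hmaps ha) _ (hne a ha)).ne'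
    obtain ⟨B, hB⟩ := (hZ'.image_of_continuousOn hquot).bddAbove
    refine ⟨U, hU, max B 1, by positivity, fun p x hpx hxU v => ?_⟩
    by_cases hv : v = 0
    · have h1 := θ_smul p x 0 v
      have h2 := q_smul p x 0 v
      rw [zero_smul] at h1 h2
      rw [hv, h1, h2]; simp
    set v' : EW n := (e (⟨x, v⟩ : TangentBundle (𝓡 (2 * n)) W)).2 with hv'
    have hsrc : (⟨x, v⟩ : TangentBundle (𝓡 (2 * n)) W) ∈ e.source := by
      rw [e.mem_source]; exact hUe hxU
    have hev : e (⟨x, v⟩ : TangentBundle (𝓡 (2 * n)) W) = (x, v') :=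
      Prod.ext (e.coe_fst hsrc) rfl
    have hlin : ∀ (r : ℝ), e (⟨x, r • v⟩ : TangentBundle (𝓡 (2 * n)) W) = (x, r • v') := by
      intro r
      have hsrc' : (⟨x, r • v⟩ : TangentBundle (𝓡 (2 * n)) W) ∈ e.source := by
        rw [e.mem_source]; exact hUe hxU
      refine Prod.ext (e.coe_fst hsrc') ?_
      exact (e.linear ℝ (hUe hxU)).map_smul r v
    have hv0 : v' ≠ 0 := by
      intro h0
      apply hv
      have h1 : e (⟨x, v⟩ : TangentBundle (𝓡 (2 * n)) W) = e (⟨x, (0 : EW n)⟩ : TangentBundle (𝓡 (2 * n)) W) := by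
        rw [hev, h0]
        exact (e.zeroSection ℝ (hUe hxU)).symm
      have h2 := e.injOn hsrc (by rw [e.mem_source]; exact hUe hxU) h1
      injection h2
    set r := ‖v'‖⁻¹ with hr
    have hr0 : r ≠ 0 := inv_ne_zero (norm_ne_zero_iff.2 hv0)
    have hmemZ : (((p, x), r • v') : (P × W) × EW n) ∈ Z' := by
      refine ⟨⟨hpx, mem_univ _, hxU⟩, ?_⟩
      simp [hr, norm_smul, hv0]
    have hιv : ι ((p, x), r • v') = (p, (⟨x, r • v⟩ : TangentBundle (𝓡 (2 * n)) W)) := by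
      refine Prod.ext rfl ?_
      change e.toOpenPartialHomeomorph.symm (x, r • v') = _
      rw [← hlin r]
      exact e.toOpenPartialHomeomorph.left_inv (e.mem_source.2 (hUe hxU))
    have h1 : θ p x (r • v) ^ 2 / q p x (r • v) ≤ B := by
      let Ψ : P × TangentBundle (𝓡 (2 * n)) W → ℝ := fun p =>
        θ p.1 p.2.proj p.2.2 ^ 2 / q p.1 p.2.proj p.2.2
      have h2 : Ψ (ι ((p, x), r • v')) ≤ B := hB (mem_image_of_mem _ hmemZ)
      rw [hιv] at h2
      exact h2
    have hqv : 0 < q p x v := q_pos p x hpx v hv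
    rw [θ_smul, q_smul, mul_pow, mul_div_mul_left _ _ (pow_ne_zero 2 hr0), div_le_iff₀ hqv] at h1
    exact h1.trans (mul_le_mul_of_nonneg_right (le_max_left _ _) hqv.le)
  refine (hZ.image continuous_snd).induction_on (p := fun S : Set W => ∃ c : ℝ, 0 < c ∧ ∀ p x, (p, x) ∈ Z → x ∈ S →
      ∀ v, θ p x v ^ 2 ≤ c * q p x v) ⟨1, one_pos, by simp⟩ ?_ ?_ ?_ |>.imp ?_
  · rintro S S' hS ⟨c, hc, h⟩
    exact ⟨c, hc, fun p x hpx hx => h p x hpx (hS hx)⟩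
  · rintro S S' ⟨c, hc, h⟩ ⟨c', hc', h'⟩
    have hqn : ∀ p x, (p, x) ∈ Z → ∀ v, 0 ≤ q p x v := by
      intro p x hpx v
      by_cases hv : v = 0
      · have h2 := q_smul p x 0 v
        rw [zero_smul] at h2
        rw [hv, h2]; simp
      · exact (q_pos p x hpx v hv).le
    refine ⟨max c c', by positivity, fun p x hpx hx v => ?_⟩
    rcases hx with hx | hx
    · exact (h p x hpx hx v).trans (mul_le_mul_of_nonneg_right (le_max_left _ _) (hqn p x hpx v))
    · exact (h' p x hpx hx v).trans (mul_le_mul_of_nonneg_right (le_max_right _ _) (hqn p x hpx v))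
  · intro x₀ _
    obtain ⟨U, hU, c, hc, h⟩ := hloc x₀
    exact ⟨U, mem_nhdsWithin_of_mem_nhds hU, c, hc, h⟩
  · rintro c ⟨hc, h⟩
    exact ⟨hc, fun p x hpx v => h p x hpx ⟨(p, x), hpx, rfl⟩ v⟩

end

/-! ### The Lagrangian boundary condition -/

section

variable {C : Completion Q W}

theorem mfderiv_pr_dcyl [Nonempty N] (J : C.CompatibleACS) {z : N} {ρ : ℝ} (hρ : 1 < ρ)
    (p : EN n × ℝ) :
    (mfderiv (𝓡 (2 * n)) ((𝓡 (2 * n - 1)).prod 𝓘(ℝ, ℝ)) C.pr (C.cyl z ρ) :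
      EW n →L[ℝ] EN n × ℝ) (C.dcyl z ρ p) = p := by
  have h0 : 0 < ρ := by linarith
  have h1 := ((C.contMDiffAt_pr J (z := z) hρ).mdifferentiableAt (by simp)).hasMFDerivAt
  have h2 := HasMFDerivAt.comp (f := fun p : N × ℝ => C.cyl p.1 p.2) (z, ρ) h1
    (C.hasMFDerivAt_cyl h0)
  have h3 : (C.pr ∘ fun p : N × ℝ => C.cyl p.1 p.2) =ᶠ[𝓝 (z, ρ)] id := by
    filter_upwards [(continuous_snd.continuousAt (x := (z, ρ))).eventually_const_lt hρ] with p hp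
    exact C.pr_cyl hp
  have h4 := (h2.congr_of_eventuallyEq h3.symm).mfderiv
  rw [mfderiv_id] at h4
  exact (DFunLike.congr_fun h4 p).symm

/-- The Liouville form vanishes on vectors tangent to the Lagrangian. -/
theorem lam_lag (Q : LiouvilleQuadruple n M N L) (q : L) (ξ : EuclideanSpace ℝ (Fin n)) :
    (Q.lam (Q.lag q) : EW n →L[ℝ] ℝ)
      ((mfderiv (𝓡∂ n) (𝓡∂ (2 * n)) Q.lag q : EuclideanSpace ℝ (Fin n) →L[ℝ] EW n) ξ) = 0 := by
  obtain ⟨η, hη⟩ := Q.tangent q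
  have h := Q.lagrangian q η ξ
  rw [hη] at h
  exact h

variable [CompactSpace L] [T2Space M] [T2Space W]

/-- `λ` vanishes on velocities of curves in the cylindrical part of the completed Lagrangian, by
projection to the Legendrian `∂L`. -/
theorem lamv_eq_zero_of_mem_cyl [Nonempty N] [CompactSpace M] (J : C.CompatibleACS) {w : ℝ → W} {s₀ : ℝ} {v : EW n}
    (hw : HasMFDerivAt 𝓘(ℝ, ℝ) (𝓡 (2 * n)) w s₀ ((1 : ℝ →L[ℝ] ℝ).smulRight v))
    (hL : ∀ s, w s ∈ C.Lhat) (hs : w s₀ ∉ range C.incl) : C.lamv (w s₀) v = 0 := by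
  have hclosed : IsClosed (range C.incl) := (isCompact_range C.incl_embedding.contMDiff.continuous).isClosed
  have hev : ∀ᶠ s in 𝓝 s₀, w s ∉ range C.incl :=
    hw.continuousAt.eventually_mem (hclosed.isOpen_compl.mem_nhds hs)
  have hlag : ∀ s, w s ∉ range C.incl → Q.bdry (C.pr (w s)).1 ∈ range Q.lag := by
    intro s h
    rcases hL s with ⟨m, -, h1⟩ | ⟨z, hz, ρ, hρ, h1⟩
    · exact absurd ⟨m, h1⟩ h
    · rcases hρ.eq_or_lt with h2 | h2
      · rw [← h2, C.cyl_one] at h1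
        exact absurd ⟨_, h1⟩ h
      · rw [← h1, C.pr_cyl h2]
        exact hz
  obtain ⟨hρ, hpt⟩ := C.pr_spec hs
  set z₀ := (C.pr (w s₀)).1 with hz₀
  set ρ₀ := (C.pr (w s₀)).2 with hρ₀
  obtain ⟨⟨ζ, τ⟩, hζ⟩ := (C.dcyl_bijective J z₀ hρ.le).2 v
  have h1 := ((C.contMDiffAt_pr J (z := z₀) hρ).mdifferentiableAt (by simp)).hasMFDerivAt
  rw [hpt] at h1
  have h2 := (hasMFDerivAt_fst (I := 𝓡 (2 * n - 1)) (I' := 𝓘(ℝ, ℝ)) (C.pr (w s₀))).comp s₀ (h1.comp s₀ hw)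
  have h3 := ((Q.bdry_embedding.contMDiff z₀).mdifferentiableAt (by simp)).hasMFDerivAt.comp s₀ h2
  have h4 : HasMFDerivAt 𝓘(ℝ, ℝ) (𝓡∂ (2 * n)) (fun s => Q.bdry (C.pr (w s)).1) s₀
      ((1 : ℝ →L[ℝ] ℝ).smulRight (dbdry Q z₀ ζ)) := by
    refine h3.congr_mfderiv (ContinuousLinearMap.ext fun c' => ?_)
    let c : ℝ := c'
    let P : EW n →L[ℝ] EN n × ℝ :=
      mfderiv (𝓡 (2 * n)) ((𝓡 (2 * n - 1)).prod 𝓘(ℝ, ℝ)) C.pr (w s₀)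
    have h5 : P v = (ζ, τ) := by
      rw [← hζ]
      have := mfderiv_pr_dcyl J (z := z₀) hρ (ζ, τ)
      rw [hpt] at this
      exact this
    change dbdry Q z₀ (P (c • v)).1 = c • dbdry Q z₀ ζ
    rw [map_smul, h5, Prod.smul_fst, map_smul]
  have hfr : ∃ᶠ s in 𝓝[≠] s₀, Q.bdry (C.pr (w s)).1 ∈ range Q.lag :=
    ((hev.filter_mono nhdsWithin_le_nhds).mono hlag).frequently
  obtain ⟨q, hq, ξ, hξ⟩ := mem_range_mfderiv_of_frequently Q.lag_embedding h4 hfr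
  have h6 := lam_lag Q q ξ
  have h7 : ∀ m m' : M, m = m' → ∀ u : EW n, (Q.lam m : EW n →L[ℝ] ℝ) u = 0 →
      (Q.lam m' : EW n →L[ℝ] ℝ) u = 0 := by rintro m _ rfl u h; exact h
  have h8 : Q.bdryLamv z₀ ζ = 0 := by
    rw [hξ] at h6
    exact h7 _ _ hq _ h6
  have h9 := C.lamv_dcyl (z := z₀) hρ.le ζ τ
  rw [hζ, h8, mul_zero, hpt] at h9
  exact h9

/-- `λ` vanishes on velocities of curves in the completed Lagrangian. The compact part and the
cylindrical part of the Lagrangian are not known to fit together smoothly, so a time at which the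
curve returns infinitely often to the compact part is treated there, and every other time is a limit
of times at which the curve is in the cylindrical part. -/
theorem lamv_eq_zero_of_mem_Lhat [Nonempty N] [CompactSpace M] (J : C.CompatibleACS) {w : ℝ → W} {v : ℝ → EW n}
    (hw : ∀ s, HasMFDerivAt 𝓘(ℝ, ℝ) (𝓡 (2 * n)) w s ((1 : ℝ →L[ℝ] ℝ).smulRight (v s)))
    (hL : ∀ s, w s ∈ C.Lhat) (hc : Continuous fun s => C.lamv (w s) (v s)) (s₀ : ℝ) :
    C.lamv (w s₀) (v s₀) = 0 := by
  by_cases hfr : ∃ᶠ s in 𝓝[≠] s₀, w s ∈ range (C.incl ∘ Q.lag)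
  · have hd : ∀ q : L, HasMFDerivAt (𝓡∂ n) (𝓡 (2 * n)) (C.incl ∘ Q.lag) q
        ((mfderiv (𝓡∂ (2 * n)) (𝓡 (2 * n)) C.incl (Q.lag q)).comp
          (mfderiv (𝓡∂ n) (𝓡∂ (2 * n)) Q.lag q)) := fun q =>
      ((C.incl_embedding.contMDiff _).mdifferentiableAt (by simp)).hasMFDerivAt.comp q
        ((Q.lag_embedding.contMDiff q).mdifferentiableAt (by simp)).hasMFDerivAt
    have himm : IsSmoothInjImmersion (𝓡∂ n) (𝓡 (2 * n)) (C.incl ∘ Q.lag) := by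
      refine ⟨C.incl_embedding.contMDiff.comp Q.lag_embedding.contMDiff,
        C.incl_embedding.injective.comp Q.lag_embedding.injective, fun q => ?_⟩
      rw [(hd q).mfderiv]
      exact (C.incl_embedding.immersion _).comp (Q.lag_embedding.immersion q)
    obtain ⟨q, hq, ξ, hξ⟩ := mem_range_mfderiv_of_frequently himm (hw s₀) hfr
    have h1 : (C.lamv (C.incl (Q.lag q)))
        ((mfderiv (𝓡∂ (2 * n)) (𝓡 (2 * n)) C.incl (Q.lag q) : EW n →L[ℝ] EW n)
          ((mfderiv (𝓡∂ n) (𝓡∂ (2 * n)) Q.lag q : EuclideanSpace ℝ (Fin n) →L[ℝ] EW n) ξ)) = 0 := by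
      have h2 := congrFun C.lam_incl (Q.lag q)
      have h3 := lam_lag Q q ξ
      rw [← h2] at h3
      exact h3
    rw [(hd q).mfderiv] at hξ
    have h4 : ∀ m m' : W, m = m' → ∀ u u' : EW n, u = u' → C.lamv m u = 0 → C.lamv m' u' = 0 := by
      rintro m _ rfl u _ rfl h; exact h
    exact h4 _ _ hq _ _ hξ h1
  · have hev : ∀ᶠ s in 𝓝[≠] s₀, C.lamv (w s) (v s) = 0 := by
      filter_upwards [not_frequently.1 hfr] with s hs
      refine lamv_eq_zero_of_mem_cyl J (hw s) hL ?_
      rcases hL s with ⟨m, ⟨q, rfl⟩, h1⟩ | ⟨z, ⟨q, hz⟩, ρ, hρ, h1⟩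
      · exact absurd ⟨q, h1⟩ hs
      · rcases hρ.eq_or_lt with h2 | h2
        · rw [← h2, C.cyl_one, ← hz] at h1
          exact absurd ⟨q, h1⟩ hs
        · rw [← h1]
          exact C.disjoint z ρ h2
    exact tendsto_nhds_unique (hc.continuousAt.tendsto.mono_left (nhdsWithin_le_nhds (s := {s₀}ᶜ)))
      (tendsto_const_nhds.congr' (hev.mono fun s h => h.symm))

end

/-! ### Weak integral curves and Reeb chords -/

section

/-- A curve `z : [0, 1] → N` is a weak integral curve of the vector field `R` if `(g ∘ z)' = dg(R) ∘ z`
for all smooth functions `g`. This notion passes to limits of values, without charts. -/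
def IsWeakIntegralCurve (R : N → EN n) (z : ℝ → N) : Prop :=
  ∀ g : N → ℝ, ContMDiff (𝓡 (2 * n - 1)) 𝓘(ℝ, ℝ) ∞ g → ∀ t ∈ Icc (0 : ℝ) 1,
    HasDerivWithinAt (fun τ => g (z τ)) (dN g (z t) (R (z t))) (Icc 0 1) t

/-- The vector field `R` maps smooth functions to smooth functions, as a derivation. -/
def SmoothDerivation (R : N → EN n) : Prop :=
  ∀ g : N → ℝ, ContMDiff (𝓡 (2 * n - 1)) 𝓘(ℝ, ℝ) ∞ g →
    ContMDiff (𝓡 (2 * n - 1)) 𝓘(ℝ, ℝ) ∞ (fun z => dN g z (R z))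

theorem IsWeakIntegralCurve.contDiffOn {R : N → EN n} {z : ℝ → N} (hz : IsWeakIntegralCurve R z)
    (hR : SmoothDerivation R) {g : N → ℝ} (hg : ContMDiff (𝓡 (2 * n - 1)) 𝓘(ℝ, ℝ) ∞ g) :
    ContDiffOn ℝ ∞ (fun τ => g (z τ)) (Icc 0 1) := by
  rw [contDiffOn_infty]
  intro k
  induction k generalizing g with
  | zero =>
    simp only [CharP.cast_eq_zero, contDiffOn_zero]
    exact fun t ht => (hz g hg t ht).continuousWithinAt
  | succ k ih =>
    have hu : UniqueDiffOn ℝ (Icc (0 : ℝ) 1) := uniqueDiffOn_Icc one_pos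
    rw [Nat.cast_succ, contDiffOn_succ_iff_derivWithin hu]
    refine ⟨fun t ht => (hz g hg t ht).differentiableWithinAt, by simp, ?_⟩
    exact (ih (hR g hg)).congr fun t ht => (hz g hg t ht).derivWithin (hu t ht)

section
variable [T2Space N]

theorem IsWeakIntegralCurve.continuousOn {R : N → EN n} {z : ℝ → N} (hz : IsWeakIntegralCurve R z) :
    ContinuousOn z (Icc 0 1) := by
  intro t ht U hU
  obtain ⟨f, -, hf⟩ := (SmoothBumpFunction.nhds_basis_support (I := 𝓡 (2 * n - 1)) hU).mem_iff.1 hU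
  have h1 := (hz f f.contMDiff t ht).continuousWithinAt
  have h2 : ∀ᶠ τ in 𝓝[Icc 0 1] t, f (z τ) ≠ 0 := by
    refine h1.eventually_ne ?_
    change f (z t) ≠ 0
    rw [f.eq_one]; exact one_ne_zero
  exact h2.mono fun τ hτ => hf hτ

/-- Weak integral curves are smooth, and are integral curves. -/
theorem IsWeakIntegralCurve.contMDiffOn {R : N → EN n} {z : ℝ → N} (hz : IsWeakIntegralCurve R z)
    (hR : SmoothDerivation R) :
    ContMDiffOn 𝓘(ℝ, ℝ) (𝓡 (2 * n - 1)) ∞ z (Icc 0 1) ∧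
    ∀ t ∈ Icc (0 : ℝ) 1, (velocityWithin (𝓡 (2 * n - 1)) z (Icc 0 1) t : EN n) = R (z t) := by
  have key : ∀ t ∈ Icc (0 : ℝ) 1,
      ContDiffWithinAt ℝ ∞ (extChartAt (𝓡 (2 * n - 1)) (z t) ∘ z) (Icc 0 1) t ∧
      HasDerivWithinAt (extChartAt (𝓡 (2 * n - 1)) (z t) ∘ z) (R (z t)) (Icc 0 1) t := by
    intro t ht
    set φ := extChartAt (𝓡 (2 * n - 1)) (z t) with hφ
    let f : SmoothBumpFunction (𝓡 (2 * n - 1)) (z t) := Classical.arbitrary _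
    have hG : ContMDiff (𝓡 (2 * n - 1)) 𝓘(ℝ, EN n) ∞ (fun x => f x • φ x) :=
      f.contMDiff_smul (contMDiffOn_extChartAt.mono (by simp))
    have hGi : ∀ i, ContMDiff (𝓡 (2 * n - 1)) 𝓘(ℝ, ℝ) ∞ (fun x => (f x • φ x) i) := fun i =>
      (EuclideanSpace.proj (𝕜 := ℝ) i).contDiff.contMDiff.comp hG
    have hone : ∀ᶠ x in 𝓝 (z t), f x • φ x = φ x := by
      filter_upwards [f.eventuallyEq_one] with x hx
      rw [hx]; simp
    have hev : (φ ∘ z) =ᶠ[𝓝[Icc 0 1] t] fun τ => f (z τ) • φ (z τ) := by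
      filter_upwards [(hz.continuousOn t ht).eventually hone] with τ hτ
      exact hτ.symm
    have hev0 : (φ ∘ z) t = f (z t) • φ (z t) := hone.self_of_nhds.symm
    have hdN : ∀ i, dN (fun x => (f x • φ x) i) (z t) (R (z t)) = R (z t) i := by
      intro i
      have h1 : HasMFDerivAt (𝓡 (2 * n - 1)) 𝓘(ℝ, EN n) φ (z t) (ContinuousLinearMap.id ℝ (EN n)) := by
        have := (mdifferentiableAt_extChartAt (I := 𝓡 (2 * n - 1))
          (mem_chart_source _ (z t))).hasMFDerivAt
        rw [mfderiv_extChartAt_self] at this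
        exact this
      have h2 : HasMFDerivAt (𝓡 (2 * n - 1)) 𝓘(ℝ, ℝ) (fun x => (φ x) i) (z t)
          ((EuclideanSpace.proj (𝕜 := ℝ) i).comp (ContinuousLinearMap.id ℝ (EN n))) :=
        HasMFDerivAt.comp (z t) ((EuclideanSpace.proj (𝕜 := ℝ) i).hasMFDerivAt) h1
      have h3 := (h2.congr_of_eventuallyEq (f₁ := fun x => (f x • φ x) i)
        (hone.mono fun x hx => by simp only [hx])).mfderiv
      exact DFunLike.congr_fun h3 (R (z t))
    constructor
    · refine ContDiffWithinAt.congr_of_eventuallyEq ?_ hev hev0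
      exact (contDiffOn_euclidean.2 fun i => hz.contDiffOn hR (hGi i)) t ht
    · refine HasDerivWithinAt.congr_of_eventuallyEq ?_ hev hev0
      rw [hasDerivWithinAt_iff_hasFDerivWithinAt]
      refine hasFDerivWithinAt_euclidean.2 fun i => ?_
      have := hz _ (hGi i) t ht
      rw [hdN i] at this
      refine this.hasFDerivWithinAt.congr_fderiv ?_
      ext1; simp
  constructor
  · intro t ht
    rw [contMDiffWithinAt_iff_target]
    exact ⟨hz.continuousOn t ht, (key t ht).1.contMDiffWithinAt⟩
  · intro t ht
    have h1 : HasMFDerivWithinAt 𝓘(ℝ, ℝ) (𝓡 (2 * n - 1)) z (Icc 0 1) t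
        ((1 : ℝ →L[ℝ] ℝ).smulRight (R (z t))) := by
      refine ⟨hz.continuousOn t ht, ?_⟩
      have h2 := (key t ht).2.hasFDerivWithinAt
      have h3 : (ContinuousLinearMap.toSpanSingleton ℝ (R (z t))) = ((1 : ℝ →L[ℝ] ℝ).smulRight (R (z t))) := by
        ext1; simp
      rw [h3] at h2
      exact h2.mono inter_subset_left
    have h4 := h1.mfderivWithin ((uniqueDiffOn_Icc one_pos).uniqueMDiffOn t ht)
    change (mfderivWithin 𝓘(ℝ, ℝ) (𝓡 (2 * n - 1)) z (Icc 0 1) t : ℝ →L[ℝ] EN n) 1 = R (z t)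
    have h5 : (mfderivWithin 𝓘(ℝ, ℝ) (𝓡 (2 * n - 1)) z (Icc 0 1) t : ℝ →L[ℝ] EN n) =
      (1 : ℝ →L[ℝ] ℝ).smulRight (R (z t)) := h4
    rw [h5]; exact one_smul ℝ (R (z t))

/-- A weak integral curve of the Reeb vector field on `[0, 1]` with end points on the Legendrian is a
Reeb chord of action `1`. -/
theorem one_mem_actionSpectrum {μ : OneForm (𝓡 (2 * n - 1)) (M := N)} {R : N → EN n}
    (hReeb : ∀ z, IsReebVector μ z (R z)) (hR : SmoothDerivation R) {z : ℝ → N}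
    (hz : IsWeakIntegralCurve R z) (h0 : z 0 ∈ Q.bdryLag) (h1 : z 1 ∈ Q.bdryLag) :
    (1 : ℝ) ∈ Q.actionSpectrum μ := by
  obtain ⟨hs, hv⟩ := hz.contMDiffOn hR
  have hre : ∀ t ∈ Icc (0 : ℝ) 1, IsReebVector μ (z t) (velocityWithin (𝓡 (2 * n - 1)) z (Icc 0 1) t) := by
    intro t ht
    have h2 : velocityWithin (𝓡 (2 * n - 1)) z (Icc 0 1) t = R (z t) := hv t ht
    rw [h2]; exact hReeb _
  refine ⟨1, z, one_pos, hs, h0, h1, hre, ?_⟩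
  have : ∫ t in (0 : ℝ)..1, μ (z t) (velocityWithin (𝓡 (2 * n - 1)) z (Icc 0 1) t) =
      ∫ t in (0 : ℝ)..1, (1 : ℝ) := by
    refine intervalIntegral.integral_congr fun t ht => ?_
    rw [uIcc_of_le zero_le_one] at ht
    exact (hre t ht).2
  rw [this]; simp

end

/-- If the derivative of `h` is within `B` of the constant `c`, up to an integrable error, then `h` is
close to a linear function of slope `c`. -/
theorem abs_sub_sub_le_of_deriv {h h' err : ℝ → ℝ} {B E₀ c : ℝ} (herr : ContinuousOn err (Icc 0 1))
    (herr0 : ∀ t ∈ Icc (0 : ℝ) 1, 0 ≤ err t)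
    (hE : ∫ t in (0 : ℝ)..1, err t ≤ E₀)
    (hh : ∀ t ∈ Icc (0 : ℝ) 1, HasDerivWithinAt h (h' t) (Icc 0 1) t) {s t : ℝ}
    (hs : 0 ≤ s) (hst : s ≤ t) (ht : t ≤ 1)
    (hB : ∀ τ ∈ Icc s t, |h' τ - c| ≤ B + err τ) :
    |h t - h s - c * (t - s)| ≤ B * (t - s) + E₀ := by
  have hsub : Icc s t ⊆ Icc 0 1 := Icc_subset_Icc hs ht
  have hd : ∀ τ ∈ Ioo s t, HasDerivAt (fun τ => h τ - c * τ) (h' τ - c) τ := by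
    intro τ hτ
    have h1 := (hh τ (hsub (Ioo_subset_Icc_self hτ))).hasDerivAt
      (Icc_mem_nhds (hs.trans_lt hτ.1) (hτ.2.trans_le ht))
    exact h1.sub (((hasDerivAt_id τ).const_mul c).congr_deriv (mul_one c))
  have hi : IntervalIntegrable err MeasureTheory.volume s t :=
    (herr.mono (by rw [uIcc_of_le hst]; exact hsub)).intervalIntegrable
  have h2 := norm_sub_le_integral_of_norm_deriv_le_of_le (f := fun τ => h τ - c * τ)
    (B := fun τ => B + err τ) hst
    (fun τ hτ => ((hh τ (hsub hτ)).continuousWithinAt.mono hsub).sub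
      (by fun_prop))
    (fun τ hτ => (hd τ hτ).differentiableAt.differentiableWithinAt)
    (Eventually.of_forall fun τ hτ => by
      rw [(hd τ hτ).deriv]; exact hB τ (Ioo_subset_Icc_self hτ))
    ((continuous_const.intervalIntegrable _ _).add hi)
  rw [intervalIntegral.integral_add (continuous_const.intervalIntegrable _ _) hi,
    intervalIntegral.integral_const, Real.norm_eq_abs] at h2
  have h3 : ∫ τ in s..t, err τ ≤ ∫ τ in (0 : ℝ)..1, err τ := by
    refine intervalIntegral.integral_mono_interval hs hst ht ?_
      (by rw [← uIcc_of_le zero_le_one] at herr; exact herr.intervalIntegrable)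
    refine (MeasureTheory.ae_restrict_iff' measurableSet_Ioc).2 (Eventually.of_forall fun τ hτ => ?_)
    exact herr0 τ (Ioc_subset_Icc_self hτ)
  have h4 : h t - c * t - (h s - c * s) = h t - h s - c * (t - s) := by ring
  rw [h4, smul_eq_mul] at h2
  linarith

/-- Curves that are integral curves of `R` up to an error that tends to zero in `L²` converge pointwise,
along an ultrafilter, to a weak integral curve. Pointwise limits exist because `N` is compact, and
the equation passes to the limit because its integral form has a second order error bound that
does not depend on the curve. -/
theorem exists_limit_weakIntegralCurve [CompactSpace N] {R : N → EN n} (hR : SmoothDerivation R)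
    {z : ℕ → ℝ → N} {e : ℕ → ℝ → ℝ} {E₀ : ℝ} (he : ∀ k, ContinuousOn (e k) (Icc 0 1))
    (he0 : ∀ k, ∀ t ∈ Icc (0 : ℝ) 1, 0 ≤ e k t) (hE : ∀ k, ∫ t in (0 : ℝ)..1, e k t ≤ E₀)
    (hz : ∀ g : N → ℝ, ContMDiff (𝓡 (2 * n - 1)) 𝓘(ℝ, ℝ) ∞ g → ∃ c : ℝ, 0 ≤ c ∧ ∀ k,
      ∃ d : ℝ → ℝ, ∀ t ∈ Icc (0 : ℝ) 1, HasDerivWithinAt (fun τ => g (z k τ)) (d t) (Icc 0 1) t ∧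
        (d t - dN g (z k t) (R (z k t))) ^ 2 ≤ c / (k + 1) * e k t) :
    ∃ z' : ℝ → N, IsWeakIntegralCurve R z' ∧
      ∀ t, ∀ F : Set N, IsClosed F → (∀ k, z k t ∈ F) → z' t ∈ F := by
  let U : Ultrafilter ℕ := hyperfilter ℕ
  let z' : ℝ → N := fun t => (U.map fun k => z k t).lim
  have hlim : ∀ t, Tendsto (fun k => z k t) U (𝓝 (z' t)) := fun t => Ultrafilter.le_nhds_lim _
  have hE0 : 0 ≤ E₀ := (intervalIntegral.integral_nonneg zero_le_one (he0 0)).trans (hE 0)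
  -- the error in the integral form of the equation
  have step0 : ∀ g : N → ℝ, ContMDiff (𝓡 (2 * n - 1)) 𝓘(ℝ, ℝ) ∞ g → ∀ ε > 0, ∀ᶠ k in atTop,
      ∀ B a s t, 0 ≤ s → s ≤ t → t ≤ 1 →
        (∀ τ ∈ Icc s t, |dN g (z k τ) (R (z k τ)) - a| ≤ B) →
        |g (z k t) - g (z k s) - a * (t - s)| ≤ B * (t - s) + ε := by
    intro g hg ε hε
    obtain ⟨c, hc, h⟩ := hz g hg
    have hlarge : ∀ᶠ k : ℕ in atTop, c * E₀ / (2 * ε) / (k + 1) ≤ ε / 2 := by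
      have : Tendsto (fun k : ℕ => c * E₀ / (2 * ε) / ((k : ℝ) + 1)) atTop (𝓝 0) :=
        tendsto_const_nhds.div_atTop (tendsto_atTop_add_const_right _ _ tendsto_natCast_atTop_atTop)
      exact this.eventually_le_const (by positivity)
    filter_upwards [hlarge] with k hk B a s t hs hst ht hB
    obtain ⟨d, hd⟩ := h k
    have hk0 : (0 : ℝ) < k + 1 := by positivity
    refine abs_sub_sub_le_of_deriv (err := fun τ => ε / 2 + c / (2 * ε * (k + 1)) * e k τ)
      (h' := d) (h := fun τ => g (z k τ)) ?_ ?_ ?_ (fun τ hτ => (hd τ hτ).1) hs hst ht ?_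
    · exact continuousOn_const.add (continuousOn_const.mul (he k))
    · intro τ hτ
      have := he0 k τ hτ
      positivity
    · have hi : IntervalIntegrable (e k) MeasureTheory.volume 0 1 :=
        ((he k).mono (by rw [uIcc_of_le zero_le_one])).intervalIntegrable
      rw [intervalIntegral.integral_add (continuous_const.intervalIntegrable _ _) (hi.const_mul _),
        intervalIntegral.integral_const, intervalIntegral.integral_const_mul]
      have h1 : c / (2 * ε * (k + 1)) * ∫ τ in (0 : ℝ)..1, e k τ ≤ c / (2 * ε * (k + 1)) * E₀ :=
        mul_le_mul_of_nonneg_left (hE k) (by positivity)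
      have h2 : c / (2 * ε * (k + 1)) * E₀ = c * E₀ / (2 * ε) / (k + 1) := by
        field_simp
      simp only [sub_zero, smul_eq_mul, one_mul]
      linarith
    · intro τ hτ
      have hτ' : τ ∈ Icc (0 : ℝ) 1 := Icc_subset_Icc hs ht hτ
      have h1 := (hd τ hτ').2
      have h2 : |d τ - dN g (z k τ) (R (z k τ))| ≤ ε / 2 + c / (2 * ε * (k + 1)) * e k τ := by
        set x := d τ - dN g (z k τ) (R (z k τ))
        -- the inequality between the arithmetic and the geometric mean
        have h3 : |x| ≤ ε / 2 + x ^ 2 / (2 * ε) := by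
          rw [← sq_abs]
          have : 0 ≤ (|x| - ε) ^ 2 / (2 * ε) := by positivity
          have h4 : (|x| - ε) ^ 2 / (2 * ε) = ε / 2 + |x| ^ 2 / (2 * ε) - |x| := by field_simp; ring
          linarith
        have h5 : x ^ 2 / (2 * ε) ≤ c / (k + 1) * e k τ / (2 * ε) :=
          div_le_div_of_nonneg_right h1 (by positivity)
        have h6 : c / (k + 1) * e k τ / (2 * ε) = c / (2 * ε * (k + 1)) * e k τ := by field_simp
        linarith
      calc |d τ - a| ≤ |dN g (z k τ) (R (z k τ)) - a| + |d τ - dN g (z k τ) (R (z k τ))| := by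
            rw [add_comm]; exact abs_sub_le _ _ _
        _ ≤ _ := by
            have := hB τ hτ
            linarith
  have hbd : ∀ g : N → ℝ, ContMDiff (𝓡 (2 * n - 1)) 𝓘(ℝ, ℝ) ∞ g → ∃ B, 0 ≤ B ∧ ∀ y, |g y| ≤ B := by
    intro g hg
    obtain ⟨B, hB⟩ := isCompact_univ.exists_bound_of_continuousOn hg.continuous.continuousOn
    exact ⟨max B 0, le_max_right _ _, fun y => (hB y (mem_univ _)).trans (le_max_left _ _)⟩
  -- the approximate equation to second order
  have step : ∀ g : N → ℝ, ContMDiff (𝓡 (2 * n - 1)) 𝓘(ℝ, ℝ) ∞ g → ∃ B, 0 ≤ B ∧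
      ∀ s t, 0 ≤ s → s ≤ t → t ≤ 1 → ∀ r ∈ Icc s t,
        |g (z' t) - g (z' s) - dN g (z' r) (R (z' r)) * (t - s)| ≤ B * (t - s) ^ 2 := by
    intro g hg
    have hg1 := hR g hg
    obtain ⟨B, hB0, hB⟩ := hbd _ (hR _ hg1)
    refine ⟨B, hB0, fun s t hs hst ht r hr => ?_⟩
    have hts : 0 ≤ t - s := sub_nonneg.2 hst
    refine le_of_forall_pos_le_add fun ε hε => ?_
    have hev : ∀ᶠ k in (U : Filter ℕ), |g (z k t) - g (z k s) - dN g (z k r) (R (z k r)) * (t - s)| ≤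
        B * (t - s) ^ 2 + ε := by
      refine Filter.Eventually.filter_mono Nat.hyperfilter_le_atTop ?_
      filter_upwards [step0 g hg (ε / 2) (by positivity),
        step0 _ hg1 (ε / 2) (by positivity)] with k h1 h2
      have h3 : ∀ τ ∈ Icc s t, |dN g (z k τ) (R (z k τ)) - dN g (z k r) (R (z k r))| ≤
          B * (t - s) + ε / 2 := by
        intro τ hτ
        have h4 : ∀ τ₁ τ₂, s ≤ τ₁ → τ₁ ≤ τ₂ → τ₂ ≤ t →
            |dN g (z k τ₂) (R (z k τ₂)) - dN g (z k τ₁) (R (z k τ₁))| ≤ B * (t - s) + ε / 2 := by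
          intro τ₁ τ₂ h5 h6 h7
          have h8 := h2 B 0 τ₁ τ₂ (hs.trans h5) h6 (h7.trans ht) (fun τ _ => by
            rw [sub_zero]; exact hB _)
          rw [zero_mul, sub_zero] at h8
          refine h8.trans ?_
          have : B * (τ₂ - τ₁) ≤ B * (t - s) := mul_le_mul_of_nonneg_left (by linarith) hB0
          linarith
        rcases le_total τ r with h5 | h5
        · rw [abs_sub_comm]; exact h4 τ r hτ.1 h5 hr.2
        · exact h4 r τ hr.1 h5 hτ.2
      have h4 := h1 (B * (t - s) + ε / 2) (dN g (z k r) (R (z k r))) s t hs hst ht h3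
      refine h4.trans ?_
      have h5 : t - s ≤ 1 := by linarith
      nlinarith
    have hgl : ∀ τ, Tendsto (fun k => g (z k τ)) U (𝓝 (g (z' τ))) := fun τ =>
      (hg.continuous.tendsto _).comp (hlim τ)
    have hgl1 : Tendsto (fun k => dN g (z k r) (R (z k r))) U (𝓝 (dN g (z' r) (R (z' r)))) :=
      (hg1.continuous.tendsto _).comp (hlim r)
    exact le_of_tendsto (((hgl t).sub (hgl s)).sub (hgl1.mul_const _)).abs hev
  refine ⟨z', fun g hg t ht => ?_, fun t F hF h =>
    hF.mem_of_tendsto (hlim t) (Eventually.of_forall h)⟩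
  obtain ⟨B, hB0, hB⟩ := step g hg
  rw [hasDerivWithinAt_iff_isLittleO]
  have h1 : (fun τ => g (z' τ) - g (z' t) - (τ - t) • dN g (z' t) (R (z' t))) =O[𝓝[Icc 0 1] t]
      fun τ => (τ - t) ^ 2 := by
    refine Asymptotics.IsBigO.of_bound B ?_
    filter_upwards [self_mem_nhdsWithin] with τ hτ
    rw [Real.norm_eq_abs, Real.norm_eq_abs, abs_of_nonneg (sq_nonneg (τ - t)), smul_eq_mul, mul_comm (τ - t)]
    rcases le_total t τ with h | h
    · exact hB t τ ht.1 h hτ.2 t ⟨le_rfl, h⟩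
    · have := hB τ t hτ.1 h ht.2 t ⟨h, le_rfl⟩
      rw [← abs_neg, show (τ - t) ^ 2 = (t - τ) ^ 2 by ring]
      convert this using 2
      ring
  refine h1.trans_isLittleO ?_
  have h2 : (fun τ : ℝ => (τ - t) ^ 2) =o[𝓝 t] fun τ => τ - t := by
    have := (Asymptotics.isLittleO_pow_id (𝕜 := ℝ) (n := 2) one_lt_two)
    have h3 : Tendsto (fun τ : ℝ => τ - t) (𝓝 t) (𝓝 0) := by
      have : Continuous fun τ : ℝ => τ - t := by fun_prop
      simpa using this.tendsto t
    exact this.comp_tendsto h3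
  exact h2.mono inf_le_left

end

/-! ### Families of Hamiltonians and almost complex structures -/

section

theorem SmoothACSFamily.contMDiffOn_Jv {C : Completion Q W} {J : ℝ → ℝ → C.CompatibleACS}
    (hJ : SmoothACSFamily J) {EP : Type*} [NormedAddCommGroup EP] [NormedSpace ℝ EP]
    {HP : Type*} [TopologicalSpace HP] {IP : ModelWithCorners ℝ EP HP}
    {P : Type*} [TopologicalSpace P] [ChartedSpace HP P] {σ τ : P → ℝ} {x : P → W}
    {v : P → EW n} {S : Set P} (hτ : ∀ p ∈ S, τ p ∈ Icc (0 : ℝ) 1)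
    (hσc : ContMDiffOn IP 𝓘(ℝ, ℝ) ∞ σ S) (hτc : ContMDiffOn IP 𝓘(ℝ, ℝ) ∞ τ S)
    (hx : ContMDiffOn IP (𝓡 (2 * n)) ∞ x S)
    (hv : ContMDiffOn IP (𝓡 (2 * n)).tangent ∞
      (fun p => (⟨x p, v p⟩ : TangentBundle (𝓡 (2 * n)) W)) S) :
    ContMDiffOn IP (𝓡 (2 * n)).tangent ∞ (fun p =>
      (⟨x p, (J (σ p) (τ p)).Jv (x p) (v p)⟩ : TangentBundle (𝓡 (2 * n)) W)) S := by
  have h3 := ContMDiffOn.comp (f := fun p => (σ p, τ p, x p)) hJ (hσc.prodMk (hτc.prodMk hx))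
    (fun p hp => ⟨mem_univ _, hτ p hp, mem_univ _⟩)
  exact ContMDiffOn.clm_bundle_apply (F₁ := EW n) (F₂ := EW n)
    (E₁ := fun q : W => TangentSpace (𝓡 (2 * n)) q) (E₂ := fun q : W => TangentSpace (𝓡 (2 * n)) q)
    h3 hv

/-- A smooth family of Hamiltonians and almost complex structures of contact type, with one compact set
for all parameters, that is constant for `s ≤ -s₀` and for `s ≥ s₀`, and such that the Hamiltonians do
not decrease and `1` is not in the action spectra at the two ends. It covers both a fixed admissible
Hamiltonian and a monotone homotopy. -/
structure FloerFamily (C : Completion Q W) where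
  /-- The compact set outside of which everything is of contact type. -/
  K : Set W
  /-- The Hamiltonians. -/
  H : ℝ → W → ℝ
  /-- The slopes of the Hamiltonians. -/
  a : ℝ → N → ℝ
  /-- The constants of the Hamiltonians. -/
  b : ℝ → ℝ
  /-- The almost complex structures. -/
  J : ℝ → ℝ → C.CompatibleACS
  s₀ : ℝ
  s₀_pos : 0 < s₀
  smooth_H : ContMDiff (𝓘(ℝ, ℝ).prod (𝓡 (2 * n))) 𝓘(ℝ, ℝ) ∞ (fun p : ℝ × W => H p.1 p.2)
  ham : ∀ s, C.IsContactTypeHam K (a s) (b s) (H s)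
  smooth_J : SmoothACSFamily J
  acs : ∀ s, ∀ t ∈ Icc (0 : ℝ) 1, (J s t).IsContactType K (a s)
  H_left : ∀ s ≤ -s₀, H s = H (-s₀)
  H_right : ∀ s ≥ s₀, H s = H s₀
  J_left : ∀ s ≤ -s₀, ∀ t ∈ Icc (0 : ℝ) 1, J s t = J (-s₀) t
  J_right : ∀ s ≥ s₀, ∀ t ∈ Icc (0 : ℝ) 1, J s t = J s₀ t
  monotone : ∀ s x, 0 ≤ deriv (fun σ => H σ x) s
  spectrum_left : (1 : ℝ) ∉ Q.actionSpectrum (Q.scaledLam (a (-s₀)))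
  spectrum_right : (1 : ℝ) ∉ Q.actionSpectrum (Q.scaledLam (a s₀))

namespace FloerFamily

variable {C : Completion Q W} (F : FloerFamily C)

/-- The projection of the parameter `s` to `[-s₀, s₀]`, which does not change the member of the family. -/
def clamp (s : ℝ) : ℝ := max (-F.s₀) (min s F.s₀)

theorem clamp_mem (s : ℝ) : F.clamp s ∈ Icc (-F.s₀) F.s₀ :=
  ⟨le_max_left _ _, max_le (by linarith [F.s₀_pos]) (min_le_right _ _)⟩

theorem clamp_of_le {s : ℝ} (h : s ≤ -F.s₀) : F.clamp s = -F.s₀ :=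
  max_eq_left ((min_le_left _ _).trans h)

theorem clamp_of_ge {s : ℝ} (h : F.s₀ ≤ s) : F.clamp s = F.s₀ := by
  rw [clamp, min_eq_right h, max_eq_right (by linarith [F.s₀_pos])]

theorem clamp_of_mem {s : ℝ} (h : s ∈ Icc (-F.s₀) F.s₀) : F.clamp s = s := by
  rw [clamp, min_eq_left h.2, max_eq_right h.1]

theorem clamp_cases (s : ℝ) : s ≤ -F.s₀ ∨ F.s₀ ≤ s ∨ s ∈ Icc (-F.s₀) F.s₀ := by
  rcases le_total s (-F.s₀) with h | h
  · exact Or.inl h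
  · rcases le_total F.s₀ s with h' | h'
    · exact Or.inr (Or.inl h')
    · exact Or.inr (Or.inr ⟨h, h'⟩)

theorem H_clamp (s : ℝ) : F.H s = F.H (F.clamp s) := by
  rcases F.clamp_cases s with h | h | h
  · rw [F.clamp_of_le h, F.H_left s h]
  · rw [F.clamp_of_ge h, F.H_right s h]
  · rw [F.clamp_of_mem h]

theorem J_clamp (s : ℝ) {t : ℝ} (ht : t ∈ Icc (0 : ℝ) 1) : F.J s t = F.J (F.clamp s) t := by
  rcases F.clamp_cases s with h | h | h
  · rw [F.clamp_of_le h, F.J_left s h t ht]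
  · rw [F.clamp_of_ge h, F.J_right s h t ht]
  · rw [F.clamp_of_mem h]

variable [T2Space W]

/-- A level such that all points of the cylindrical part with `ρ > R₀` are outside `K`. -/
def R₀ : ℝ := (C.exists_bound_of_isCompact (F.J 0 0) (F.ham 0).core.1).choose

theorem one_le_R₀ : 1 ≤ F.R₀ :=
  (C.exists_bound_of_isCompact (F.J 0 0) (F.ham 0).core.1).choose_spec.1

theorem cyl_notMem {z : N} {ρ : ℝ} (h : F.R₀ < ρ) : C.cyl z ρ ∉ F.K :=
  (C.exists_bound_of_isCompact (F.J 0 0) (F.ham 0).core.1).choose_spec.2 z ρ h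

theorem H_cyl (s : ℝ) {z : N} {ρ : ℝ} (h : F.R₀ < ρ) : F.H s (C.cyl z ρ) = F.a s z * ρ + F.b s :=
  (F.ham s).eq z ρ (by linarith [F.one_le_R₀]) (F.cyl_notMem h)

/-- The slope is a difference of two values of the Hamiltonian, hence smooth in all variables. -/
theorem a_eq (s : ℝ) (z : N) :
    F.a s z = F.H s (C.cyl z (F.R₀ + 2)) - F.H s (C.cyl z (F.R₀ + 1)) := by
  rw [F.H_cyl s (by linarith), F.H_cyl s (by linarith)]; ring

theorem b_eq (s : ℝ) (z : N) : F.b s = (F.R₀ + 2) * F.H s (C.cyl z (F.R₀ + 1)) -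
    (F.R₀ + 1) * F.H s (C.cyl z (F.R₀ + 2)) := by
  rw [F.H_cyl s (by linarith), F.H_cyl s (by linarith)]; ring

theorem a_clamp (s : ℝ) : F.a s = F.a (F.clamp s) := by
  ext z
  rw [F.a_eq, F.a_eq, ← F.H_clamp]

theorem contMDiff_cyl {ρ : ℝ} (hρ : 0 < ρ) :
    ContMDiff (𝓡 (2 * n - 1)) (𝓡 (2 * n)) ∞ (fun z => C.cyl z ρ) := fun z =>
  ContMDiffAt.comp (f := fun z : N => (z, ρ)) z (C.contMDiffAt_cyl hρ)
    (contMDiffAt_id.prodMk contMDiffAt_const)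

theorem contMDiff_a : ContMDiff (𝓘(ℝ, ℝ).prod (𝓡 (2 * n - 1))) 𝓘(ℝ, ℝ) ∞
    (fun p : ℝ × N => F.a p.1 p.2) := by
  have h : ∀ ρ > 0, ContMDiff (𝓘(ℝ, ℝ).prod (𝓡 (2 * n - 1))) 𝓘(ℝ, ℝ) ∞
      (fun p : ℝ × N => F.H p.1 (C.cyl p.2 ρ)) := fun ρ hρ =>
    ContMDiff.comp (f := fun p : ℝ × N => (p.1, C.cyl p.2 ρ)) F.smooth_H
      (contMDiff_fst.prodMk ((contMDiff_cyl hρ).comp contMDiff_snd))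
  have h1 := F.one_le_R₀
  exact ((h (F.R₀ + 2) (by linarith)).sub (h (F.R₀ + 1) (by linarith))).congr
    fun p => F.a_eq p.1 p.2

/-- The logarithmic derivative `∂_s log a` of the slope with respect to the parameter. -/
def G (s : ℝ) (z : N) : ℝ := deriv (fun σ => F.a σ z) s / F.a s z

theorem a_pos (s : ℝ) (z : N) : 0 < F.a s z := (F.ham s).slope_pos z

theorem contMDiff_G : ContMDiff (𝓘(ℝ, ℝ).prod (𝓡 (2 * n - 1))) 𝓘(ℝ, ℝ) ∞
    (fun p : ℝ × N => F.G p.1 p.2) := by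
  have h1 := contMDiffOn_deriv_slice isOpen_univ (F.contMDiff_a.contMDiffOn (s := univ ×ˢ univ))
  rw [univ_prod_univ, contMDiffOn_univ] at h1
  exact h1.div₀ F.contMDiff_a fun p => (F.a_pos p.1 p.2).ne'

/-- Outside `[-s₀, s₀]` the family is locally constant. -/
theorem eventually_clamp {s : ℝ} (hs : s < -F.s₀ ∨ F.s₀ < s) :
    ∀ᶠ σ in 𝓝 s, F.clamp σ = F.clamp s := by
  rcases hs with h | h
  · filter_upwards [eventually_lt_nhds h] with σ hσ
    rw [F.clamp_of_le hσ.le, F.clamp_of_le h.le]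
  · filter_upwards [eventually_gt_nhds h] with σ hσ
    rw [F.clamp_of_ge hσ.le, F.clamp_of_ge h.le]

theorem deriv_eq_zero_of_clamp {g : ℝ → ℝ} (hg : ∀ s, g s = g (F.clamp s)) {s : ℝ}
    (hs : s < -F.s₀ ∨ F.s₀ < s) : deriv g s = 0 := by
  have : g =ᶠ[𝓝 s] fun _ => g s := by
    filter_upwards [F.eventually_clamp hs] with σ hσ
    rw [hg σ, hσ, ← hg s]
  rw [this.deriv_eq, deriv_const]

theorem G_eq_zero {s : ℝ} (hs : s < -F.s₀ ∨ F.s₀ < s) : F.G s = 0 := by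
  ext z
  rw [G, F.deriv_eq_zero_of_clamp (fun σ => by rw [F.a_clamp]) hs, zero_div]; rfl

theorem deriv_G_eq_zero {s : ℝ} (hs : s < -F.s₀ ∨ F.s₀ < s) (z : N) :
    deriv (fun σ => F.G σ z) s = 0 := by
  have : (fun σ => F.G σ z) =ᶠ[𝓝 s] fun _ => 0 := by
    have h1 : ∀ᶠ σ in 𝓝 s, σ < -F.s₀ ∨ F.s₀ < σ :=
      (isOpen_Iio.union isOpen_Ioi).mem_nhds hs
    filter_upwards [h1] with σ hσ
    rw [F.G_eq_zero hσ]; rfl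
  rw [this.deriv_eq, deriv_const]

/-- The Hamiltonians without their constants. On the end, `r = a(z) ρ`. -/
def r (s : ℝ) (x : W) : ℝ := F.H s x - F.b s

theorem r_cyl (s : ℝ) {z : N} {ρ : ℝ} (h : F.R₀ < ρ) : F.r s (C.cyl z ρ) = F.a s z * ρ := by
  rw [r, F.H_cyl s h]; ring

section Nonempty
variable [Nonempty N]

theorem b_clamp (s : ℝ) : F.b s = F.b (F.clamp s) := by
  rw [F.b_eq s (Classical.arbitrary N), F.b_eq (F.clamp s) (Classical.arbitrary N), ← F.H_clamp]

theorem r_clamp (s : ℝ) : F.r s = F.r (F.clamp s) := by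
  ext x
  rw [r, r, ← F.H_clamp, ← F.b_clamp]

theorem contDiff_b : ContDiff ℝ ∞ F.b := by
  have h : ∀ x : W, ContDiff ℝ ∞ (fun s => F.H s x) := fun x =>
    (ContMDiff.comp (f := fun s : ℝ => (s, x)) F.smooth_H
      (contMDiff_id.prodMk contMDiff_const)).contDiff
  have : F.b = fun s => (F.R₀ + 2) * F.H s (C.cyl (Classical.arbitrary N) (F.R₀ + 1)) -
    (F.R₀ + 1) * F.H s (C.cyl (Classical.arbitrary N) (F.R₀ + 2)) :=
    funext fun s => F.b_eq s _
  rw [this]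
  exact (contDiff_const.mul (h _)).sub (contDiff_const.mul (h _))

theorem contMDiff_r : ContMDiff (𝓘(ℝ, ℝ).prod (𝓡 (2 * n))) 𝓘(ℝ, ℝ) ∞
    (fun p : ℝ × W => F.r p.1 p.2) :=
  F.smooth_H.sub (F.contDiff_b.contMDiff.comp contMDiff_fst)

theorem dW_r (s : ℝ) (x : W) : dW (n := n) (F.r s) x = dW (F.H s) x := by
  have h1 : MDifferentiableAt (𝓡 (2 * n)) 𝓘(ℝ, ℝ) (F.H s) x :=
    (F.ham s).smooth.mdifferentiableAt (by simp)
  have h2 := h1.hasMFDerivAt.sub (hasMFDerivAt_const (I := 𝓡 (2 * n)) (F.b s) x)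
  have h3 : mfderiv (𝓡 (2 * n)) 𝓘(ℝ, ℝ) (F.r s) x = _ := h2.mfderiv
  ext v
  have := congrArg (fun D : EW n →L[ℝ] ℝ => D v) h3
  refine Eq.trans this ?_
  change dW (F.H s) x v - 0 = _
  rw [sub_zero]

/-- A base point in the region where everything is of contact type. -/
def basePoint : W := C.cyl (Classical.arbitrary N) (F.R₀ + 1)

/-- The constant `c⁻¹` of the almost complex structure, recovered from `λ(J X) = c⁻¹ r` at the base point,
which shows its smooth dependence on the parameters. -/
def m (s t : ℝ) : ℝ := C.lamv F.basePoint ((F.J s t).Jv F.basePoint (C.Xv F.basePoint)) /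
  F.r s F.basePoint

theorem m_clamp (s : ℝ) {t : ℝ} (ht : t ∈ Icc (0 : ℝ) 1) : F.m s t = F.m (F.clamp s) t := by
  rw [m, m, ← F.r_clamp, ← F.J_clamp s ht]

theorem exists_conicalAt (s : ℝ) {t : ℝ} (ht : t ∈ Icc (0 : ℝ) 1) : 0 < F.m s t ∧
    ∃ q : N → EN n → ℝ, ∀ z ρ, F.R₀ < ρ →
      (∃ R, IsReebVector (Q.scaledLam (F.a s)) z R) ∧
      (F.J s t).ConicalAt (F.H s) (C.cyl z ρ) (F.m s t)⁻¹ (F.a s z * ρ) ∧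
      ∀ w, (F.J s t).nsq (C.cyl z ρ) (C.lift (F.a s) z ρ w) = F.a s z * ρ * q z w := by
  obtain ⟨c, hc, q, hq⟩ := (F.ham s).exists_norm_form (F.acs s t ht)
  have h1 := F.one_le_R₀
  have key : ∀ z ρ, F.R₀ < ρ →
      (F.J s t).ConicalAt (F.H s) (C.cyl z ρ) c (F.a s z * ρ) := fun z ρ hρ =>
    ⟨mul_pos (F.a_pos s z) (by linarith), hc, fun v => C.Om_Xv (F.J s t) (by linarith) v,
      (F.ham s).dW_Xv (by linarith) (F.cyl_notMem hρ), (hq z ρ (by linarith) (F.cyl_notMem hρ)).2.1⟩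
  have hm : F.m s t = c⁻¹ := by
    have h2 := (key (Classical.arbitrary N) (F.R₀ + 1) (by linarith))
    rw [m, basePoint, h2.lamv_Jv_Xv, F.r_cyl s (by linarith), mul_div_cancel_right₀ _ h2.r_pos.ne']
  rw [hm, inv_inv]
  exact ⟨inv_pos.2 hc, q, fun z ρ hρ => ⟨(hq z ρ (by linarith) (F.cyl_notMem hρ)).1, key z ρ hρ,
    (hq z ρ (by linarith) (F.cyl_notMem hρ)).2.2⟩⟩

theorem m_pos (s : ℝ) {t : ℝ} (ht : t ∈ Icc (0 : ℝ) 1) : 0 < F.m s t :=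
  (F.exists_conicalAt s ht).1

theorem contDiffOn_m : ContDiffOn ℝ ∞ (fun p : ℝ × ℝ => F.m p.1 p.2) (univ ×ˢ Icc 0 1) := by
  rw [← contMDiffOn_iff_contDiffOn]
  have h1 : ContMDiffOn 𝓘(ℝ, ℝ × ℝ) (𝓡 (2 * n)).tangent ∞ (fun p : ℝ × ℝ =>
      (⟨F.basePoint, (F.J p.1 p.2).Jv F.basePoint (C.Xv F.basePoint)⟩ :
        TangentBundle (𝓡 (2 * n)) W)) (univ ×ˢ Icc 0 1) :=
    F.smooth_J.contMDiffOn_Jv (σ := fun p : ℝ × ℝ => p.1) (τ := fun p : ℝ × ℝ => p.2)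
      (fun p hp => hp.2) contDiff_fst.contMDiff.contMDiffOn contDiff_snd.contMDiff.contMDiffOn
      contMDiffOn_const contMDiffOn_const
  have h2 : ContMDiffOn 𝓘(ℝ, ℝ × ℝ) 𝓘(ℝ, ℝ) ∞ (fun p : ℝ × ℝ =>
      C.lamv F.basePoint ((F.J p.1 p.2).Jv F.basePoint (C.Xv F.basePoint))) (univ ×ˢ Icc 0 1) :=
    C.smooth_lam.contMDiffOn_apply h1
  have h3 : ContMDiff 𝓘(ℝ, ℝ × ℝ) 𝓘(ℝ, ℝ) ∞ (fun p : ℝ × ℝ => F.r p.1 F.basePoint) :=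
    ContMDiff.comp (f := fun p : ℝ × ℝ => (p.1, F.basePoint)) F.contMDiff_r
      (contDiff_fst.contMDiff.prodMk contMDiff_const)
  refine h2.div₀ h3.contMDiffOn fun p _ => ?_
  rw [basePoint, F.r_cyl _ (by linarith)]
  exact (mul_pos (F.a_pos _ _) (by linarith [F.one_le_R₀])).ne'

theorem hasDerivAt_m (s : ℝ) {t : ℝ} (ht : t ∈ Icc (0 : ℝ) 1) :
    HasDerivAt (fun σ => F.m σ t)
      (fderivWithin ℝ (fun p : ℝ × ℝ => F.m p.1 p.2) (univ ×ˢ Icc 0 1) (s, t) (1, 0)) s := by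
  have h1 := ((F.contDiffOn_m (s, t) ⟨mem_univ _, ht⟩).differentiableWithinAt
    (by simp)).hasFDerivWithinAt
  have h2 : HasDerivWithinAt (fun σ : ℝ => (σ, t)) ((1 : ℝ), (0 : ℝ)) univ s :=
    ((hasDerivAt_id s).prodMk (hasDerivAt_const s t)).hasDerivWithinAt
  have h3 := HasFDerivWithinAt.comp_hasDerivWithinAt (f := fun σ : ℝ => (σ, t))
    (t := univ ×ˢ Icc (0 : ℝ) 1) s h1 h2 (fun σ _ => ⟨mem_univ _, ht⟩)
  exact h3.hasDerivAt univ_mem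

end Nonempty
end FloerFamily

end

/-! ### Uniform estimates for families -/

section

section
variable {C : Completion Q W}

theorem isOpen_compl_range_incl [CompactSpace M] [T2Space W] : IsOpen (range C.incl)ᶜ :=
  (isCompact_range C.incl_embedding.contMDiff.continuous).isClosed.isOpen_compl

theorem contMDiffAt_pr_of_notMem [Nonempty N] (J : C.CompatibleACS) {x : W}
    (hx : x ∈ (range C.incl)ᶜ) :
    ContMDiffAt (𝓡 (2 * n)) ((𝓡 (2 * n - 1)).prod 𝓘(ℝ, ℝ)) ∞ C.pr x := by
  rcases C.cover x with h | ⟨z, ρ, h1, rfl⟩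
  · exact absurd h hx
  · exact C.contMDiffAt_pr J h1

theorem dW_comp_pr [Nonempty N] (J : C.CompatibleACS) {g : N → ℝ} {z : N} {ρ : ℝ}
    (hg : MDifferentiableAt (𝓡 (2 * n - 1)) 𝓘(ℝ, ℝ) g z) (hρ : 1 < ρ) (w : EN n) (τ : ℝ) :
    dW (fun x => g (C.pr x).1) (C.cyl z ρ) (C.dcyl z ρ (w, τ)) = dN g z w := by
  have hpr := ((C.contMDiffAt_pr J (z := z) hρ).mdifferentiableAt (by simp)).hasMFDerivAt
  have key : ∀ q : N × ℝ, q = (z, ρ) →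
      MDifferentiableAt ((𝓡 (2 * n - 1)).prod 𝓘(ℝ, ℝ)) 𝓘(ℝ, ℝ) (fun q : N × ℝ => g q.1) q ∧
      (mfderiv ((𝓡 (2 * n - 1)).prod 𝓘(ℝ, ℝ)) 𝓘(ℝ, ℝ) (fun q : N × ℝ => g q.1) q :
        EN n × ℝ →L[ℝ] ℝ) (w, τ) = dN g z w := by
    rintro _ rfl
    have h1 := HasMFDerivAt.comp (f := fun q : N × ℝ => q.1) (z, ρ) hg.hasMFDerivAt
      (hasMFDerivAt_fst (I := 𝓡 (2 * n - 1)) (I' := 𝓘(ℝ, ℝ)) (x := (z, ρ)))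
    exact ⟨h1.mdifferentiableAt, congrArg (fun D : EN n × ℝ →L[ℝ] ℝ => D (w, τ)) h1.mfderiv⟩
  obtain ⟨k1, k2⟩ := key (C.pr (C.cyl z ρ)) (C.pr_cyl hρ)
  have h2 := (HasMFDerivAt.comp (f := C.pr) (C.cyl z ρ) k1.hasMFDerivAt hpr).mfderiv
  have h3 := congrArg (fun D : EW n →L[ℝ] ℝ => D (C.dcyl z ρ (w, τ))) h2
  refine Eq.trans h3 (Eq.trans ?_ k2)
  exact congrArg (mfderiv ((𝓡 (2 * n - 1)).prod 𝓘(ℝ, ℝ)) 𝓘(ℝ, ℝ) (fun q : N × ℝ => g q.1)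
    (C.pr (C.cyl z ρ)) : EN n × ℝ →L[ℝ] ℝ) (mfderiv_pr_dcyl J hρ (w, τ))

theorem dW_comp_pr_lift [Nonempty N] (J : C.CompatibleACS) {g : N → ℝ} {z : N} {ρ : ℝ}
    (hg : MDifferentiableAt (𝓡 (2 * n - 1)) 𝓘(ℝ, ℝ) g z) (hρ : 1 < ρ) (a : N → ℝ) (w : EN n)
    (p : ℝ) : dW (fun x => g (C.pr x).1) (C.cyl z ρ) (C.lift a z ρ w + p • C.Xv (C.cyl z ρ)) =
      dN g z w := by
  rw [lift, ← C.dcyl_zero (by linarith : ρ ≠ 0), ← map_add]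
  simp only [Prod.mk_add_mk, add_zero]
  exact dW_comp_pr J hg hρ w _

theorem continuous_lamv (C : Completion Q W) :
    Continuous fun ξ : TangentBundle (𝓡 (2 * n)) W => C.lamv ξ.proj ξ.2 := by
  have := C.smooth_lam.contMDiffOn_apply (IP := (𝓡 (2 * n)).tangent)
    (P := TangentBundle (𝓡 (2 * n)) W) (b := fun ξ => ξ.proj) (v := fun ξ => ξ.2) (s := univ)
    contMDiffOn_id
  exact (contMDiffOn_univ.1 this).continuous

end

namespace FloerFamily

variable {C : Completion Q W} (F : FloerFamily C) [T2Space W]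

section
variable [CompactSpace N] [Nonempty N]

theorem exists_a_bounds : ∃ a₁ a₂ : ℝ, 0 < a₁ ∧ ∀ s z, a₁ ≤ F.a s z ∧ F.a s z ≤ a₂ := by
  have hne : (Icc (-F.s₀) F.s₀ ×ˢ (univ : Set N)).Nonempty :=
    ⟨(F.clamp 0, Classical.arbitrary N), F.clamp_mem 0, mem_univ _⟩
  have hc : IsCompact (Icc (-F.s₀) F.s₀ ×ˢ (univ : Set N)) := isCompact_Icc.prod isCompact_univ
  obtain ⟨p, -, h1⟩ := hc.exists_isMinOn hne F.contMDiff_a.continuous.continuousOn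
  obtain ⟨q, -, h2⟩ := hc.exists_isMaxOn hne F.contMDiff_a.continuous.continuousOn
  refine ⟨F.a p.1 p.2, F.a q.1 q.2, F.a_pos _ _, fun s z => ?_⟩
  rw [F.a_clamp s]
  exact ⟨h1 (show (F.clamp s, z) ∈ _ from ⟨F.clamp_mem s, mem_univ _⟩),
    h2 (show (F.clamp s, z) ∈ _ from ⟨F.clamp_mem s, mem_univ _⟩)⟩

theorem exists_G_bound : ∃ B : ℝ, 0 ≤ B ∧ ∀ s z, |F.G s z| ≤ B ∧ |deriv (fun σ => F.G σ z) s| ≤ B := by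
  have hc : IsCompact (Icc (-F.s₀) F.s₀ ×ˢ (univ : Set N)) := isCompact_Icc.prod isCompact_univ
  have h1 := contMDiffOn_deriv_slice isOpen_univ (F.contMDiff_G.contMDiffOn (s := univ ×ˢ univ))
  obtain ⟨B₁, hB₁⟩ := hc.exists_bound_of_continuousOn F.contMDiff_G.continuous.continuousOn
  obtain ⟨B₂, hB₂⟩ := hc.exists_bound_of_continuousOn (h1.continuousOn.mono
    (prod_mono (subset_univ _) subset_rfl))
  refine ⟨max 0 (max B₁ B₂), le_max_left _ _, fun s z => ?_⟩
  by_cases hs : s ∈ Icc (-F.s₀) F.s₀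
  · have := hB₁ (s, z) ⟨hs, mem_univ _⟩
    have := hB₂ (s, z) ⟨hs, mem_univ _⟩
    exact ⟨le_max_of_le_right (le_max_of_le_left (hB₁ (s, z) ⟨hs, mem_univ _⟩)),
      le_max_of_le_right (le_max_of_le_right (hB₂ (s, z) ⟨hs, mem_univ _⟩))⟩
  · have hs' : s < -F.s₀ ∨ F.s₀ < s := by
      by_contra! h
      exact hs ⟨h.1, h.2⟩
    rw [F.G_eq_zero hs', F.deriv_G_eq_zero hs']
    simp

theorem deriv_m_eq_zero {s t : ℝ} (ht : t ∈ Icc (0 : ℝ) 1) (hs : s < -F.s₀ ∨ F.s₀ < s) :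
    deriv (fun σ => F.m σ t) s = 0 :=
  F.deriv_eq_zero_of_clamp (fun σ => F.m_clamp σ ht) hs

theorem exists_m_bounds : ∃ m₁ m₂ B : ℝ, 0 < m₁ ∧ 0 ≤ B ∧ ∀ s, ∀ t ∈ Icc (0 : ℝ) 1,
    m₁ ≤ F.m s t ∧ F.m s t ≤ m₂ ∧ |deriv (fun σ => F.m σ t) s| ≤ B := by
  have hc : IsCompact (Icc (-F.s₀) F.s₀ ×ˢ Icc (0 : ℝ) 1) := isCompact_Icc.prod isCompact_Icc
  have hne : (Icc (-F.s₀) F.s₀ ×ˢ Icc (0 : ℝ) 1).Nonempty :=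
    ⟨(F.clamp 0, 0), F.clamp_mem 0, by simp⟩
  have hsub : Icc (-F.s₀) F.s₀ ×ˢ Icc (0 : ℝ) 1 ⊆ univ ×ˢ Icc (0 : ℝ) 1 :=
    prod_mono (subset_univ _) subset_rfl
  obtain ⟨p, hp, h1⟩ := hc.exists_isMinOn hne (F.contDiffOn_m.continuousOn.mono hsub)
  obtain ⟨q, -, h2⟩ := hc.exists_isMaxOn hne (F.contDiffOn_m.continuousOn.mono hsub)
  have hd : ContinuousOn (fun p : ℝ × ℝ => fderivWithin ℝ (fun p : ℝ × ℝ => F.m p.1 p.2)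
      (univ ×ˢ Icc 0 1) p (1, 0)) (univ ×ˢ Icc 0 1) :=
    (F.contDiffOn_m.continuousOn_fderivWithin
      (uniqueDiffOn_univ.prod (uniqueDiffOn_Icc zero_lt_one)) (by simp)).clm_apply
      continuousOn_const
  obtain ⟨B, hB⟩ := hc.exists_bound_of_continuousOn (hd.mono hsub)
  refine ⟨F.m p.1 p.2, F.m q.1 q.2, max 0 B, F.m_pos _ hp.2, le_max_left _ _, fun s t ht => ?_⟩
  refine ⟨?_, ?_, ?_⟩
  · rw [F.m_clamp s ht]; exact h1 (show (F.clamp s, t) ∈ _ from ⟨F.clamp_mem s, ht⟩)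
  · rw [F.m_clamp s ht]; exact h2 (show (F.clamp s, t) ∈ _ from ⟨F.clamp_mem s, ht⟩)
  · by_cases hs : s ∈ Icc (-F.s₀) F.s₀
    · rw [(F.hasDerivAt_m s ht).deriv]
      exact le_max_of_le_right (hB (s, t) ⟨hs, ht⟩)
    · have hs' : s < -F.s₀ ∨ F.s₀ < s := by
        by_contra! h
        exact hs ⟨h.1, h.2⟩
      rw [F.deriv_m_eq_zero ht hs']
      simp

variable [CompactSpace M]

/-- The part of the completion where `ρ ≤ R`, together with `M`, is compact. -/
theorem isCompact_core (C : Completion Q W) (R : ℝ) :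
    IsCompact (range C.incl ∪ (fun p : N × ℝ => C.cyl p.1 p.2) '' (univ ×ˢ Icc 1 R)) := by
  refine (isCompact_range C.incl_embedding.contMDiff.continuous).union
    ((isCompact_univ.prod isCompact_Icc).image_of_continuousOn ?_)
  exact C.cyl_smooth.continuousOn.mono fun p hp => ⟨mem_univ _, lt_of_lt_of_le one_pos hp.2.1⟩

theorem mem_core_or (C : Completion Q W) (R : ℝ) (x : W) :
    x ∈ range C.incl ∪ (fun p : N × ℝ => C.cyl p.1 p.2) '' (univ ×ˢ Icc 1 R) ∨
      ∃ z ρ, R < ρ ∧ C.cyl z ρ = x := by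
  rcases C.cover x with h | ⟨z, ρ, h1, h2⟩
  · exact Or.inl (Or.inl h)
  · rcases le_or_gt ρ R with h | h
    · exact Or.inl (Or.inr ⟨(z, ρ), ⟨mem_univ _, h1.le, h⟩, h2⟩)
    · exact Or.inr ⟨z, ρ, h, h2⟩

/-- Where `r` is large, the point is far out on the cylindrical end. -/
theorem exists_level : ∃ r₀ : ℝ, 0 < r₀ ∧ ∀ s x, r₀ < F.r s x → ∃ z ρ, F.R₀ < ρ ∧ C.cyl z ρ = x := by
  have hc := (isCompact_Icc (a := -F.s₀) (b := F.s₀)).prod (isCompact_core C F.R₀)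
  obtain ⟨B, hB⟩ := hc.exists_bound_of_continuousOn F.contMDiff_r.continuous.continuousOn
  refine ⟨max B 1, by positivity, fun s x hx => ?_⟩
  refine (mem_core_or C F.R₀ x).resolve_left fun h => ?_
  have h1 := hB (F.clamp s, x) ⟨F.clamp_mem s, h⟩
  rw [F.r_clamp] at hx
  have h2 := le_abs_self (F.r (F.clamp s) x)
  have h3 := le_max_left B 1
  simp only [Real.norm_eq_abs] at h1
  linarith

end

/-- Linear forms over a compact set are bounded with respect to the metrics of the family. -/
theorem exists_sq_le_nsq {S : ℝ} {Z : Set W} (hZ : IsCompact Z) {θ : ℝ → W → EW n → ℝ}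
    (hθ : ContinuousOn (fun p : ℝ × TangentBundle (𝓡 (2 * n)) W => θ p.1 p.2.proj p.2.2)
      {p | p.2.proj ∈ Z}) (θ_smul : ∀ s x (r : ℝ) v, θ s x (r • v) = r * θ s x v) :
    ∃ c : ℝ, 0 < c ∧ ∀ s ∈ Icc (-S) S, ∀ t ∈ Icc (0 : ℝ) 1, ∀ x ∈ Z, ∀ v,
      θ s x v ^ 2 ≤ c * (F.J s t).nsq x v := by
  have hq : ContinuousOn (fun p : (ℝ × ℝ) × TangentBundle (𝓡 (2 * n)) W =>
      (F.J p.1.1 p.1.2).nsq p.2.proj p.2.2)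
      {p | (p.1, p.2.proj) ∈ (Icc (-S) S ×ˢ Icc (0 : ℝ) 1) ×ˢ Z} := by
    intro p hp
    have h1 : ContinuousWithinAt (fun p : (ℝ × ℝ) × TangentBundle (𝓡 (2 * n)) W =>
        (⟨p.2.proj, p.2.2⟩ : TangentBundle (𝓡 (2 * n)) W))
        {p | (p.1, p.2.proj) ∈ (Icc (-S) S ×ˢ Icc (0 : ℝ) 1) ×ˢ Z} p :=
      continuous_snd.continuousWithinAt
    exact C.continuousWithinAt_Om h1 (F.smooth_J.continuousWithinAt
      (σ := fun p : (ℝ × ℝ) × TangentBundle (𝓡 (2 * n)) W => p.1.1) (τ := fun p => p.1.2) hp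
      (fun p hp => hp.1.2) (by fun_prop) (by fun_prop) h1)
  have hθ' : ContinuousOn (fun p : (ℝ × ℝ) × TangentBundle (𝓡 (2 * n)) W =>
      θ p.1.1 p.2.proj p.2.2) {p | (p.1, p.2.proj) ∈ (Icc (-S) S ×ˢ Icc (0 : ℝ) 1) ×ˢ Z} :=
    hθ.comp (f := fun p : (ℝ × ℝ) × TangentBundle (𝓡 (2 * n)) W => (p.1.1, p.2))
      (by fun_prop) fun p hp => hp.2
  obtain ⟨c, hc, h⟩ := exists_sq_le_of_isCompact (P := ℝ × ℝ)
    (Z := (Icc (-S) S ×ˢ Icc (0 : ℝ) 1) ×ˢ Z) (q := fun p x v => (F.J p.1 p.2).nsq x v)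
    (θ := fun p x v => θ p.1 x v) ((isCompact_Icc.prod isCompact_Icc).prod hZ) hq hθ'
    (fun p x _ v hv => (F.J p.1 p.2).nsq_pos hv) (fun p x r v => (F.J p.1 p.2).nsq_smul r v)
    (fun p x r v => θ_smul p.1 x r v)
  exact ⟨c, hc, fun s hs t ht x hx v => h (s, t) x ⟨⟨hs, ht⟩, hx⟩ v⟩

theorem nsq_clamp (s : ℝ) {t : ℝ} (ht : t ∈ Icc (0 : ℝ) 1) (x : W) (v : EW n) :
    (F.J s t).nsq x v = (F.J (F.clamp s) t).nsq x v := by rw [F.J_clamp s ht]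

theorem exists_lamv_sq_le {Z : Set W} (hZ : IsCompact Z) : ∃ c : ℝ, 0 < c ∧
    ∀ s, ∀ t ∈ Icc (0 : ℝ) 1, ∀ x ∈ Z, ∀ v, C.lamv x v ^ 2 ≤ c * (F.J s t).nsq x v := by
  obtain ⟨c, hc, h⟩ := F.exists_sq_le_nsq (S := F.s₀) hZ (θ := fun _ x v => C.lamv x v)
    ((continuous_lamv C).comp continuous_snd).continuousOn (fun s x r v => by simp)
  exact ⟨c, hc, fun s t ht x hx v => by
    rw [F.nsq_clamp s ht]; exact h _ (F.clamp_mem s) t ht x hx v⟩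

theorem exists_dW_sq_le {Z : Set W} (hZ : IsCompact Z) : ∃ c : ℝ, 0 < c ∧
    ∀ s, ∀ t ∈ Icc (0 : ℝ) 1, ∀ x ∈ Z, ∀ v, dW (F.H s) x v ^ 2 ≤ c * (F.J s t).nsq x v := by
  have h1 := contMDiffOn_dM_slice isOpen_univ (F.smooth_H.contMDiffOn (s := univ ×ˢ univ))
  obtain ⟨c, hc, h⟩ := F.exists_sq_le_nsq (S := F.s₀) hZ (θ := fun s x v => dW (F.H s) x v)
    (h1.continuousOn.mono fun p hp => ⟨mem_univ _, mem_univ _⟩) (fun s x r v => by simp)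
  exact ⟨c, hc, fun s t ht x hx v => by
    rw [F.nsq_clamp s ht, F.H_clamp s]; exact h _ (F.clamp_mem s) t ht x hx v⟩

theorem exists_nsq_hamv_le {Z : Set W} (hZ : IsCompact Z) : ∃ c : ℝ, 0 < c ∧
    ∀ s, ∀ t ∈ Icc (0 : ℝ) 1, ∀ x ∈ Z, (F.J s t).nsq x (C.hamv (F.H s) x) ≤ c := by
  obtain ⟨c, hc, h⟩ := F.exists_dW_sq_le hZ
  refine ⟨c, hc, fun s t ht x hx => ?_⟩
  have h1 := h s t ht x hx ((F.J s t).Jv x (C.hamv (F.H s) x))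
  rw [(F.J s t).nsq_Jv, (F.J s t).dW_eq, neg_sq] at h1
  have h2 : (F.J s t).nsq x (C.hamv (F.H s) x) ^ 2 ≤ c * (F.J s t).nsq x (C.hamv (F.H s) x) := h1
  by_contra! h3
  nlinarith

variable [CompactSpace N] [Nonempty N] [CompactSpace M]

/-- The scaling behaviour of the metrics at infinity: a form `dΓ` pulled back from `N` has squared norm
at most `c / r`, and it is controlled by the part of the vector tangent to the level sets of `H`
alone. -/
theorem exists_sq_dW_comp_pr_le (S : ℝ) {Γ : ℝ × N → ℝ}
    (hΓ : ContMDiff (𝓘(ℝ, ℝ).prod (𝓡 (2 * n - 1))) 𝓘(ℝ, ℝ) ∞ Γ) : ∃ c : ℝ, 0 < c ∧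
    ∀ s ∈ Icc (-S) S, ∀ t ∈ Icc (0 : ℝ) 1, ∀ z ρ, F.R₀ < ρ → ∀ v,
      dW (fun x => Γ (s, (C.pr x).1)) (C.cyl z ρ) v ^ 2 * (F.a s z * ρ) ≤
        c * ((F.J s t).nsq (C.cyl z ρ) v -
          F.m s t * dW (F.H s) (C.cyl z ρ) v ^ 2 / (F.a s z * ρ)) := by
  have hR := F.one_le_R₀
  have hZ : IsCompact ((fun z : N => C.cyl z (F.R₀ + 1)) '' univ) :=
    isCompact_univ.image (contMDiff_cyl (C := C) (by linarith)).continuous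
  have hZO : (fun z : N => C.cyl z (F.R₀ + 1)) '' univ ⊆ (range C.incl)ᶜ := by
    rintro _ ⟨z, -, rfl⟩
    exact C.disjoint z _ (by linarith)
  have hΓ' : ContMDiffOn (𝓘(ℝ, ℝ).prod (𝓡 (2 * n))) 𝓘(ℝ, ℝ) ∞
      (fun p : ℝ × W => Γ (p.1, (C.pr p.2).1)) (univ ×ˢ (range C.incl)ᶜ) := by
    refine ContMDiff.comp_contMDiffOn (f := fun p : ℝ × W => (p.1, (C.pr p.2).1)) hΓ
      (contMDiffOn_fst.prodMk ?_)
    have h1 : ContMDiffOn (𝓡 (2 * n)) ((𝓡 (2 * n - 1)).prod 𝓘(ℝ, ℝ)) ∞ C.pr (range C.incl)ᶜ :=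
      fun x hx => (contMDiffAt_pr_of_notMem (F.J 0 0) hx).contMDiffWithinAt
    exact contMDiff_fst.comp_contMDiffOn (h1.comp contMDiffOn_snd fun p hp => hp.2)
  have h1 := contMDiffOn_dM_slice isOpen_compl_range_incl hΓ'
  obtain ⟨c, hc, h⟩ := F.exists_sq_le_nsq (S := S) hZ
    (θ := fun s x v => dW (fun x => Γ (s, (C.pr x).1)) x v)
    (h1.continuousOn.mono fun p hp => ⟨mem_univ _, hZO hp⟩) (fun s x r v => by simp)
  obtain ⟨a₁, a₂, ha₁, ha⟩ := F.exists_a_bounds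
  -- the estimate at the level `ρ = R₀ + 1` is carried to all levels by the scaling of the norm
  refine ⟨c * (a₂ * (F.R₀ + 1)), mul_pos hc (mul_pos (ha₁.trans_le ((ha 0 (Classical.arbitrary N)).1.trans
    (ha 0 (Classical.arbitrary N)).2)) (by linarith)), ?_⟩
  intro s hs t ht z ρ hρ v
  obtain ⟨hm, q, hq⟩ := F.exists_conicalAt s ht
  obtain ⟨-, hreg, hnsq⟩ := hq z ρ hρ
  obtain ⟨-, -, hnsq'⟩ := hq z (F.R₀ + 1) (by linarith)
  obtain ⟨w, hw⟩ := (F.ham s).decomp (F.J s t) (by linarith) (F.cyl_notMem hρ) v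
  have hg : MDifferentiableAt (𝓡 (2 * n - 1)) 𝓘(ℝ, ℝ) (fun z => Γ (s, z)) z :=
    (ContMDiff.comp (f := fun z : N => (s, z)) hΓ
      (contMDiff_const.prodMk contMDiff_id)).mdifferentiableAt (by simp)
  have hl : dW (F.H s) (C.cyl z ρ) (C.lift (F.a s) z ρ w) = 0 :=
    (F.ham s).dW_lift (by linarith) (F.cyl_notMem hρ) w
  have e1 : dW (fun x => Γ (s, (C.pr x).1)) (C.cyl z ρ) v = dN (fun z => Γ (s, z)) z w := by
    conv_lhs => rw [hw]
    exact dW_comp_pr_lift (F.J s t) hg (by linarith) (F.a s) w _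
  have hr := hreg.r_pos
  have e2 : (F.J s t).nsq (C.cyl z ρ) v = F.a s z * ρ * q z w +
      F.m s t * dW (F.H s) (C.cyl z ρ) v ^ 2 / (F.a s z * ρ) := by
    conv_lhs => rw [hw, hreg.nsq_add_smul hl, hnsq, inv_inv]
    have : F.a s z * ρ ≠ 0 := hr.ne'
    field_simp
  have e3 := h s hs t ht (C.cyl z (F.R₀ + 1)) (mem_image_of_mem _ (mem_univ z))
    (C.lift (F.a s) z (F.R₀ + 1) w + (0 : ℝ) • C.Xv (C.cyl z (F.R₀ + 1)))
  rw [dW_comp_pr_lift (F.J s t) hg (by linarith) (F.a s) w 0, zero_smul, add_zero, hnsq'] at e3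
  rw [e1, e2, add_sub_cancel_right]
  have hq0 : 0 ≤ q z w := by
    have h5 := (F.J s t).nsq_nonneg (x := C.cyl z ρ) (C.lift (F.a s) z ρ w)
    rw [hnsq] at h5
    exact nonneg_of_mul_nonneg_right h5 hr
  have e4 : dN (fun z => Γ (s, z)) z w ^ 2 ≤ c * (a₂ * (F.R₀ + 1) * q z w) := by
    refine e3.trans (mul_le_mul_of_nonneg_left ?_ hc.le)
    refine mul_le_mul_of_nonneg_right (mul_le_mul_of_nonneg_right (ha s z).2 (by linarith)) hq0
  refine (mul_le_mul_of_nonneg_right e4 hr.le).trans (le_of_eq ?_)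
  ring

end FloerFamily

end

/-! ### Approximate chords of bounded energy -/

section

theorem isClosed_bdryLag [CompactSpace L] [T2Space M] (Q : LiouvilleQuadruple n M N L) :
    IsClosed Q.bdryLag :=
  (isCompact_range Q.lag_embedding.contMDiff.continuous).isClosed.preimage
    Q.bdry_embedding.contMDiff.continuous

theorem mem_bdryLag_of_cyl_mem_Lhat {C : Completion Q W} {z : N} {ρ : ℝ} (hρ : 1 < ρ)
    (h : C.cyl z ρ ∈ C.Lhat) : z ∈ Q.bdryLag := by
  rcases h with ⟨p, -, hp⟩ | ⟨z', hz', ρ', hρ', h⟩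
  · exact absurd ⟨p, hp⟩ (C.disjoint z ρ hρ)
  · rw [← (C.cyl_injective z' z ρ' ρ hρ' hρ.le h).1]; exact hz'

namespace FloerFamily

variable {C : Completion Q W} (F : FloerFamily C) [T2Space W]
  [CompactSpace N] [Nonempty N] [CompactSpace M]

/-- The Reeb vector field of the slope exists and is smooth, and the Hamiltonian vector field on the end
projects to it. It is recovered from `J X = c⁻¹ X_H` at a fixed level `ρ`. -/
theorem exists_reeb (s : ℝ) : ∃ R : N → EN n, (∀ z, IsReebVector (Q.scaledLam (F.a s)) z (R z)) ∧
    SmoothDerivation R ∧ ∀ z ρ, F.R₀ < ρ → ∀ g : N → ℝ, MDifferentiableAt (𝓡 (2 * n - 1)) 𝓘(ℝ, ℝ) g z →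
      dW (fun x => g (C.pr x).1) (C.cyl z ρ) (C.hamv (F.H s) (C.cyl z ρ)) = dN g z (R z) := by
  have h01 : (0 : ℝ) ∈ Icc (0 : ℝ) 1 := by simp
  have hR0 := F.one_le_R₀
  obtain ⟨hm, q, hq⟩ := F.exists_conicalAt s h01
  choose R hR using fun z => (hq z (F.R₀ + 1) (by linarith)).1
  have key : ∀ z ρ, F.R₀ < ρ → ∀ g : N → ℝ, MDifferentiableAt (𝓡 (2 * n - 1)) 𝓘(ℝ, ℝ) g z →
      dW (fun x => g (C.pr x).1) (C.cyl z ρ) (C.hamv (F.H s) (C.cyl z ρ)) = dN g z (R z) := by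
    intro z ρ hρ g hg
    rw [(F.ham s).hamv_eq (F.J s 0) (by linarith) (F.cyl_notMem hρ) (hR z)]
    have := dW_comp_pr_lift (F.J s 0) hg (by linarith : 1 < ρ) (F.a s) (R z) 0
    rwa [zero_smul, add_zero] at this
  refine ⟨R, hR, fun g hg => ?_, key⟩
  have hpr : ContMDiffOn (𝓘(ℝ, ℝ).prod (𝓡 (2 * n))) 𝓘(ℝ, ℝ) ∞
      (fun p : ℝ × W => g (C.pr p.2).1) (univ ×ˢ (range C.incl)ᶜ) := by
    have h1 : ContMDiffOn (𝓡 (2 * n)) ((𝓡 (2 * n - 1)).prod 𝓘(ℝ, ℝ)) ∞ C.pr (range C.incl)ᶜ :=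
      fun x hx => (contMDiffAt_pr_of_notMem (F.J 0 0) hx).contMDiffWithinAt
    exact hg.comp_contMDiffOn (contMDiff_fst.comp_contMDiffOn
      (h1.comp contMDiffOn_snd fun p hp => hp.2))
  have h1 := contMDiffOn_dM_slice isOpen_compl_range_incl hpr
  have hcyl : ContMDiff (𝓡 (2 * n - 1)) (𝓡 (2 * n)) ∞ (fun z => C.cyl z (F.R₀ + 1)) :=
    contMDiff_cyl (by linarith)
  have h2 : ContMDiffOn (𝓡 (2 * n - 1)) (𝓡 (2 * n)).tangent ∞ (fun z =>
      (⟨C.cyl z (F.R₀ + 1), (F.J s 0).Jv _ (C.Xv (C.cyl z (F.R₀ + 1)))⟩ :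
        TangentBundle (𝓡 (2 * n)) W)) univ :=
    F.smooth_J.contMDiffOn_Jv (σ := fun _ => s) (τ := fun _ => 0) (fun _ _ => h01)
      contMDiffOn_const contMDiffOn_const hcyl.contMDiffOn (C.smooth_X.comp hcyl).contMDiffOn
  have h3 := h1.comp ((contMDiffOn_const (c := s)).prodMk h2)
    (fun z _ => ⟨mem_univ _, C.disjoint z _ (by linarith)⟩)
  have h4 : ContMDiff (𝓡 (2 * n - 1)) 𝓘(ℝ, ℝ) ∞ (fun z => (F.m s 0)⁻¹ *
      dW (fun x => g (C.pr x).1) (C.cyl z (F.R₀ + 1))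
        ((F.J s 0).Jv _ (C.Xv (C.cyl z (F.R₀ + 1))))) :=
    contMDiff_const.mul (contMDiffOn_univ.1 h3)
  refine h4.congr fun z => ?_
  rw [← key z (F.R₀ + 1) (by linarith) g (hg.mdifferentiableAt (by simp)),
    (hq z (F.R₀ + 1) (by linarith)).2.1.Jv_Xv, map_smul, inv_inv, smul_eq_mul,
    inv_mul_cancel_left₀ hm.ne']

/-- Approximate chords `y' = X_H - J v` with bounded energy `∫ |v|²` come below a fixed level. If they went
to infinity, then, as the error in the projection to `N` is scaled down, they would converge to a
Reeb chord of action `1`. -/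
theorem exists_level_of_slice [T2Space N] [CompactSpace L] [T2Space M] {s : ℝ}
    (hs : (1 : ℝ) ∉ Q.actionSpectrum (Q.scaledLam (F.a s))) (E₀ : ℝ) :
    ∃ R : ℝ, ∀ (y : ℝ → W) (v : ℝ → EW n),
      (∀ t ∈ Icc (0 : ℝ) 1, HasMFDerivWithinAt 𝓘(ℝ, ℝ) (𝓡 (2 * n)) y (Icc 0 1) t
        ((1 : ℝ →L[ℝ] ℝ).smulRight (C.hamv (F.H s) (y t) - (F.J s t).Jv (y t) (v t)))) →
      ContinuousOn (fun t => (F.J s t).nsq (y t) (v t)) (Icc 0 1) →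
      ∫ t in (0 : ℝ)..1, (F.J s t).nsq (y t) (v t) ≤ E₀ → y 0 ∈ C.Lhat → y 1 ∈ C.Lhat →
      ∃ t ∈ Icc (0 : ℝ) 1, F.r s (y t) ≤ R := by
  obtain ⟨R, hReeb, hR, key⟩ := F.exists_reeb s
  obtain ⟨r₀, hr₀, hlev⟩ := F.exists_level
  have hR0 := F.one_le_R₀
  by_contra! hcon
  -- a sequence of slices that go to infinity
  choose y v hy hcont hE hy0 hy1 hfar using fun k : ℕ => hcon (r₀ + k + 1)
  have hcyl : ∀ k, ∀ t ∈ Icc (0 : ℝ) 1, ∃ ρ, F.R₀ < ρ ∧ C.cyl (C.pr (y k t)).1 ρ = y k t := by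
    intro k t ht
    have hk : (0 : ℝ) ≤ k := Nat.cast_nonneg k
    obtain ⟨z, ρ, hρ, h1⟩ := hlev s (y k t) (by linarith [hfar k t ht])
    refine ⟨ρ, hρ, ?_⟩
    rw [← h1, C.pr_cyl (by linarith)]
  obtain ⟨z', hz', hcl⟩ := exists_limit_weakIntegralCurve (R := R) hR
    (z := fun k t => (C.pr (y k t)).1) (e := fun k t => (F.J s t).nsq (y k t) (v k t)) (E₀ := E₀)
    hcont (fun k t _ => (F.J s t).nsq_nonneg _) hE (fun g hg => by
      obtain ⟨c, hc, h⟩ := F.exists_sq_dW_comp_pr_le |s| (Γ := fun p => g p.2)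
        (hg.comp contMDiff_snd)
      refine ⟨c, hc.le, fun k => ⟨fun t => dW (fun x => g (C.pr x).1) (y k t)
        (C.hamv (F.H s) (y k t) - (F.J s t).Jv (y k t) (v k t)), fun t ht => ?_⟩⟩
      obtain ⟨ρ, hρ, hρy⟩ := hcyl k t ht
      obtain ⟨z, hz⟩ : ∃ z, z = (C.pr (y k t)).1 := ⟨_, rfl⟩
      rw [← hz] at hρy
      constructor
      · refine hasDerivWithinAt_dM_comp (I := 𝓡 (2 * n)) (G := fun x => g (C.pr x).1) ?_ (hy k t ht)
        rw [← hρy]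
        have h1 := C.contMDiffAt_pr (F.J 0 0) (z := z) (by linarith : 1 < ρ)
        have h2 : ContMDiffAt (𝓡 (2 * n)) 𝓘(ℝ, ℝ) ∞ (fun x => g (C.pr x).1) (C.cyl z ρ) :=
          ContMDiffAt.comp (f := fun x => (C.pr x).1) _ (hg _)
            (ContMDiffAt.comp (f := C.pr) _ contMDiffAt_fst h1)
        exact h2.mdifferentiableAt (by simp)
      · beta_reduce
        rw [← hz, map_sub, ← hρy, key z ρ hρ g (hg.mdifferentiableAt (by simp)), sub_sub_cancel_left,
          neg_sq]
        have h1 := h s ⟨neg_abs_le s, le_abs_self s⟩ t ht z ρ hρ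
          ((F.J s t).Jv (C.cyl z ρ) (v k t))
        rw [(F.J s t).nsq_Jv] at h1
        have h2 : (k : ℝ) + 1 ≤ F.a s z * ρ := by
          have := hfar k t ht
          rw [← hρy, F.r_cyl s hρ] at this
          linarith
        have hk : (0 : ℝ) < k + 1 := by positivity
        have h3 : 0 ≤ F.m s t * dW (F.H s) (C.cyl z ρ) ((F.J s t).Jv (C.cyl z ρ) (v k t)) ^ 2 /
            (F.a s z * ρ) := by
          have := F.m_pos s ht
          have : 0 ≤ F.a s z * ρ := hk.le.trans h2
          positivity
        rw [div_mul_eq_mul_div, le_div_iff₀ hk]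
        refine (mul_le_mul_of_nonneg_left h2 (sq_nonneg _)).trans (h1.trans ?_)
        exact mul_le_mul_of_nonneg_left (by linarith) hc.le)
  have hend : ∀ t ∈ Icc (0 : ℝ) 1, (∀ k, y k t ∈ C.Lhat) → z' t ∈ Q.bdryLag := by
    intro t ht hL
    refine hcl t _ (isClosed_bdryLag Q) fun k => ?_
    obtain ⟨ρ, hρ, hρy⟩ := hcyl k t ht
    have := hL k
    rw [← hρy] at this
    exact mem_bdryLag_of_cyl_mem_Lhat (by linarith) this
  exact hs (one_mem_actionSpectrum hReeb hR hz' (hend 0 (by simp) hy0) (hend 1 (by simp) hy1))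

end FloerFamily

end

/-! ### Solutions of the Floer equation -/

section

namespace FloerFamily

/-- The strip `ℝ × [0, 1]`. -/
abbrev stripDomain : Set (ℝ × ℝ) := univ ×ˢ Icc 0 1

theorem uniqueDiffOn_stripDomain : UniqueDiffOn ℝ stripDomain :=
  uniqueDiffOn_univ.prod (uniqueDiffOn_Icc zero_lt_one)

theorem mem_closure_interior_stripDomain {p : ℝ × ℝ} (hp : p ∈ stripDomain) :
    p ∈ closure (interior stripDomain) := by
  rw [interior_prod_eq, interior_univ, interior_Icc, closure_prod_eq, closure_univ,
    closure_Ioo zero_ne_one]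
  exact hp

variable {C : Completion Q W}

/-- Solutions of the Floer equation for the family `F`, without conditions at the ends. -/
structure Strip (F : FloerFamily C) where
  /-- The map. -/
  u : ℝ × ℝ → W
  smooth : ContMDiffOn 𝓘(ℝ, ℝ × ℝ) (𝓡 (2 * n)) ∞ u stripDomain
  floer : ∀ s, ∀ t ∈ Icc (0 : ℝ) 1,
    velocity (𝓡 (2 * n)) (fun σ => u (σ, t)) s -
      (F.J s t).toFun (u (s, t))
        (velocityWithin (𝓡 (2 * n)) (fun τ => u (s, τ)) (Icc 0 1) t -
          C.hamVF (F.H s) (u (s, t))) = 0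
  boundary : ∀ s, u (s, 0) ∈ C.Lhat ∧ u (s, 1) ∈ C.Lhat

namespace Strip

variable {F : FloerFamily C} (U : F.Strip)

/-- The derivative of the strip. -/
def du (p : ℝ × ℝ) : ℝ × ℝ →L[ℝ] EW n := mfderivWithin 𝓘(ℝ, ℝ × ℝ) (𝓡 (2 * n)) U.u stripDomain p

/-- The derivative `∂_s u`. -/
def us (s t : ℝ) : EW n := U.du (s, t) (1, 0)

/-- The derivative `∂_t u`. -/
def ut (s t : ℝ) : EW n := U.du (s, t) (0, 1)

theorem hasMFDerivWithinAt {p : ℝ × ℝ} (hp : p ∈ stripDomain) :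
    HasMFDerivWithinAt 𝓘(ℝ, ℝ × ℝ) (𝓡 (2 * n)) U.u stripDomain p (U.du p) :=
  ((U.smooth p hp).mdifferentiableWithinAt (by simp)).hasMFDerivWithinAt

theorem hasMFDerivAt_s (s : ℝ) {t : ℝ} (ht : t ∈ Icc (0 : ℝ) 1) :
    HasMFDerivAt 𝓘(ℝ, ℝ) (𝓡 (2 * n)) (fun σ => U.u (σ, t)) s
      ((1 : ℝ →L[ℝ] ℝ).smulRight (U.us s t)) := by
  have h1 : HasMFDerivWithinAt 𝓘(ℝ, ℝ) 𝓘(ℝ, ℝ × ℝ) (fun σ : ℝ => (σ, t)) univ s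
      ((ContinuousLinearMap.id ℝ ℝ).prod (0 : ℝ →L[ℝ] ℝ)) :=
    ((hasFDerivAt_id s).prodMk (hasFDerivAt_const t s)).hasMFDerivAt.hasMFDerivWithinAt
  have h2 := HasMFDerivWithinAt.comp (f := fun σ : ℝ => (σ, t)) s
    (U.hasMFDerivWithinAt (p := (s, t)) ⟨mem_univ _, ht⟩) h1 (fun σ _ => ⟨mem_univ _, ht⟩)
  rw [hasMFDerivWithinAt_univ] at h2
  refine h2.congr_mfderiv ?_
  have h3 : (U.du (s, t)).comp ((ContinuousLinearMap.id ℝ ℝ).prod (0 : ℝ →L[ℝ] ℝ)) =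
      (1 : ℝ →L[ℝ] ℝ).smulRight (U.us s t) := by ext; simp [us]
  exact h3

theorem hasMFDerivWithinAt_t (s : ℝ) {t : ℝ} (ht : t ∈ Icc (0 : ℝ) 1) :
    HasMFDerivWithinAt 𝓘(ℝ, ℝ) (𝓡 (2 * n)) (fun τ => U.u (s, τ)) (Icc 0 1) t
      ((1 : ℝ →L[ℝ] ℝ).smulRight (U.ut s t)) := by
  have h1 : HasMFDerivWithinAt 𝓘(ℝ, ℝ) 𝓘(ℝ, ℝ × ℝ) (fun τ : ℝ => (s, τ)) (Icc 0 1) t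
      ((0 : ℝ →L[ℝ] ℝ).prod (ContinuousLinearMap.id ℝ ℝ)) :=
    ((hasFDerivAt_const s t).prodMk (hasFDerivAt_id t)).hasMFDerivAt.hasMFDerivWithinAt
  have h2 := HasMFDerivWithinAt.comp (f := fun τ : ℝ => (s, τ)) t
    (U.hasMFDerivWithinAt (p := (s, t)) ⟨mem_univ _, ht⟩) h1 (fun τ hτ => ⟨mem_univ _, hτ⟩)
  refine h2.congr_mfderiv ?_
  have h3 : (U.du (s, t)).comp ((0 : ℝ →L[ℝ] ℝ).prod (ContinuousLinearMap.id ℝ ℝ)) =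
      (1 : ℝ →L[ℝ] ℝ).smulRight (U.ut s t) := by ext; simp [ut]
  exact h3

/-- The Floer equation, on the model space. -/
theorem us_eq (s : ℝ) {t : ℝ} (ht : t ∈ Icc (0 : ℝ) 1) :
    U.us s t = (F.J s t).Jv (U.u (s, t)) (U.ut s t - C.hamv (F.H s) (U.u (s, t))) := by
  have h1 : (velocity (𝓡 (2 * n)) (fun σ => U.u (σ, t)) s : EW n) = U.us s t := by
    have h := (U.hasMFDerivAt_s s ht).mfderiv
    have h' := congrArg (fun D : ℝ →L[ℝ] EW n => D 1) h
    refine Eq.trans h' ?_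
    change (1 : ℝ) • U.us s t = _
    rw [one_smul]
  have h2 : (velocityWithin (𝓡 (2 * n)) (fun τ => U.u (s, τ)) (Icc 0 1) t : EW n) = U.ut s t := by
    have h := (U.hasMFDerivWithinAt_t s ht).mfderivWithin
      ((uniqueDiffOn_Icc zero_lt_one) t ht).uniqueMDiffWithinAt
    have h' := congrArg (fun D : ℝ →L[ℝ] EW n => D 1) h
    refine Eq.trans h' ?_
    change (1 : ℝ) • U.ut s t = _
    rw [one_smul]
  have h3 := sub_eq_zero.1 (U.floer s t ht)
  refine Eq.trans h1.symm (Eq.trans h3 ?_)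
  exact congrArg (fun v : EW n => (F.J s t).Jv (U.u (s, t)) (v - C.hamv (F.H s) (U.u (s, t)))) h2

/-- The Floer equation, solved for `∂_t u`. -/
theorem ut_eq (s : ℝ) {t : ℝ} (ht : t ∈ Icc (0 : ℝ) 1) :
    U.ut s t = C.hamv (F.H s) (U.u (s, t)) - (F.J s t).Jv (U.u (s, t)) (U.us s t) := by
  rw [U.us_eq s ht, (F.J s t).Jv_Jv]; abel

theorem contMDiffOn_du (v : ℝ × ℝ) : ContMDiffOn 𝓘(ℝ, ℝ × ℝ) (𝓡 (2 * n)).tangent ∞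
    (fun p => (⟨U.u p, U.du p v⟩ : TangentBundle (𝓡 (2 * n)) W)) stripDomain :=
  contMDiffOn_mfderivWithin_const U.smooth uniqueDiffOn_stripDomain v

/-- The function `λ(∂_t u)`. -/
def α (s t : ℝ) : ℝ := C.lamv (U.u (s, t)) (U.ut s t)

/-- The function `λ(∂_s u)`. -/
def γ (s t : ℝ) : ℝ := C.lamv (U.u (s, t)) (U.us s t)

/-- The energy density `|∂_s u|²`. -/
def e (s t : ℝ) : ℝ := (F.J s t).nsq (U.u (s, t)) (U.us s t)

theorem contDiffOn_lamv (v : ℝ × ℝ) :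
    ContDiffOn ℝ ∞ (fun p => C.lamv (U.u p) (U.du p v)) stripDomain := by
  rw [← contMDiffOn_iff_contDiffOn]
  exact C.smooth_lam.contMDiffOn_apply (U.contMDiffOn_du v)

theorem continuousOn_e : ContinuousOn (fun p : ℝ × ℝ => U.e p.1 p.2) stripDomain := by
  intro p hp
  have h1 := ((U.contMDiffOn_du (1, 0)) p hp).continuousWithinAt
  exact C.continuousWithinAt_Om h1 (F.smooth_J.continuousWithinAt (σ := fun p : ℝ × ℝ => p.1)
    (τ := fun p => p.2) hp (fun p hp => hp.2) (by fun_prop) (by fun_prop) h1)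

theorem e_nonneg (s t : ℝ) : 0 ≤ U.e s t := (F.J s t).nsq_nonneg _

theorem hasDerivAt_of_contDiffOn {g : ℝ × ℝ → ℝ} (hg : ContDiffOn ℝ ∞ g stripDomain) (s : ℝ) {t : ℝ}
    (ht : t ∈ Icc (0 : ℝ) 1) :
    HasDerivAt (fun σ => g (σ, t)) (fderivWithin ℝ g stripDomain (s, t) (1, 0)) s := by
  have h1 := ((hg (s, t) ⟨mem_univ _, ht⟩).differentiableWithinAt (by simp)).hasFDerivWithinAt
  have h2 : HasDerivWithinAt (fun σ : ℝ => (σ, t)) ((1 : ℝ), (0 : ℝ)) univ s :=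
    ((hasDerivAt_id s).prodMk (hasDerivAt_const s t)).hasDerivWithinAt
  have h3 := HasFDerivWithinAt.comp_hasDerivWithinAt (f := fun σ : ℝ => (σ, t))
    (t := stripDomain) s h1 h2 (fun σ _ => ⟨mem_univ _, ht⟩)
  exact h3.hasDerivAt univ_mem

theorem hasDerivWithinAt_of_contDiffOn {g : ℝ × ℝ → ℝ} (hg : ContDiffOn ℝ ∞ g stripDomain) (s : ℝ)
    {t : ℝ} (ht : t ∈ Icc (0 : ℝ) 1) :
    HasDerivWithinAt (fun τ => g (s, τ)) (fderivWithin ℝ g stripDomain (s, t) (0, 1)) (Icc 0 1) t := by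
  have h1 := ((hg (s, t) ⟨mem_univ _, ht⟩).differentiableWithinAt (by simp)).hasFDerivWithinAt
  have h2 : HasDerivWithinAt (fun τ : ℝ => (s, τ)) ((0 : ℝ), (1 : ℝ)) (Icc 0 1) t :=
    ((hasDerivAt_const t s).prodMk (hasDerivAt_id t)).hasDerivWithinAt
  exact HasFDerivWithinAt.comp_hasDerivWithinAt (f := fun τ : ℝ => (s, τ))
    (t := stripDomain) t h1 h2 (fun τ hτ => ⟨mem_univ _, hτ⟩)

/-- The derivative `∂_s α`. -/
def α_s (s t : ℝ) : ℝ :=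
  fderivWithin ℝ (fun p => C.lamv (U.u p) (U.du p (0, 1))) stripDomain (s, t) (1, 0)

/-- The derivative `∂_t γ`. -/
def γ_t (s t : ℝ) : ℝ :=
  fderivWithin ℝ (fun p => C.lamv (U.u p) (U.du p (1, 0))) stripDomain (s, t) (0, 1)

theorem hasDerivAt_α (s : ℝ) {t : ℝ} (ht : t ∈ Icc (0 : ℝ) 1) :
    HasDerivAt (fun σ => U.α σ t) (U.α_s s t) s :=
  hasDerivAt_of_contDiffOn (U.contDiffOn_lamv (0, 1)) s ht

theorem hasDerivWithinAt_γ (s : ℝ) {t : ℝ} (ht : t ∈ Icc (0 : ℝ) 1) :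
    HasDerivWithinAt (fun τ => U.γ s τ) (U.γ_t s t) (Icc 0 1) t :=
  hasDerivWithinAt_of_contDiffOn (U.contDiffOn_lamv (1, 0)) s ht

/-- The identity `u^*dλ = d(u^*λ)`, in which the Floer equation turns `Ω(∂_s u, ∂_t u)` into
`dH(∂_s u) - |∂_s u|²`. -/
theorem α_s_sub_γ_t (s : ℝ) {t : ℝ} (ht : t ∈ Icc (0 : ℝ) 1) :
    U.α_s s t - U.γ_t s t = dW (F.H s) (U.u (s, t)) (U.us s t) - U.e s t := by
  have hp : (s, t) ∈ stripDomain := ⟨mem_univ _, ht⟩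
  have h1 := fderivWithin_pullbackWithin_sub C.smooth_lam U.smooth uniqueDiffOn_stripDomain hp
    (mem_closure_interior_stripDomain hp) (1, 0) (0, 1)
  have h2 := contDiffOn_pullbackWithin C.smooth_lam U.smooth uniqueDiffOn_stripDomain
  have h3 := ((h2 (s, t) hp).differentiableWithinAt (by simp)).hasFDerivWithinAt
  have h4 : ∀ v w : ℝ × ℝ, fderivWithin ℝ (pullbackWithin C.lam U.u stripDomain) stripDomain (s, t) v w =
      fderivWithin ℝ (fun p => C.lamv (U.u p) (U.du p w)) stripDomain (s, t) v := by
    intro v w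
    have h5 := (h3.clm_apply (hasFDerivWithinAt_const w (s, t) stripDomain)).fderivWithin
      (uniqueDiffOn_stripDomain _ hp)
    have h6 := congrArg (fun D : ℝ × ℝ →L[ℝ] ℝ => D v) h5
    refine Eq.trans ?_ h6.symm
    simp
  rw [h4, h4] at h1
  have h5 : U.α_s s t - U.γ_t s t = C.Om (U.u (s, t)) (U.us s t) (U.ut s t) := h1
  rw [h5, U.ut_eq s ht, map_sub, (F.J s t).Om_hamv]
  rfl

theorem continuousOn_γ_t : ContinuousOn (fun p : ℝ × ℝ => U.γ_t p.1 p.2) stripDomain :=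
  ((U.contDiffOn_lamv (1, 0)).continuousOn_fderivWithin uniqueDiffOn_stripDomain (by simp)).clm_apply
    continuousOn_const

/-- The Lagrangian boundary condition, in the form in which it is used. -/
theorem γ_eq_zero [CompactSpace L] [T2Space M] [T2Space W] [Nonempty N] [CompactSpace M]
    {t : ℝ} (ht : t ∈ Icc (0 : ℝ) 1) (hL : ∀ s, U.u (s, t) ∈ C.Lhat) (s : ℝ) : U.γ s t = 0 :=
  lamv_eq_zero_of_mem_Lhat (F.J 0 0) (w := fun s => U.u (s, t)) (v := fun s => U.us s t)
    (fun s => U.hasMFDerivAt_s s ht) hL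
    ((U.contDiffOn_lamv (1, 0)).continuousOn.comp_continuous (f := fun s : ℝ => (s, t))
      (by fun_prop) fun s => ⟨mem_univ _, ht⟩) s

end Strip
end FloerFamily

end

/-! ### Strips near infinity -/

section

namespace FloerFamily.Strip

variable {C : Completion Q W} {F : FloerFamily C} (U : F.Strip)

theorem hasDerivAt_H (s : ℝ) {t : ℝ} (ht : t ∈ Icc (0 : ℝ) 1) :
    HasDerivAt (fun σ => F.H σ (U.u (σ, t))) (deriv (fun σ => F.H σ (U.u (s, t))) s +
      dW (F.H s) (U.u (s, t)) (U.us s t)) s := by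
  have h1 : MDifferentiableAt (𝓘(ℝ, ℝ).prod (𝓡 (2 * n))) 𝓘(ℝ, ℝ) (fun p : ℝ × W => F.H p.1 p.2)
      (s, U.u (s, t)) := F.smooth_H.mdifferentiableAt (by simp)
  have h2 := hasDerivWithinAt_comp_prod h1 rfl (U.hasMFDerivAt_s s ht).hasMFDerivWithinAt (S := univ)
  rw [dProd_one h1] at h2
  exact h2.hasDerivAt univ_mem

variable [T2Space W]

/-- The function `r = H - b` along the strip, which measures how far out on the end the point is. -/
def f (s t : ℝ) : ℝ := F.r s (U.u (s, t))

variable [Nonempty N]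

theorem contMDiffOn_f : ContMDiffOn 𝓘(ℝ, ℝ × ℝ) 𝓘(ℝ, ℝ) ∞ (fun p : ℝ × ℝ => U.f p.1 p.2) stripDomain :=
  F.contMDiff_r.comp_contMDiffOn (f := fun p : ℝ × ℝ => (p.1, U.u p))
    (contDiff_fst.contMDiff.contMDiffOn.prodMk U.smooth)

/-- The logarithmic derivative of the slope, along the strip. -/
def b (s t : ℝ) : ℝ := F.G s (C.pr (U.u (s, t))).1

/-- The derivative of `b` with respect to the parameter of the family. -/
def b_s (s t : ℝ) : ℝ := deriv (fun σ => F.G σ (C.pr (U.u (s, t))).1) s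

/-- The derivative of `b` in the direction of `∂_s u`. -/
def b_u (s t : ℝ) : ℝ := dW (fun x => F.G s (C.pr x).1) (U.u (s, t)) (U.us s t)

variable {s t : ℝ} {z : N} {ρ : ℝ}

theorem dW_us (ht : t ∈ Icc (0 : ℝ) 1) (hρ : F.R₀ < ρ) (hx : C.cyl z ρ = U.u (s, t)) :
    dW (F.H s) (U.u (s, t)) (U.us s t) = (U.f s t - U.α s t) / F.m s t := by
  obtain ⟨hm, q, hq⟩ := F.exists_conicalAt s ht
  have h1 := (hq z ρ hρ).2.1
  rw [← F.r_cyl s hρ, hx] at h1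
  rw [U.us_eq s ht, h1.dW_Jv, map_sub, h1.lamv_hamv, α, f]
  field_simp
  ring

theorem hasDerivAt_f (ht : t ∈ Icc (0 : ℝ) 1) (hρ : F.R₀ < ρ) (hx : C.cyl z ρ = U.u (s, t)) :
    HasDerivAt (fun σ => U.f σ t) (U.b s t * U.f s t + (U.f s t - U.α s t) / F.m s t) s := by
  have h1 : MDifferentiableAt (𝓘(ℝ, ℝ).prod (𝓡 (2 * n))) 𝓘(ℝ, ℝ) (fun p : ℝ × W => F.r p.1 p.2)
      (s, U.u (s, t)) := F.contMDiff_r.mdifferentiableAt (by simp)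
  have h2 := hasDerivWithinAt_comp_prod h1 rfl (U.hasMFDerivAt_s s ht).hasMFDerivWithinAt (S := univ)
  rw [dProd_one h1] at h2
  have h3 : dM (𝓡 (2 * n)) (F.r s) (U.u (s, t)) (U.us s t) = (U.f s t - U.α s t) / F.m s t := by
    rw [← U.dW_us ht hρ hx, ← F.dW_r s]; rfl
  have hR := F.one_le_R₀
  have h4 : deriv (fun σ => F.r σ (U.u (s, t))) s = U.b s t * U.f s t := by
    have h5 : (fun σ => F.r σ (U.u (s, t))) = fun σ => F.a σ z * ρ := by
      ext σ; rw [← hx, F.r_cyl σ hρ]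
    rw [h5, deriv_mul_const_field, b, f, ← hx, C.pr_cyl (by linarith), F.r_cyl s hρ, G]
    have := (F.a_pos s z).ne'
    field_simp
  refine (h2.hasDerivAt univ_mem).congr_deriv ?_
  rw [← h4, ← h3]

theorem hasDerivWithinAt_f (s : ℝ) (ht : t ∈ Icc (0 : ℝ) 1) :
    HasDerivWithinAt (fun τ => U.f s τ) (dW (F.H s) (U.u (s, t)) (U.ut s t)) (Icc 0 1) t := by
  have h0 : MDifferentiableAt (𝓡 (2 * n)) 𝓘(ℝ, ℝ) (F.r s) (U.u (s, t)) :=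
    (ContMDiff.comp (f := fun x : W => (s, x)) F.contMDiff_r
      (contMDiff_const.prodMk contMDiff_id)).mdifferentiableAt (by simp)
  have h2 := hasDerivWithinAt_dM_comp (I := 𝓡 (2 * n)) (G := F.r s) (y := fun τ => U.u (s, τ)) h0
    (U.hasMFDerivWithinAt_t s ht)
  rw [← F.dW_r]
  exact h2

theorem dW_ut (ht : t ∈ Icc (0 : ℝ) 1) (hρ : F.R₀ < ρ) (hx : C.cyl z ρ = U.u (s, t)) :
    dW (F.H s) (U.u (s, t)) (U.ut s t) = U.γ s t / F.m s t := by
  obtain ⟨hm, q, hq⟩ := F.exists_conicalAt s ht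
  have h1 := (hq z ρ hρ).2.1
  rw [← F.r_cyl s hρ, hx] at h1
  rw [U.ut_eq s ht, map_sub, h1.dW_Jv, (F.J s t).dW_hamv, γ]
  field_simp
  ring

theorem γ_sq_le (ht : t ∈ Icc (0 : ℝ) 1) (hρ : F.R₀ < ρ) (hx : C.cyl z ρ = U.u (s, t)) :
    U.γ s t ^ 2 ≤ F.m s t * U.f s t * U.e s t := by
  obtain ⟨hm, q, hq⟩ := F.exists_conicalAt s ht
  have h1 := (hq z ρ hρ).2.1
  rw [← F.r_cyl s hρ, hx] at h1
  have h2 := h1.lamv_sq_le (U.us s t)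
  rwa [inv_inv] at h2

variable [CompactSpace M]

theorem hasDerivAt_b (ht : t ∈ Icc (0 : ℝ) 1) (hρ : F.R₀ < ρ) (hx : C.cyl z ρ = U.u (s, t)) :
    HasDerivAt (fun σ => U.b σ t) (U.b_s s t + U.b_u s t) s := by
  have hR := F.one_le_R₀
  have h0 : U.u (s, t) ∈ (range C.incl)ᶜ := by
    rw [← hx]; exact C.disjoint z ρ (by linarith)
  have h1 : MDifferentiableAt (𝓘(ℝ, ℝ).prod (𝓡 (2 * n))) 𝓘(ℝ, ℝ)
      (fun p : ℝ × W => F.G p.1 (C.pr p.2).1) (s, U.u (s, t)) := by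
    have h2 : ContMDiffAt (𝓡 (2 * n)) (𝓡 (2 * n - 1)) ∞ (fun x => (C.pr x).1) (U.u (s, t)) :=
      ContMDiffAt.comp (f := C.pr) _ contMDiffAt_fst (contMDiffAt_pr_of_notMem (F.J 0 0) h0)
    have h3 : ContMDiffAt (𝓘(ℝ, ℝ).prod (𝓡 (2 * n))) (𝓘(ℝ, ℝ).prod (𝓡 (2 * n - 1))) ∞
        (fun p : ℝ × W => (p.1, (C.pr p.2).1)) (s, U.u (s, t)) :=
      contMDiffAt_fst.prodMk (ContMDiffAt.comp (f := fun p : ℝ × W => p.2) (s, U.u (s, t)) h2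
        contMDiffAt_snd)
    exact (ContMDiffAt.comp (f := fun p : ℝ × W => (p.1, (C.pr p.2).1)) (s, U.u (s, t))
      F.contMDiff_G.contMDiffAt h3).mdifferentiableAt (by simp)
  have h2 := hasDerivWithinAt_comp_prod h1 rfl (U.hasMFDerivAt_s s ht).hasMFDerivWithinAt (S := univ)
  rw [dProd_one h1] at h2
  exact h2.hasDerivAt univ_mem

variable [CompactSpace N] [CompactSpace L] [T2Space M]

/-- The part of the energy density that comes from the derivative of `f`. -/
theorem energy_ge (ht : t ∈ Icc (0 : ℝ) 1) (hρ : F.R₀ < ρ) (hx : C.cyl z ρ = U.u (s, t)) :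
    (U.f s t - U.α s t) ^ 2 / (F.m s t * U.f s t) ≤ U.e s t := by
  obtain ⟨c, hc, h⟩ := F.exists_sq_dW_comp_pr_le |s| F.contMDiff_G
  have h1 := h s ⟨neg_abs_le s, le_abs_self s⟩ t ht z ρ hρ (U.us s t)
  have hm := F.m_pos s ht
  have hf : 0 < F.a s z * ρ := mul_pos (F.a_pos s z) (by linarith [F.one_le_R₀])
  rw [← F.r_cyl s hρ, hx] at h1 hf
  rw [U.dW_us ht hρ hx] at h1
  have h2 : F.m s t * ((U.f s t - U.α s t) / F.m s t) ^ 2 / F.r s (U.u (s, t)) =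
      (U.f s t - U.α s t) ^ 2 / (F.m s t * U.f s t) := by
    rw [f]; field_simp
  rw [h2] at h1
  have h3 := nonneg_of_mul_nonneg_right ((mul_nonneg (sq_nonneg _) hf.le).trans h1) hc
  exact sub_nonneg.1 h3

open Classical in
/-- The energy density without the part that comes from the derivative of `f`, divided by `f`. It is set
to zero where `f ≤ r₀`, where it has no meaning. -/
def κ (r₀ s t : ℝ) : ℝ :=
  if r₀ < U.f s t then (U.e s t - (U.f s t - U.α s t) ^ 2 / (F.m s t * U.f s t)) / U.f s t else 0

/-- The functions that describe the behaviour of a strip at infinity. -/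
def stripData {r₀ : ℝ} (hr₀ : 0 < r₀)
    (hlev : ∀ s x, r₀ < F.r s x → ∃ z ρ, F.R₀ < ρ ∧ C.cyl z ρ = x) : StripData where
  f := U.f
  α := U.α
  γ := U.γ
  e := U.e
  m := F.m
  b := U.b
  m_s := fun s t => deriv (fun σ => F.m σ t) s
  b_s := U.b_s
  b_u := U.b_u
  κ := U.κ r₀
  r₀ := r₀
  r₀_pos := hr₀
  continuousOn_f := U.contMDiffOn_f.continuousOn
  m_pos := fun s t ht => F.m_pos s ht
  f_s := fun s t ht hf => by
    obtain ⟨z, ρ, hρ, hx⟩ := hlev s _ hf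
    exact U.hasDerivAt_f ht hρ hx
  f_t := fun s t ht hf => by
    obtain ⟨z, ρ, hρ, hx⟩ := hlev s _ hf
    rw [← U.dW_ut ht hρ hx]
    exact U.hasDerivWithinAt_f s ht
  curl := fun s t ht hf => by
    obtain ⟨z, ρ, hρ, hx⟩ := hlev s _ hf
    refine ⟨_, _, U.hasDerivAt_α s ht, U.hasDerivWithinAt_γ s ht, ?_⟩
    rw [U.α_s_sub_γ_t s ht, U.dW_us ht hρ hx]
  hasDerivAt_m := fun s t ht => (F.hasDerivAt_m s ht).differentiableAt.hasDerivAt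
  differentiable_m := fun s t ht =>
    (hasDerivWithinAt_of_contDiffOn F.contDiffOn_m s ht).differentiableWithinAt
  hasDerivAt_b := fun s t ht hf => by
    obtain ⟨z, ρ, hρ, hx⟩ := hlev s _ hf
    exact U.hasDerivAt_b ht hρ hx
  κ_nonneg := fun s t ht => by
    rw [κ]
    split_ifs with hf
    · obtain ⟨z, ρ, hρ, hx⟩ := hlev s _ hf
      exact div_nonneg (sub_nonneg.2 (U.energy_ge ht hρ hx)) (hr₀.trans hf).le
    · exact le_rfl
  energy := fun s t ht hf => by
    rw [κ, if_pos hf, mul_div_cancel₀ _ (hr₀.trans hf).ne']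
    simp
  γ_zero := U.γ_eq_zero (by simp) fun s => (U.boundary s).1
  γ_one := U.γ_eq_zero (by simp) fun s => (U.boundary s).2

/-- The derivative of `b` along the strip is controlled by the energy density, because `b` is a function
on `N` and the metric scales. -/
theorem b_u_sq_le {r₀ : ℝ} (hr₀ : 0 < r₀)
    (hlev : ∀ s x, r₀ < F.r s x → ∃ z ρ, F.R₀ < ρ ∧ C.cyl z ρ = x) {c : ℝ}
    (hc : ∀ z ρ, F.R₀ < ρ → ∀ v,
      dW (fun x => F.G s (C.pr x).1) (C.cyl z ρ) v ^ 2 * (F.a s z * ρ) ≤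
        c * ((F.J s t).nsq (C.cyl z ρ) v -
          F.m s t * dW (F.H s) (C.cyl z ρ) v ^ 2 / (F.a s z * ρ)))
    (ht : t ∈ Icc (0 : ℝ) 1) (hf : r₀ < U.f s t) : U.b_u s t ^ 2 ≤ c * U.κ r₀ s t := by
  obtain ⟨z, ρ, hρ, hx⟩ := hlev s _ hf
  have h1 := hc z ρ hρ (U.us s t)
  have hm := F.m_pos s ht
  have hf0 : 0 < U.f s t := hr₀.trans hf
  rw [← F.r_cyl s hρ, hx, U.dW_us ht hρ hx] at h1
  change U.b_u s t ^ 2 * U.f s t ≤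
    c * (U.e s t - F.m s t * ((U.f s t - U.α s t) / F.m s t) ^ 2 / U.f s t) at h1
  have h2 : F.m s t * ((U.f s t - U.α s t) / F.m s t) ^ 2 / U.f s t =
      (U.f s t - U.α s t) ^ 2 / (F.m s t * U.f s t) := by
    field_simp
  rw [h2] at h1
  rw [κ, if_pos hf, ← mul_div_assoc, le_div_iff₀ hf0]
  exact h1

end FloerFamily.Strip

end

/-! ### Action, energy and slices -/

section

namespace FloerFamily

variable {C : Completion Q W} {F : FloerFamily C} [T2Space W] [Nonempty N] [CompactSpace N]
  [CompactSpace M]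

/-- The sublevel sets of `r` are relatively compact, uniformly in the parameter. -/
theorem exists_isCompact_sublevel (F : FloerFamily C) (R : ℝ) :
    ∃ Z : Set W, IsCompact Z ∧ ∀ s x, F.r s x ≤ R → x ∈ Z := by
  obtain ⟨a₁, a₂, ha₁, ha⟩ := F.exists_a_bounds
  refine ⟨_, isCompact_core C (max F.R₀ (R / a₁)), fun s x hx => ?_⟩
  refine (mem_core_or C (max F.R₀ (R / a₁)) x).resolve_right ?_
  rintro ⟨z, ρ, hρ, rfl⟩
  have h1 : F.R₀ < ρ := (le_max_left _ _).trans_lt hρ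
  have h2 : R / a₁ < ρ := (le_max_right _ _).trans_lt hρ
  rw [F.r_cyl s h1] at hx
  rw [div_lt_iff₀ ha₁] at h2
  have h3 : a₁ * ρ ≤ F.a s z * ρ :=
    mul_le_mul_of_nonneg_right (ha s z).1 (by linarith [F.one_le_R₀])
  linarith

theorem abs_le_add_div {l c e x : ℝ} (hx : 0 < x) (h : l ^ 2 ≤ c * e) : |l| ≤ x + c * e / x := by
  rcases le_or_gt |l| x with h1 | h1
  · have : 0 ≤ c * e / x := div_nonneg ((sq_nonneg l).trans h) hx.le
    linarith
  · have h2 : |l| * x ≤ c * e := by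
      refine le_trans ?_ h
      rw [← sq_abs, sq]
      exact mul_le_mul_of_nonneg_left h1.le (abs_nonneg _)
    have := (le_div_iff₀ hx).2 h2
    linarith

namespace Strip

variable (U : F.Strip)

/-- The action of the curve `u(s, ·)`, with the sign for which it increases along strips. -/
def action (s : ℝ) : ℝ := ∫ t in (0 : ℝ)..1, (F.H s (U.u (s, t)) - U.α s t)

/-- The energy `∫ |∂_s u|²` of the curve `u(s, ·)`. -/
def energy (s : ℝ) : ℝ := ∫ t in (0 : ℝ)..1, U.e s t

theorem continuousOn_slice {g : ℝ → ℝ → ℝ} (hg : ContinuousOn (fun p : ℝ × ℝ => g p.1 p.2) stripDomain)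
    (s : ℝ) : ContinuousOn (g s) (Icc 0 1) :=
  hg.comp (f := fun t : ℝ => (s, t)) (by fun_prop) fun t ht => ⟨mem_univ _, ht⟩

theorem continuousOn_H : ContinuousOn (fun p : ℝ × ℝ => F.H p.1 (U.u (p.1, p.2))) stripDomain :=
  F.smooth_H.continuous.comp_continuousOn (f := fun p : ℝ × ℝ => (p.1, U.u p))
    (continuousOn_fst.prodMk U.smooth.continuousOn)

theorem energy_nonneg (s : ℝ) : 0 ≤ U.energy s :=
  intervalIntegral.integral_nonneg zero_le_one fun t _ => U.e_nonneg s t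

theorem integral_γ_t [CompactSpace L] [T2Space M] (s : ℝ) : ∫ t in (0 : ℝ)..1, U.γ_t s t = 0 := by
  have h1 : ContinuousOn (U.γ s) (Icc 0 1) := fun t ht =>
    (U.hasDerivWithinAt_γ s ht).continuousWithinAt
  rw [intervalIntegral.integral_eq_sub_of_hasDerivAt_of_le zero_le_one h1
    (fun t ht => (U.hasDerivWithinAt_γ s (Ioo_subset_Icc_self ht)).hasDerivAt (Icc_mem_nhds ht.1 ht.2))
    ((continuousOn_slice U.continuousOn_γ_t s).intervalIntegrable_of_Icc zero_le_one),
    U.γ_eq_zero (by simp) (fun s => (U.boundary s).1),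
    U.γ_eq_zero (by simp) (fun s => (U.boundary s).2), sub_zero]

/-- The action increases at least as fast as the energy: its derivative is `∫ (∂_s H + |∂_s u|²)`. -/
theorem exists_hasDerivAt_action [CompactSpace L] [T2Space M] (s : ℝ) :
    ∃ A', HasDerivAt U.action A' s ∧ U.energy s ≤ A' := by
  have hdH : ContinuousOn (fun p : ℝ × ℝ => deriv (fun σ => F.H σ (U.u (p.1, p.2))) p.1)
      stripDomain := by
    have h1 := contMDiffOn_deriv_slice isOpen_univ (F.smooth_H.contMDiffOn (s := univ ×ˢ univ))
    exact h1.continuousOn.comp (f := fun p : ℝ × ℝ => (p.1, U.u p))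
      (continuousOn_fst.prodMk U.smooth.continuousOn) fun p _ => ⟨mem_univ _, mem_univ _⟩
  have h1 := hasDerivAt_integral_of_continuousOn
    (h := fun s t => F.H s (U.u (s, t)) - U.α s t)
    (h' := fun s t => deriv (fun σ => F.H σ (U.u (s, t))) s + U.e s t - U.γ_t s t)
    (continuousOn_slice (U.continuousOn_H.sub (U.contDiffOn_lamv (0, 1)).continuousOn))
    (fun s t ht => ((U.hasDerivAt_H s ht).sub (U.hasDerivAt_α s ht)).congr_deriv (by
      have := U.α_s_sub_γ_t s ht
      linarith))
    ((hdH.add U.continuousOn_e).sub U.continuousOn_γ_t) s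
  refine ⟨_, h1, ?_⟩
  have i1 := (continuousOn_slice (g := fun s t =>
    deriv (fun σ => F.H σ (U.u (s, t))) s + U.e s t) (hdH.add U.continuousOn_e) s).intervalIntegrable_of_Icc
    (μ := MeasureTheory.volume) zero_le_one
  have i2 := (continuousOn_slice U.continuousOn_γ_t s).intervalIntegrable_of_Icc
    (μ := MeasureTheory.volume) zero_le_one
  have i3 := (continuousOn_slice U.continuousOn_e s).intervalIntegrable_of_Icc
    (μ := MeasureTheory.volume) zero_le_one
  have h2 : ∫ t in (0 : ℝ)..1, (deriv (fun σ => F.H σ (U.u (s, t))) s + U.e s t - U.γ_t s t) =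
      ∫ t in (0 : ℝ)..1, (deriv (fun σ => F.H σ (U.u (s, t))) s + U.e s t) := by
    refine (intervalIntegral.integral_sub i1 i2).trans ?_
    rw [U.integral_γ_t, sub_zero]
  rw [h2]
  refine intervalIntegral.integral_mono_on zero_le_one i3 i1 fun t _ => ?_
  linarith [F.monotone s (U.u (s, t))]

end Strip

/-- The action of a curve in a compact set is bounded in terms of the energy. The free parameter `x` takes
the place of a square root. -/
theorem exists_abs_action_le (F : FloerFamily C) {Z : Set W} (hZ : IsCompact Z) : ∃ c : ℝ, 0 < c ∧
    ∀ (U : F.Strip) (s : ℝ), (∀ t ∈ Icc (0 : ℝ) 1, U.u (s, t) ∈ Z) → ∀ x > 0,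
      |U.action s| ≤ c * (1 + x + U.energy s / x) := by
  obtain ⟨c₁, hc₁, h₁⟩ := F.exists_lamv_sq_le hZ
  obtain ⟨c₂, hc₂, h₂⟩ := F.exists_nsq_hamv_le hZ
  obtain ⟨B, hB⟩ := ((isCompact_Icc (a := -F.s₀) (b := F.s₀)).prod hZ).exists_bound_of_continuousOn
    F.smooth_H.continuous.continuousOn
  obtain ⟨c, hc⟩ : ∃ c, c = |B| + (c₁ * c₂ + 1) + 1 + c₁ := ⟨_, rfl⟩
  have hc0 : 0 < c := by rw [hc]; positivity
  refine ⟨c, hc0, fun U s hU x hx => ?_⟩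
  -- the integrand, with `∂_t u = X_H - J ∂_s u`
  have key : ∀ t ∈ Icc (0 : ℝ) 1, |F.H s (U.u (s, t)) - U.α s t| ≤ c * (1 + x + U.e s t / x) := by
    intro t ht
    have k1 : |F.H s (U.u (s, t))| ≤ |B| := by
      rw [F.H_clamp]
      exact (hB (F.clamp s, U.u (s, t)) ⟨F.clamp_mem s, hU t ht⟩).trans (le_abs_self B)
    have k2 : |C.lamv (U.u (s, t)) (C.hamv (F.H s) (U.u (s, t)))| ≤ 1 + c₁ * c₂ / 1 := by
      refine abs_le_add_div one_pos ((h₁ s t ht _ (hU t ht) _).trans ?_)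
      exact mul_le_mul_of_nonneg_left (h₂ s t ht _ (hU t ht)) hc₁.le
    have k3 : |C.lamv (U.u (s, t)) ((F.J s t).Jv (U.u (s, t)) (U.us s t))| ≤
        x + c₁ * U.e s t / x := by
      refine abs_le_add_div hx ((h₁ s t ht _ (hU t ht) _).trans ?_)
      rw [(F.J s t).nsq_Jv]
      exact le_rfl
    have k4 : U.α s t = C.lamv (U.u (s, t)) (C.hamv (F.H s) (U.u (s, t))) -
        C.lamv (U.u (s, t)) ((F.J s t).Jv (U.u (s, t)) (U.us s t)) := by
      rw [Strip.α, U.ut_eq s ht, map_sub]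
    have k5 : |F.H s (U.u (s, t)) - U.α s t| ≤ |B| + (1 + c₁ * c₂ / 1) + (x + c₁ * U.e s t / x) := by
      rw [k4]
      refine (abs_sub _ _).trans ?_
      have := abs_sub (C.lamv (U.u (s, t)) (C.hamv (F.H s) (U.u (s, t))))
        (C.lamv (U.u (s, t)) ((F.J s t).Jv (U.u (s, t)) (U.us s t)))
      linarith
    refine k5.trans ?_
    have he : 0 ≤ U.e s t / x := div_nonneg (U.e_nonneg s t) hx.le
    rw [div_one, mul_div_assoc]
    have m1 : |B| + (1 + c₁ * c₂) ≤ c := by rw [hc]; linarith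
    have m2 : 1 * x ≤ c * x := mul_le_mul_of_nonneg_right (by
      rw [hc]; have := abs_nonneg B; have := mul_pos hc₁ hc₂; linarith) hx.le
    have m3 : c₁ * (U.e s t / x) ≤ c * (U.e s t / x) := mul_le_mul_of_nonneg_right (by
      rw [hc]; have := abs_nonneg B; have := mul_pos hc₁ hc₂; linarith) he
    linarith
  have i1 : ContinuousOn (fun t => F.H s (U.u (s, t)) - U.α s t) (Icc 0 1) :=
    Strip.continuousOn_slice (g := fun s t => F.H s (U.u (s, t)) - U.α s t)
      (U.continuousOn_H.sub (U.contDiffOn_lamv (0, 1)).continuousOn) s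
  have i2 : ContinuousOn (U.e s) (Icc 0 1) := Strip.continuousOn_slice U.continuousOn_e s
  have i3 : IntervalIntegrable (U.e s) MeasureTheory.volume 0 1 :=
    i2.intervalIntegrable_of_Icc zero_le_one
  refine (intervalIntegral.abs_integral_le_integral_abs zero_le_one).trans ?_
  refine (intervalIntegral.integral_mono_on zero_le_one
    (i1.abs.intervalIntegrable_of_Icc zero_le_one)
    (((i2.div_const x).const_add (1 + x)).const_mul c |>.intervalIntegrable_of_Icc zero_le_one)
    key).trans (le_of_eq ?_)
  rw [intervalIntegral.integral_const_mul, intervalIntegral.integral_add intervalIntegrable_const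
    (i3.div_const x), intervalIntegral.integral_div]
  simp [Strip.energy]

/-- Strips that stay in a given compact set near the two ends have, in each interval of length one, a
slice with an energy bound that does not depend on the strip. Only `C⁰` control near the ends is
needed: the action is bounded by the Riccati argument, even though `∂_t u` might not converge. -/
theorem exists_energy_bound [CompactSpace L] [T2Space M] (F : FloerFamily C) {Z : Set W}
    (hZ : IsCompact Z) : ∃ E₀ : ℝ, ∀ U : F.Strip,
      (∀ᶠ s in atTop, ∀ t ∈ Icc (0 : ℝ) 1, U.u (s, t) ∈ Z) →
      (∀ᶠ s in atBot, ∀ t ∈ Icc (0 : ℝ) 1, U.u (s, t) ∈ Z) →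
      ∀ s, ∃ σ ∈ Ioo s (s + 1), U.energy σ ≤ E₀ := by
  obtain ⟨c, hc, h⟩ := F.exists_abs_action_le hZ
  refine ⟨4 * c, fun U hT hB s => ?_⟩
  choose A' hA' hE using U.exists_hasDerivAt_action
  have hA'0 : ∀ s, 0 ≤ A' s := fun s => (U.energy_nonneg s).trans (hE s)
  have hmono : ∀ s, ∀ x > 0, c * (1 + x + U.energy s / x) ≤ c * (1 + x + A' s / x) :=
    fun s x hx => mul_le_mul_of_nonneg_left
      (by have := div_le_div_of_nonneg_right (hE s) hx.le; linarith) hc.le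
  obtain ⟨S₁, hS₁⟩ := eventually_atTop.1 hT
  obtain ⟨S₂, hS₂⟩ := eventually_atBot.1 hB
  have hup : ∀ s, U.action s ≤ 2 * c := le_of_riccati hc hA' hA'0 (S := S₁) fun s hs x hx =>
    ((le_abs_self _).trans (h U s (hS₁ s hs) x hx)).trans (hmono s x hx)
  -- the lower bound is the same argument for `-A(-s)`
  have hlow : ∀ s, -U.action (-s) ≤ 2 * c := by
    refine le_of_riccati (A := fun s => -U.action (-s)) (A' := fun s => A' (-s)) hc (fun s => ?_)
      (fun s => hA'0 _) (S := -S₂) fun s hs x hx =>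
      ((neg_le_abs _).trans (h U (-s) (hS₂ (-s) (by linarith)) x hx)).trans (hmono (-s) x hx)
    have h1 := ((hA' (-s)).comp s (hasDerivAt_neg s)).neg
    exact h1.congr_deriv (by ring)
  -- a slice where the derivative of the action is its mean
  obtain ⟨σ, hσ, h1⟩ := exists_hasDerivAt_eq_slope U.action A' (show s < s + 1 by linarith)
    (fun τ _ => (hA' τ).continuousAt.continuousWithinAt) fun τ _ => hA' τ
  refine ⟨σ, hσ, (hE σ).trans ?_⟩
  have h2 := hlow (-s)
  rw [neg_neg] at h2
  rw [h1, add_sub_cancel_left, div_one]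
  linarith [hup (s + 1)]

/-- A bound for the strip on slices of bounded energy, where the family is constant: the slice comes below
a fixed level at one time, and the Gronwall estimate controls it at all other times. -/
theorem exists_slice_bound [T2Space N] [CompactSpace L] [T2Space M] (F : FloerFamily C) {s₁ : ℝ}
    (hs₁ : (1 : ℝ) ∉ Q.actionSpectrum (Q.scaledLam (F.a s₁))) (E₀ : ℝ) :
    ∃ R : ℝ, ∀ (U : F.Strip) (s : ℝ), F.clamp s = s₁ → U.energy s ≤ E₀ →
      ∀ t ∈ Icc (0 : ℝ) 1, U.f s t ≤ R := by
  obtain ⟨R, hR⟩ := F.exists_level_of_slice hs₁ E₀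
  obtain ⟨r₀, hr₀, hlev⟩ := F.exists_level
  obtain ⟨m₁, m₂, B, hm₁, hB, hm⟩ := F.exists_m_bounds
  have hmax0 : 0 ≤ max R r₀ := le_max_of_le_right hr₀.le
  refine ⟨(max R r₀ + 2 + E₀) * Real.exp (1 / m₁ + 1), fun U s hs hE => ?_⟩
  have hnsq : ∀ t ∈ Icc (0 : ℝ) 1, U.e s t = (F.J s₁ t).nsq (U.u (s, t)) (U.us s t) := by
    intro t ht
    rw [Strip.e, F.nsq_clamp s ht, hs]
  have hH : F.H s₁ = F.H s := by rw [F.H_clamp s, hs]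
  have hcont : ContinuousOn (U.e s) (Icc 0 1) := Strip.continuousOn_slice U.continuousOn_e s
  obtain ⟨t₀, ht₀, h0⟩ := hR (fun t => U.u (s, t)) (fun t => U.us s t) (fun t ht => by
      have h1 := U.hasMFDerivWithinAt_t s ht
      rw [U.ut_eq s ht, F.J_clamp s ht, hs, ← hH] at h1
      exact h1)
    (hcont.congr fun t ht => (hnsq t ht).symm)
    (by
      refine le_trans (le_of_eq ?_) hE
      refine intervalIntegral.integral_congr fun t ht => ?_
      rw [uIcc_of_le zero_le_one] at ht
      exact (hnsq t ht).symm) (U.boundary s).1 (U.boundary s).2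
  have h0' : U.f s t₀ ≤ max R r₀ := by
    refine le_max_of_le_left ?_
    rw [Strip.f, F.r_clamp s, hs]
    exact h0
  refine le_of_deriv_le_of_large hmax0 (by positivity) hcont (fun t _ => U.e_nonneg s t) hE
    (fun t ht => U.hasDerivWithinAt_f s ht) (fun t ht hf => ?_) ht₀ h0'
  have hf' : r₀ < U.f s t := (le_max_right _ _).trans_lt hf
  obtain ⟨z, ρ, hρ, hx⟩ := hlev s _ hf'
  have hmm := F.m_pos s ht
  have hff : 0 < U.f s t := hr₀.trans hf'
  have h1 := U.γ_sq_le ht hρ hx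
  rw [U.dW_ut ht hρ hx, abs_div, abs_of_pos hmm]
  -- the inequality between the arithmetic and the geometric mean
  have h2 : |U.γ s t| ≤ U.f s t + F.m s t * U.f s t * U.e s t / U.f s t :=
    abs_le_add_div hff h1
  have h3 : F.m s t * U.f s t * U.e s t / U.f s t = F.m s t * U.e s t := by field_simp
  rw [h3] at h2
  rw [div_le_iff₀ hmm]
  refine h2.trans ?_
  have h4 : U.f s t ≤ 1 / m₁ * U.f s t * F.m s t := by
    have h5 : 1 ≤ 1 / m₁ * F.m s t := by
      rw [one_div_mul_eq_div, one_le_div hm₁]; exact (hm s t ht).1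
    calc U.f s t = 1 * U.f s t := (one_mul _).symm
      _ ≤ (1 / m₁ * F.m s t) * U.f s t := mul_le_mul_of_nonneg_right h5 hff.le
      _ = _ := by ring
  linarith

/-- Chords stay below a fixed level: they are slices of energy zero, and the Hamiltonian is constant
along them. -/
theorem exists_chord_bound [T2Space N] [CompactSpace L] [T2Space M] (F : FloerFamily C) {s₁ : ℝ}
    (hs₁ : (1 : ℝ) ∉ Q.actionSpectrum (Q.scaledLam (F.a s₁))) :
    ∃ R : ℝ, ∀ x : ℝ → W, C.IsChord (F.H s₁) x → ∀ t ∈ Icc (0 : ℝ) 1, F.r s₁ (x t) ≤ R := by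
  obtain ⟨R, hR⟩ := F.exists_level_of_slice hs₁ 0
  refine ⟨R, fun x hx t ht => ?_⟩
  have hd : ∀ t ∈ Icc (0 : ℝ) 1, HasMFDerivWithinAt 𝓘(ℝ, ℝ) (𝓡 (2 * n)) x (Icc 0 1) t
      ((1 : ℝ →L[ℝ] ℝ).smulRight (C.hamv (F.H s₁) (x t))) := fun t ht => hx.eqn t ht
  have hz : ∀ t, (F.J s₁ t).nsq (x t) 0 = 0 := fun t => by simp [CompatibleACS.nsq]
  obtain ⟨t₀, ht₀, h0⟩ := hR x (fun _ => 0) (fun t ht => by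
      rw [map_zero, sub_zero]; exact hd t ht)
    (by simp only [hz]; exact continuousOn_const) (by simp only [hz]; simp) hx.left hx.right
  have hg : ∀ t ∈ Icc (0 : ℝ) 1, HasDerivWithinAt (fun τ => F.r s₁ (x τ)) 0 (Icc 0 1) t := by
    intro t ht
    have h1 : MDifferentiableAt (𝓡 (2 * n)) 𝓘(ℝ, ℝ) (F.r s₁) (x t) :=
      (ContMDiff.comp (f := fun x : W => (s₁, x)) F.contMDiff_r
        (contMDiff_const.prodMk contMDiff_id)).mdifferentiableAt (by simp)
    have h2 := hasDerivWithinAt_dM_comp (I := 𝓡 (2 * n)) (G := F.r s₁) h1 (hd t ht)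
    refine h2.congr_deriv ?_
    change dW (F.r s₁) (x t) (C.hamv (F.H s₁) (x t)) = 0
    rw [F.dW_r, (F.J s₁ 0).dW_hamv]
  have hconst : F.r s₁ (x t) = F.r s₁ (x t₀) := by
    have := (convex_Icc (0 : ℝ) 1).norm_image_sub_le_of_norm_hasDerivWithin_le (C := 0)
      (f' := fun _ => 0) hg (by simp) ht₀ ht
    simpa [sub_eq_zero] using this
  rw [hconst]
  exact h0

end FloerFamily

end

/-! ### The estimate for strips -/

section

theorem IsContactTypeHam.mono {C : Completion Q W} {K K' : Set W} {a : N → ℝ} {b : ℝ} {H : W → ℝ}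
    (h : C.IsContactTypeHam K a b H) (hK' : C.IsCore K') (hK : K ⊆ K') :
    C.IsContactTypeHam K' a b H :=
  ⟨hK', h.smooth, h.slope_smooth, h.slope_pos, fun z ρ hρ hz => h.eq z ρ hρ fun hz' => hz (hK hz')⟩

theorem CompatibleACS.IsContactType.mono {C : Completion Q W} {J : C.CompatibleACS} {K K' : Set W}
    {a : N → ℝ} (h : J.IsContactType K a) (hK' : C.IsCore K') (hK : K ⊆ K') :
    J.IsContactType K' a := by
  obtain ⟨-, ⟨Jinf, h1, h2⟩, c, hc, h3⟩ := h
  exact ⟨hK', ⟨Jinf, h1, fun z ρ hρ hz => h2 z ρ hρ fun hz' => hz (hK hz')⟩, c, hc,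
    fun z ρ hρ hz => h3 z ρ hρ fun hz' => hz (hK hz')⟩

theorem IsCore.union {C : Completion Q W} {K K' : Set W} (h : C.IsCore K) (h' : C.IsCore K') :
    C.IsCore (K ∪ K') :=
  ⟨h.1.union h'.1, h.2.trans subset_union_left⟩

/-- A Hamiltonian of contact type determines its slope. -/
theorem IsContactTypeHam.slope_unique [T2Space W] {C : Completion Q W} (J : C.CompatibleACS)
    {K K' : Set W} {a a' : N → ℝ} {b b' : ℝ} {H : W → ℝ} (h : C.IsContactTypeHam K a b H)
    (h' : C.IsContactTypeHam K' a' b' H) : a = a' := by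
  obtain ⟨R, hR, hK⟩ := C.exists_bound_of_isCompact J (h.core.union h'.core).1
  ext z
  have h1 : ∀ ρ, R < ρ → a z * ρ + b = a' z * ρ + b' := fun ρ hρ => by
    rw [← h.eq z ρ (by linarith) fun hz => hK z ρ hρ (Or.inl hz),
      ← h'.eq z ρ (by linarith) fun hz => hK z ρ hρ (Or.inr hz)]
  linarith [h1 (R + 1) (by linarith), h1 (R + 2) (by linarith)]

namespace FloerFamily

variable {C : Completion Q W} [T2Space W] [CompactSpace N] [CompactSpace M] [T2Space N]
  [CompactSpace L] [T2Space M]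

/-- The functions that describe the strip do not depend on the parameter outside `[-s₀, s₀]`. -/
theorem Strip.stationary [Nonempty N] {F : FloerFamily C} (U : F.Strip) {s t : ℝ}
    (ht : t ∈ Icc (0 : ℝ) 1) (hs : s < -F.s₀ ∨ F.s₀ < s) :
    U.b s t = 0 ∧ U.b_s s t = 0 ∧ U.b_u s t = 0 ∧ deriv (fun σ => F.m σ t) s = 0 := by
  refine ⟨?_, F.deriv_G_eq_zero hs _, ?_, F.deriv_m_eq_zero ht hs⟩
  · rw [Strip.b, F.G_eq_zero hs]; rfl
  · rw [Strip.b_u, F.G_eq_zero hs]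
    have h1 : mfderiv (𝓡 (2 * n)) 𝓘(ℝ, ℝ) (fun _ : W => (0 : ℝ)) (U.u (s, t)) = 0 :=
      mfderiv_const
    exact congrArg (fun D : EW n →L[ℝ] ℝ => D (U.us s t)) h1

/-- A uniform bound for strips whose levels are bounded near the two ends. Slices of bounded energy just
outside `[-s₀, s₀]` are bounded; the maximum principle bounds the strip between them, and, in its form
without loss of constants, on the two half-strips beyond them. -/
theorem exists_strip_bound [Nonempty N] (F : FloerFamily C) (R₁ : ℝ) : ∃ R : ℝ, ∀ U : F.Strip,
    (∀ᶠ s in atTop, ∀ t ∈ Icc (0 : ℝ) 1, U.f s t ≤ R₁) →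
    (∀ᶠ s in atBot, ∀ t ∈ Icc (0 : ℝ) 1, U.f s t ≤ R₁) →
    ∀ s, ∀ t ∈ Icc (0 : ℝ) 1, U.f s t ≤ R := by
  obtain ⟨Z, hZ, hZR⟩ := F.exists_isCompact_sublevel R₁
  obtain ⟨E₀, hE₀⟩ := F.exists_energy_bound hZ
  obtain ⟨R₂, hR₂⟩ := F.exists_slice_bound F.spectrum_left E₀
  obtain ⟨R₃, hR₃⟩ := F.exists_slice_bound F.spectrum_right E₀
  obtain ⟨r₀, hr₀, hlev⟩ := F.exists_level
  obtain ⟨B₁, hB₁, hG⟩ := F.exists_G_bound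
  obtain ⟨m₁, m₂, B₂, hm₁, hB₂, hm⟩ := F.exists_m_bounds
  obtain ⟨c, hc, hsc⟩ := F.exists_sq_dW_comp_pr_le (F.s₀ + 1) F.contMDiff_G
  obtain ⟨A, hA, hfac⟩ := StripData.exists_factor (max B₁ B₂) c m₁ m₂ (F.s₀ + 1)
    (le_max_of_le_left hB₁) hc.le hm₁
  obtain ⟨R', hR'⟩ : ∃ R', R' = max (max R₁ r₀) (max R₂ R₃) := ⟨_, rfl⟩
  have h1 : R₁ ≤ R' := by rw [hR']; exact le_max_of_le_left (le_max_left _ _)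
  have h2 : R₂ ≤ R' := by rw [hR']; exact le_max_of_le_right (le_max_left _ _)
  have h3 : R₃ ≤ R' := by rw [hR']; exact le_max_of_le_right (le_max_right _ _)
  have h0 : r₀ ≤ R' := by rw [hR']; exact le_max_of_le_left (le_max_right _ _)
  refine ⟨max R' (R' * A), fun U hT hB s t ht => ?_⟩
  have hTZ : ∀ᶠ s in atTop, ∀ t ∈ Icc (0 : ℝ) 1, U.u (s, t) ∈ Z :=
    hT.mono fun s hs t ht => hZR s _ (hs t ht)
  have hBZ : ∀ᶠ s in atBot, ∀ t ∈ Icc (0 : ℝ) 1, U.u (s, t) ∈ Z :=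
    hB.mono fun s hs t ht => hZR s _ (hs t ht)
  have hs₀ := F.s₀_pos
  obtain ⟨S₁, hS₁, hE₁⟩ := hE₀ U hTZ hBZ (-F.s₀ - 1)
  obtain ⟨S₂, hS₂, hE₂⟩ := hE₀ U hTZ hBZ F.s₀
  have hS₁' : S₁ < -F.s₀ := by linarith [hS₁.2]
  have hl : ∀ t ∈ Icc (0 : ℝ) 1, U.f S₁ t ≤ R' := fun t ht =>
    (hR₂ U S₁ (F.clamp_of_le hS₁'.le) hE₁ t ht).trans h2
  have hr : ∀ t ∈ Icc (0 : ℝ) 1, U.f S₂ t ≤ R' := fun t ht =>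
    (hR₃ U S₂ (F.clamp_of_ge hS₂.1.le) hE₂ t ht).trans h3
  let D := U.stripData hr₀ hlev
  rcases lt_or_ge s S₁ with hs | hs
  · obtain ⟨S, hS, hSs⟩ := (hB.and (eventually_le_atBot s)).exists
    exact le_max_of_le_left (D.le_of_stationary (hSs.trans hs.le) h0
      (fun t ht => (hS t ht).trans h1) hl
      (fun σ hσ τ hτ _ => U.stationary hτ (Or.inl (hσ.2.trans hS₁'))) s ⟨hSs, hs.le⟩ t ht)
  rcases lt_or_ge S₂ s with hs' | hs'
  · obtain ⟨S, hS, hSs⟩ := (hT.and (eventually_ge_atTop s)).exists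
    exact le_max_of_le_left (D.le_of_stationary (hs'.le.trans hSs) h0 hr
      (fun t ht => (hS t ht).trans h1)
      (fun σ hσ τ hτ _ => U.stationary hτ (Or.inr (hS₂.1.trans hσ.1))) s ⟨hs'.le, hSs⟩ t ht)
  · refine le_max_of_le_right (hfac D S₁ S₂ R' (by linarith [hS₁.1]) (hs.trans hs') hS₂.2.le h0 hl hr
      (fun σ hσ τ hτ hf => ⟨?_, ?_, ?_, ?_, (hm σ τ hτ).1, (hm σ τ hτ).2.1⟩) s ⟨hs, hs'⟩ t ht)
    · have hσ' : σ ∈ Icc (-(F.s₀ + 1)) (F.s₀ + 1) :=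
        ⟨by linarith [hS₁.1, hσ.1], by linarith [hS₂.2, hσ.2]⟩
      exact U.b_u_sq_le hr₀ hlev (hsc σ hσ' τ hτ) hτ hf
    · exact le_max_of_le_left (hG σ _).1
    · exact le_max_of_le_left (hG σ _).2
    · exact le_max_of_le_right (hm σ τ hτ).2.2

/-- The `C⁰` estimate for a family: chords are bounded, hence the strips are bounded near their ends, hence
everywhere. -/
theorem exists_isCompact_floerStrips (F : FloerFamily C) : ∃ B : Set W, IsCompact B ∧
    ∀ xm xp : ℝ → W, C.IsChord (F.H (-F.s₀)) xm → C.IsChord (F.H F.s₀) xp →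
    ∀ u : ℝ × ℝ → W, C.IsFloerStrip F.H F.J xm xp u → u '' (univ ×ˢ Icc 0 1) ⊆ B := by
  rcases isEmpty_or_nonempty N with hN | hN
  · refine ⟨range C.incl, isCompact_range C.incl_embedding.contMDiff.continuous, ?_⟩
    intro _ _ _ _ _ _ w _
    exact (C.cover w).resolve_right fun ⟨z, _⟩ => hN.elim z
  obtain ⟨R₁, hR₁⟩ := F.exists_chord_bound F.spectrum_left
  obtain ⟨R₂, hR₂⟩ := F.exists_chord_bound F.spectrum_right
  obtain ⟨R, hR⟩ := F.exists_strip_bound (max R₁ R₂ + 1)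
  obtain ⟨Z, hZ, hZR⟩ := F.exists_isCompact_sublevel R
  refine ⟨Z, hZ, ?_⟩
  rintro xm xp hm hp u hu _ ⟨⟨s, t⟩, ⟨-, ht⟩, rfl⟩
  have hopen : ∀ s₁ r : ℝ, IsOpen {x | F.r s₁ x < r} := fun s₁ r =>
    isOpen_lt (F.contMDiff_r.continuous.comp (Continuous.prodMk_right s₁)) continuous_const
  have hend : ∀ {l : Filter ℝ} {s₁ : ℝ} {x : ℝ → W}, (∀ᶠ s in l, F.clamp s = s₁) →
      (∀ t ∈ Icc (0 : ℝ) 1, Tendsto u (l ×ˢ 𝓝[Icc 0 1] t) (𝓝 (x t))) →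
      (∀ t ∈ Icc (0 : ℝ) 1, F.r s₁ (x t) ≤ max R₁ R₂) →
      ∀ᶠ s in l, ∀ t ∈ Icc (0 : ℝ) 1, F.r s (u (s, t)) ≤ max R₁ R₂ + 1 := by
    intro l s₁ x hl hlim hx
    filter_upwards [hl, eventually_forall_Icc_of_tendsto hlim (hopen s₁ (max R₁ R₂ + 1))
      fun t ht => (hx t ht).trans_lt (lt_add_one _)] with s h1 h2 t ht
    rw [F.r_clamp, h1]
    exact (h2 t ht).le
  exact hZR s _ (hR ⟨u, hu.smooth, hu.floer, hu.boundary⟩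
    (hend ((eventually_ge_atTop F.s₀).mono fun s hs => F.clamp_of_ge hs) hu.limit_pos
      fun t ht => (hR₂ xp hp t ht).trans (le_max_right _ _))
    (hend ((eventually_le_atBot (-F.s₀)).mono fun s hs => F.clamp_of_le hs) hu.limit_neg
      fun t ht => (hR₁ xm hm t ht).trans (le_max_left _ _)) s t ht)

end FloerFamily

section
variable {C : Completion Q W} [T2Space W]

/-- An admissible Hamiltonian gives a constant family. -/
theorem exists_floerFamily_const (H : C.AdmissibleHam) (J : ℝ → C.CompatibleACS)
    (hJ : SmoothACSFamily (fun _ t => J t))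
    (hK : ∃ K : Set W, ∀ t ∈ Icc (0 : ℝ) 1, (J t).IsContactType K H.slope) :
    ∃ F : FloerFamily C, F.H = (fun _ => H.toFun) ∧ F.J = fun _ t => J t := by
  obtain ⟨K, hK⟩ := hK
  obtain ⟨K', hK'⟩ := H.contactType
  have hc := (hK 0 (by simp)).1.union hK'.core
  exact ⟨{
    K := K ∪ K'
    H := fun _ => H.toFun
    a := fun _ => H.slope
    b := fun _ => H.const
    J := fun _ t => J t
    s₀ := 1
    s₀_pos := one_pos
    smooth_H := hK'.smooth.comp contMDiff_snd
    ham := fun _ => hK'.mono hc subset_union_right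
    smooth_J := hJ
    acs := fun _ t ht => (hK t ht).mono hc subset_union_left
    H_left := fun _ _ => rfl
    H_right := fun _ _ => rfl
    J_left := fun _ _ _ _ => rfl
    J_right := fun _ _ _ _ => rfl
    monotone := fun s x => by simp
    spectrum_left := H.one_notMem
    spectrum_right := H.one_notMem }, rfl, rfl⟩

theorem MonotoneHomotopy.deriv_nonneg {H H' : C.AdmissibleHam} (Hs : MonotoneHomotopy H H') (s : ℝ)
    (x : W) : 0 ≤ deriv (fun σ => Hs.toFun σ x) s := by
  obtain ⟨s₁, -, hl, hr, hm⟩ := Hs.monotone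
  -- the end points `s = ±s₁` belong to the constant parts, where one-sided derivatives decide
  have hd : DifferentiableAt ℝ (fun σ => Hs.toFun σ x) s :=
    ((ContMDiff.comp (f := fun s : ℝ => (s, x)) Hs.smooth
      (contMDiff_id.prodMk contMDiff_const)).contDiff).differentiable (by simp) s
  rcases le_or_gt s (-s₁) with h1 | h1
  · refine le_of_eq ?_
    rw [← hd.derivWithin (uniqueDiffOn_Iic s s self_mem_Iic)]
    have h3 : EqOn (fun σ => Hs.toFun σ x) (fun _ => H.toFun x) (Iic s) := fun σ hσ =>
      congrFun (hl σ (le_trans hσ h1)) x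
    rw [derivWithin_congr h3 (h3 self_mem_Iic)]
    simp
  rcases le_or_gt s₁ s with h2 | h2
  · refine le_of_eq ?_
    rw [← hd.derivWithin (uniqueDiffOn_Ici s s self_mem_Ici)]
    have h3 : EqOn (fun σ => Hs.toFun σ x) (fun _ => H'.toFun x) (Ici s) := fun σ hσ =>
      congrFun (hr σ (le_trans h2 hσ)) x
    rw [derivWithin_congr h3 (h3 self_mem_Ici)]
    simp
  · exact ((hm s ⟨h1, h2⟩).1 x).le

/-- A monotone homotopy gives a family. -/
theorem exists_floerFamily_homotopy {H H' : C.AdmissibleHam} (Hs : MonotoneHomotopy H H')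
    (J : ℝ → ℝ → C.CompatibleACS) (hJ : SmoothACSFamily J)
    (hs : ∃ s₀ > 0, ∀ t ∈ Icc (0 : ℝ) 1,
      (∀ s ≤ -s₀, J s t = J (-s₀) t) ∧ (∀ s ≥ s₀, J s t = J s₀ t))
    (hK : ∃ K : Set W, (∀ s, C.IsContactTypeHam K (Hs.slope s) (Hs.const s) (Hs.toFun s)) ∧
      ∀ s, ∀ t ∈ Icc (0 : ℝ) 1, (J s t).IsContactType K (Hs.slope s)) :
    ∃ F : FloerFamily C, F.H = Hs.toFun ∧ F.J = J ∧ F.H (-F.s₀) = H.toFun ∧ F.H F.s₀ = H'.toFun := by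
  obtain ⟨s₁, hs₁, hJs⟩ := hs
  obtain ⟨s₂, hs₂, hl, hr, -⟩ := Hs.monotone
  obtain ⟨K, hham, hacs⟩ := hK
  obtain ⟨K₁, hK₁⟩ := H.contactType
  obtain ⟨K₂, hK₂⟩ := H'.contactType
  obtain ⟨s₀, hs₀⟩ : ∃ s₀, s₀ = max s₁ s₂ := ⟨_, rfl⟩
  have h1 : s₁ ≤ s₀ := hs₀ ▸ le_max_left _ _
  have h2 : s₂ ≤ s₀ := hs₀ ▸ le_max_right _ _
  have hleft : ∀ s ≤ -s₀, Hs.toFun s = H.toFun := fun s h => hl s (by linarith)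
  have hright : ∀ s ≥ s₀, Hs.toFun s = H'.toFun := fun s h => hr s (by linarith)
  have hal : Hs.slope (-s₀) = H.slope := by
    refine (hham (-s₀)).slope_unique (J 0 0) (b' := H.const) (K' := K₁) ?_
    rw [hleft _ le_rfl]; exact hK₁
  have har : Hs.slope s₀ = H'.slope := by
    refine (hham s₀).slope_unique (J 0 0) (b' := H'.const) (K' := K₂) ?_
    rw [hright _ le_rfl]; exact hK₂
  exact ⟨{
    K := K
    H := Hs.toFun
    a := Hs.slope
    b := Hs.const
    J := J
    s₀ := s₀
    s₀_pos := hs₁.trans_le h1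
    smooth_H := Hs.smooth
    ham := hham
    smooth_J := hJ
    acs := hacs
    H_left := fun s h => (hleft s h).trans (hleft _ le_rfl).symm
    H_right := fun s h => (hright s h).trans (hright _ le_rfl).symm
    J_left := fun s h t ht => ((hJs t ht).1 s (by linarith)).trans
      ((hJs t ht).1 (-s₀) (by linarith)).symm
    J_right := fun s h t ht => ((hJs t ht).2 s (by linarith)).trans ((hJs t ht).2 s₀ h1).symm
    monotone := Hs.deriv_nonneg
    spectrum_left := hal ▸ H.one_notMem
    spectrum_right := har ▸ H'.one_notMem }, rfl, rfl, hleft _ le_rfl, hright _ le_rfl⟩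

end

end

end Completion
end Floer

end

/-- The `C⁰` estimate for Floer strips in the completion `W` of a Liouville quadruple: first for a
fixed admissible Hamiltonian, then for a monotone homotopy of Hamiltonians. -/
theorem theorem2p4 (n : ℕ) [NeZero n]
    (M : Type*) [TopologicalSpace M] [ChartedSpace (EuclideanHalfSpace (2 * n)) M]
    [IsManifold (𝓡∂ (2 * n)) ∞ M] [CompactSpace M] [T2Space M]
    (N : Type*) [TopologicalSpace N] [ChartedSpace (EuclideanSpace ℝ (Fin (2 * n - 1))) N]
    [IsManifold (𝓡 (2 * n - 1)) ∞ N] [CompactSpace N] [T2Space N]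
    (L : Type*) [TopologicalSpace L] [ChartedSpace (EuclideanHalfSpace n) L]
    [IsManifold (𝓡∂ n) ∞ L] [CompactSpace L] [T2Space L]
    (Q : Floer.LiouvilleQuadruple n M N L)
    (W : Type*) [TopologicalSpace W] [ChartedSpace (EuclideanSpace ℝ (Fin (2 * n))) W]
    [IsManifold (𝓡 (2 * n)) ∞ W] [T2Space W]
    (C : Floer.Completion Q W) :
    (∀ (H : C.AdmissibleHam) (J : ℝ → C.CompatibleACS),
      Floer.Completion.SmoothACSFamily (fun _ t => J t) →
      (∃ K : Set W, ∀ t ∈ Icc (0 : ℝ) 1, (J t).IsContactType K H.slope) →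
      ∃ B : Set W, IsCompact B ∧
        ∀ xm xp : ℝ → W, C.IsChord H.toFun xm → C.IsChord H.toFun xp →
        ∀ u : ℝ × ℝ → W, C.IsFloerStrip (fun _ => H.toFun) (fun _ t => J t) xm xp u →
          u '' (univ ×ˢ Icc 0 1) ⊆ B) ∧
    (∀ (H H' : C.AdmissibleHam) (Hs : Floer.Completion.MonotoneHomotopy H H')
        (J : ℝ → ℝ → C.CompatibleACS),
      Floer.Completion.SmoothACSFamily J →
      (∃ s₀ > 0, ∀ t ∈ Icc (0 : ℝ) 1,
        (∀ s ≤ -s₀, J s t = J (-s₀) t) ∧ (∀ s ≥ s₀, J s t = J s₀ t)) →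
      (∃ K : Set W,
        (∀ s, C.IsContactTypeHam K (Hs.slope s) (Hs.const s) (Hs.toFun s)) ∧
        ∀ s, ∀ t ∈ Icc (0 : ℝ) 1, (J s t).IsContactType K (Hs.slope s)) →
      ∃ B : Set W, IsCompact B ∧
        ∀ xm xp : ℝ → W, C.IsChord H.toFun xm → C.IsChord H'.toFun xp →
        ∀ u : ℝ × ℝ → W, C.IsFloerStrip Hs.toFun J xm xp u →
          u '' (univ ×ˢ Icc 0 1) ⊆ B) := by
  refine ⟨fun H J hJ hK => ?_, fun H H' Hs J hJ hs hK => ?_⟩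
  · obtain ⟨F, hH, hFJ⟩ := Floer.Completion.exists_floerFamily_const H J hJ hK
    have h := F.exists_isCompact_floerStrips
    rw [hH, hFJ] at h
    exact h
  · obtain ⟨F, hH, hFJ, h1, h2⟩ := Floer.Completion.exists_floerFamily_homotopy Hs J hJ hs hK
    have h := F.exists_isCompact_floerStrips
    rw [h1, h2, hH, hFJ] at h
    exact h
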